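/- Let $\mathbb{k}$ be a commutative ring with unit. Let $\mathbf{FI}$ be the category of finite sets and injections and $\mathbf{\Sigma}\subset\mathbf{FI}$ the category of finite sets and bijections. An $\mathbf{FI}^{\mathrm{op}}$-module (respectively a $\mathbf{\Sigma}^{\mathrm{op}}$-module) is a functor from $\mathbf{FI}^{\mathrm{op}}$ (respectively $\mathbf{\Sigma}^{\mathrm{op}}$) to $\mathbb{k}$-modules. The restriction functor $\downarrow$ from $\mathbf{FI}^{\mathrm{op}}$-modules to $\mathbf{\Sigma}^{\mathrm{op}}$-modules has a right adjoint $\uparrow$, with $\uparrow G(S)=\bigoplus_{S'\subseteq S}G(S')$, on which an injection $f:T\hookrightarrow S$ acts by zero on the summand of $S'$ if $S'\not\subseteq f(T)$, and otherwise by $G(S')\cong G(f^{-1}(S'))\subset\ \uparrow G(T)$. Let $\perp\,=\,\downarrow\uparrow$ be the associated comonad on $\mathbf{\Sigma}^{\mathrm{op}}$-modules, with comultiplication $\Delta:\perp\to\perp\perp$ and counit $\epsilon:\perp\to\mathrm{Id}$, and let $\eta:\mathrm{Id}\to\perp$ be given by the inclusions of the summands $G(S)\subset\bigoplus_{S'\subseteq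 S}G(S')$. The restriction to $\mathbf{\Sigma}^{\mathrm{op}}$ of an $\mathbf{FI}^{\mathrm{op}}$-module $F$ (again denoted $F$) is a $\perp$-comodule, with structure morphism $\psi_F:F\to\perp F$ induced by the unit of the adjunction. Let $\mathfrak{C}^\bullet F$ be the cosimplicial $\mathbf{\Sigma}^{\mathrm{op}}$-module with $\mathfrak{C}^nF=\perp^nF$, with cofaces $\perp^nF\to\perp^{n+1}F$ given by $d^0=\eta_{\perp^nF}$, $d^i=\perp^{i-1}\Delta_{\perp^{n-i}F}$ for $0<i<n+1$ and $d^{n+1}=\perp^n\psi_F$, and with codegeneracies $s^j=\perp^j\epsilon_{\perp^{n-j}F}:\perp^{n+1}F\to\perp^nF$ for $0\le j\le n$. Let $(\mathfrak{C}^\bullet F)^{\mathrm{op}}$ be the opposite cosimplicial object, with the same terms and with cofaces $\tilde d^i=d^{n+1-i}:\perp^nF\to\perp^{n+1}F$ and codegeneracies $\tilde s^j=s^{n-j}:\perp^{n+1}F\to\perp^nF$. For a cosimplicial object $C^\bullet$ let $N(C^\bullet)$ be its normalized cochain complex, with $N(C^\bullet)^n=\bigcap_{j=0}^{n-1}\ker(s^j:C^n\to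 C^{n-1})$ and with differential the restriction of $\sum_i(-1)^id^i$. For a finite set $T$ let $\mathrm{Or}(T)=\Lambda^{|T|}(\mathbb{k}T)$. The Koszul complex $\mathsf{Kz}\,F$ is the cochain complex of $\mathbf{\Sigma}^{\mathrm{op}}$-modules with $$(\mathsf{Kz}\,F)^t(S)=\bigoplus_{B\subseteq S,\ |S\setminus B|=t}F(B)\otimes\mathrm{Or}(S\setminus B)$$ for $t\in\mathbb{N}$, on which a bijection $g:S'\to S$ acts by maps $F(B)\otimes\mathrm{Or}(S\setminus B)\to F(g^{-1}(B))\otimes\mathrm{Or}(g^{-1}(S\setminus B))$ given by the actions of the restrictions of $g$ on the two factors, and with differential $$d(Y\otimes\alpha)=\sum_{x\in B}\iota_x^*Y\otimes(x\wedge\alpha),\qquad Y\in F(B),\ \alpha\in\mathrm{Or}(S\setminus B),$$ where $\iota_x:B\setminus\{x\}\hookrightarrow B$ is the inclusion. Theorem. There is a morphism of cochain complexes of $\mathbf{\Sigma}^{\mathrm{op}}$-modules $$N\big((\mathfrak{C}^\bullet F)^{\mathrm{op}}\big)\twoheadrightarrow\mathsf{Kz}\,F,$$ natural in the $\mathbf{FI}^{\mathrm{op}}$-module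 $F$, which is surjective and a quasi-isomorphism for every $F$. -/

import Mathlib

open CategoryTheory CategoryTheory.Limits Opposite
open scoped TensorProduct

universe v u

namespace FIop

/-! ### Cosimplicial objects and their normalized cochain complexes -/

/-- A cosimplicial object of `C`, given by its terms, cofaces and codegeneracies, which satisfy the
cosimplicial identities. -/
structure Cosimplicial (C : Type u) [Category.{v} C] where
  X : ℕ → C
  d : ∀ {n : ℕ}, Fin (n + 2) → (X n ⟶ X (n + 1))
  s : ∀ {n : ℕ}, Fin (n + 1) → (X (n + 1) ⟶ X n)
  d_d : ∀ {n : ℕ} (i j : Fin (n + 2)), i ≤ j → d i ≫ d j.succ = d j ≫ d i.castSucc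
  d_s_of_le : ∀ {n : ℕ} (i : Fin (n + 2)) (j : Fin (n + 1)), i ≤ j.castSucc →
    d i.castSucc ≫ s j.succ = s j ≫ d i
  d_s_self : ∀ {n : ℕ} (i : Fin (n + 1)), d i.castSucc ≫ s i = 𝟙 (X n)
  d_s_succ : ∀ {n : ℕ} (i : Fin (n + 1)), d i.succ ≫ s i = 𝟙 (X n)
  d_s_of_gt : ∀ {n : ℕ} (i : Fin (n + 2)) (j : Fin (n + 1)), j.castSucc < i →
    d i.succ ≫ s j.castSucc = s j ≫ d i
  s_s : ∀ {n : ℕ} (i j : Fin (n + 1)), i ≤ j → s i.castSucc ≫ s j = s j.succ ≫ s i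

namespace Cosimplicial

section Basic

variable {C : Type u} [Category.{v} C]

/-- Morphisms of cosimplicial objects. -/
@[ext]
structure Hom (A B : Cosimplicial C) where
  f : ∀ n, A.X n ⟶ B.X n
  comm_d : ∀ {n : ℕ} (i : Fin (n + 2)), A.d i ≫ f (n + 1) = f n ≫ B.d i
  comm_s : ∀ {n : ℕ} (j : Fin (n + 1)), A.s j ≫ f n = f (n + 1) ≫ B.s j

instance : Category (Cosimplicial C) where
  Hom := Hom
  id A := { f := fun _ => 𝟙 _, comm_d := by simp, comm_s := by simp }
  comp φ ψ :=
    { f := fun n => φ.f n ≫ ψ.f n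
      comm_d := fun i => by rw [← Category.assoc, φ.comm_d, Category.assoc, ψ.comm_d,
        Category.assoc]
      comm_s := fun i => by rw [← Category.assoc, φ.comm_s, Category.assoc, ψ.comm_s,
        Category.assoc] }
  id_comp φ := Hom.ext (funext fun _ => Category.id_comp _)
  comp_id φ := Hom.ext (funext fun _ => Category.comp_id _)
  assoc φ ψ χ := Hom.ext (funext fun _ => Category.assoc _ _ _)

@[simp] lemma id_f (A : Cosimplicial C) (n : ℕ) : Hom.f (𝟙 A) n = 𝟙 _ := rfl

@[simp] lemma comp_f {A B D : Cosimplicial C} (φ : A ⟶ B) (ψ : B ⟶ D) (n : ℕ) :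
    Hom.f (φ ≫ ψ) n = Hom.f φ n ≫ Hom.f ψ n := rfl

/-- The opposite cosimplicial object: `d̃ⁱ = dⁿ⁺¹⁻ⁱ` and `s̃ʲ = sⁿ⁻ʲ`. -/
def opp (A : Cosimplicial C) : Cosimplicial C where
  X := A.X
  d i := A.d i.rev
  s j := A.s j.rev
  d_d i j h := by
    have := A.d_d j.rev i.rev (Fin.rev_le_rev.mpr h)
    rw [Fin.rev_succ, Fin.rev_castSucc, this]
  d_s_of_le i j h := by
    rw [Fin.rev_castSucc, Fin.rev_succ]
    apply A.d_s_of_gt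
    rw [Fin.lt_def, Fin.val_castSucc, Fin.val_rev, Fin.val_rev]
    rw [Fin.le_def, Fin.val_castSucc] at h
    omega
  d_s_self i := by rw [Fin.rev_castSucc]; exact A.d_s_succ _
  d_s_succ i := by rw [Fin.rev_succ]; exact A.d_s_self _
  d_s_of_gt i j h := by
    rw [Fin.rev_castSucc, Fin.rev_succ]
    apply A.d_s_of_le
    rw [Fin.le_def, Fin.val_castSucc, Fin.val_rev, Fin.val_rev]
    rw [Fin.lt_def, Fin.val_castSucc] at h
    omega
  s_s i j h := by
    rw [Fin.rev_succ, Fin.rev_castSucc]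
    exact (A.s_s j.rev i.rev (Fin.rev_le_rev.mpr h)).symm

/-- The morphism of opposite cosimplicial objects given by a morphism. -/
def oppMap {A B : Cosimplicial C} (φ : Hom A B) : Hom A.opp B.opp where
  f := φ.f
  comm_d i := φ.comm_d i.rev
  comm_s j := φ.comm_s j.rev

/-- Passage to the opposite cosimplicial object, as a functor. -/
def oppFunctor : Cosimplicial C ⥤ Cosimplicial C where
  obj := opp
  map φ := oppMap φ

end Basic

section Normalized

variable {C : Type u} [Category.{v} C] [Abelian C]

/-- The differential of the unnormalized cochain complex. -/
def alt (A : Cosimplicial C) (n : ℕ) : A.X n ⟶ A.X (n + 1) :=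
  ∑ i : Fin (n + 2), (-1 : ℤ) ^ (i : ℕ) • A.d i

lemma alt_alt (A : Cosimplicial C) (n : ℕ) : A.alt n ≫ A.alt (n + 1) = 0 := by
  simp only [alt, Preadditive.comp_sum, Preadditive.sum_comp, ← Finset.sum_product']
  let P := Fin (n + 3) × Fin (n + 2)
  let S : Finset P := {ij : P | (ij.2 : ℕ) < (ij.1 : ℕ)}
  rw [Finset.univ_product_univ, ← Finset.sum_add_sum_compl S, ← eq_neg_iff_add_eq_zero,
    ← Finset.sum_neg_distrib]
  let φ : ∀ ij : P, ij ∈ S → P := fun ij hij =>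
    (ij.2.castSucc, ij.1.pred fun h => by
      rw [Finset.mem_filter, h] at hij; exact absurd hij.2 (Nat.not_lt_zero _))
  apply Finset.sum_bij φ
  · rintro ⟨i, j⟩ hij
    simp only [S, φ, Finset.compl_filter, Finset.mem_filter_univ, Fin.val_castSucc,
      Fin.val_pred, not_lt] at hij ⊢
    omega
  · rintro ⟨i, j⟩ hij ⟨i', j'⟩ hij' h
    obtain ⟨h1, h2⟩ := Prod.mk_inj.mp h
    rw [Fin.castSucc_inj] at h1
    rw [Fin.pred_inj] at h2
    exact Prod.ext h2 h1
  · rintro ⟨i, j⟩ hij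
    simp only [S, Finset.compl_filter, Finset.mem_filter_univ, not_lt] at hij
    refine ⟨(j.succ, ⟨i, by have := j.isLt; omega⟩), ?_, ?_⟩
    · rw [Finset.mem_filter_univ, Fin.val_succ]
      dsimp only
      omega
    · simp [φ]
  · rintro ⟨i, j⟩ hij
    simp only [S, Finset.mem_filter_univ] at hij
    obtain ⟨i, rfl⟩ : ∃ i' : Fin (n + 2), i = i'.succ :=
      ⟨⟨i - 1, by have := i.isLt; omega⟩, Fin.ext (by simp; omega)⟩
    have h := A.d_d j i (Nat.lt_succ_iff.mp (by simpa only [Fin.val_succ] using hij))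
    simp only [φ, Fin.pred_succ, Preadditive.zsmul_comp, Preadditive.comp_zsmul, smul_smul, h,
      ← neg_smul, Fin.val_succ, Fin.val_castSucc]
    congr 1
    ring

/-- The codegeneracies `sʲ : Aⁿ → Aⁿ⁻¹`, for `0 ≤ j ≤ n - 1` (there are none for `n = 0`). -/
def codegen (A : Cosimplicial C) : ∀ n : ℕ, Fin n → (A.X n ⟶ A.X (n - 1))
  | 0 => fun j => j.elim0
  | _ + 1 => fun j => A.s j

/-- The map `Aⁿ → ⨁ⱼ Aⁿ⁻¹` with components the codegeneracies. -/
noncomputable def degen (A : Cosimplicial C) (n : ℕ) : A.X n ⟶ ∏ᶜ fun _ : Fin n => A.X (n - 1) :=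
  Pi.lift (A.codegen n)

lemma comp_degen_eq_zero (A : Cosimplicial C) {Y : C} {n : ℕ} (f : Y ⟶ A.X n) :
    f ≫ A.degen n = 0 ↔ ∀ j, f ≫ A.codegen n j = 0 := by
  constructor
  · intro h j
    rw [← Pi.lift_π (A.codegen n) j, ← Category.assoc]
    exact (congrArg (· ≫ Pi.π _ j) h).trans zero_comp
  · intro h
    refine Pi.hom_ext _ _ fun j => ?_
    rw [Category.assoc, degen, Pi.lift_π, h, zero_comp]

/-- The term `N(A)ⁿ = ker (Aⁿ → ⨁ⱼ Aⁿ⁻¹)` of the normalized cochain complex. -/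
noncomputable def normX (A : Cosimplicial C) (n : ℕ) : C := kernel (A.degen n)

/-- The inclusion of `N(A)ⁿ` in `Aⁿ`. -/
noncomputable def normι (A : Cosimplicial C) (n : ℕ) : A.normX n ⟶ A.X n := kernel.ι (A.degen n)

instance (A : Cosimplicial C) (n : ℕ) : Mono (A.normι n) :=
  inferInstanceAs (Mono (kernel.ι (A.degen n)))

lemma normι_s (A : Cosimplicial C) {n : ℕ} (j : Fin (n + 1)) : A.normι (n + 1) ≫ A.s j = 0 :=
  (A.comp_degen_eq_zero _).mp (kernel.condition _) j

lemma normι_alt_degen (A : Cosimplicial C) (n : ℕ) :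
    (A.normι n ≫ A.alt n) ≫ A.degen (n + 1) = 0 := by
  rw [comp_degen_eq_zero]
  intro j
  change (A.normι n ≫ A.alt n) ≫ A.s j = 0
  rw [Category.assoc, alt, Preadditive.sum_comp, Preadditive.comp_sum,
    Finset.sum_eq_add j.castSucc j.succ (Fin.castSucc_lt_succ).ne]
  · rw [Preadditive.zsmul_comp, Preadditive.zsmul_comp, A.d_s_self, A.d_s_succ, Fin.val_castSucc,
      Fin.val_succ, pow_succ]
    simp
  · rintro i - ⟨h1, h2⟩
    rw [Preadditive.zsmul_comp, Preadditive.comp_zsmul]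
    suffices h : A.normι n ≫ A.d i ≫ A.s j = 0 by rw [h, smul_zero]
    cases n with
    | zero =>
      exfalso
      have := i.isLt
      have := j.isLt
      rw [Ne, Fin.ext_iff, Fin.val_castSucc] at h1
      rw [Ne, Fin.ext_iff, Fin.val_succ] at h2
      omega
    | succ n =>
      rw [Ne, Fin.ext_iff, Fin.val_castSucc] at h1
      rw [Ne, Fin.ext_iff, Fin.val_succ] at h2
      rcases lt_or_gt_of_ne h1 with h | h
      · obtain ⟨i, rfl⟩ : ∃ i', i = Fin.castSucc i' :=
          ⟨⟨i, by have := j.isLt; omega⟩, rfl⟩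
        obtain ⟨j, rfl⟩ : ∃ j', j = Fin.succ j' :=
          ⟨⟨j - 1, by have := j.isLt; omega⟩, Fin.ext (by simp at h ⊢; omega)⟩
        rw [A.d_s_of_le i j (by simp [Fin.le_def] at h ⊢; omega), ← Category.assoc, normι_s,
          zero_comp]
      · obtain ⟨i, rfl⟩ : ∃ i', i = Fin.succ i' :=
          ⟨⟨i - 1, by have := i.isLt; omega⟩, Fin.ext (by simp; omega)⟩
        obtain ⟨j, rfl⟩ : ∃ j', j = Fin.castSucc j' :=
          ⟨⟨j, by have := i.isLt; simp at h2 h; omega⟩, rfl⟩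
        rw [A.d_s_of_gt i j (by simp [Fin.lt_def] at h h2 ⊢; omega), ← Category.assoc, normι_s,
          zero_comp]
  · simp
  · simp

/-- The differential of the normalized cochain complex, the restriction of that of the
unnormalized one. -/
noncomputable def normD (A : Cosimplicial C) (n : ℕ) : A.normX n ⟶ A.normX (n + 1) :=
  kernel.lift _ (A.normι n ≫ A.alt n) (A.normι_alt_degen n)

lemma normD_ι (A : Cosimplicial C) (n : ℕ) :
    A.normD n ≫ A.normι (n + 1) = A.normι n ≫ A.alt n := kernel.lift_ι _ _ _

lemma normD_ι_assoc (A : Cosimplicial C) (n : ℕ) {Y : C} (h : A.X (n + 1) ⟶ Y) :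
    A.normD n ≫ A.normι (n + 1) ≫ h = A.normι n ≫ A.alt n ≫ h := by
  rw [← Category.assoc, normD_ι, Category.assoc]

/-- The normalized cochain complex of a cosimplicial object. -/
noncomputable def norm (A : Cosimplicial C) : CochainComplex C ℕ :=
  CochainComplex.of A.normX A.normD fun n => by
    rw [← cancel_mono (A.normι _), Category.assoc, normD_ι, normD_ι_assoc, alt_alt, comp_zero,
      zero_comp]

lemma normι_f_degen {A B : Cosimplicial C} (φ : A ⟶ B) (n : ℕ) :
    (A.normι n ≫ Hom.f φ n) ≫ B.degen n = 0 := by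
  cases n with
  | zero =>
    rw [comp_degen_eq_zero]
    exact fun j => j.elim0
  | succ n =>
    rw [comp_degen_eq_zero]
    intro j
    change (A.normι (n + 1) ≫ Hom.f φ (n + 1)) ≫ B.s j = 0
    rw [Category.assoc, ← Hom.comm_s, ← Category.assoc, normι_s, zero_comp]

/-- The map induced by a morphism on the terms of the normalized cochain complexes. -/
noncomputable def normMap {A B : Cosimplicial C} (φ : A ⟶ B) (n : ℕ) : A.normX n ⟶ B.normX n :=
  kernel.lift _ (A.normι n ≫ Hom.f φ n) (normι_f_degen φ n)

lemma normMap_ι {A B : Cosimplicial C} (φ : A ⟶ B) (n : ℕ) :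
    normMap φ n ≫ B.normι n = A.normι n ≫ Hom.f φ n := kernel.lift_ι _ _ _

lemma normMap_ι_assoc {A B : Cosimplicial C} (φ : A ⟶ B) (n : ℕ) {Y : C} (h : B.X n ⟶ Y) :
    normMap φ n ≫ B.normι n ≫ h = A.normι n ≫ Hom.f φ n ≫ h := by
  rw [← Category.assoc, normMap_ι, Category.assoc]

lemma alt_f {A B : Cosimplicial C} (φ : A ⟶ B) (n : ℕ) :
    A.alt n ≫ Hom.f φ (n + 1) = Hom.f φ n ≫ B.alt n := by
  simp only [alt, Preadditive.sum_comp, Preadditive.comp_sum, Preadditive.zsmul_comp,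
    Preadditive.comp_zsmul, Hom.comm_d]

/-- The normalized cochain complex, as a functor. -/
noncomputable def normFunctor (C : Type u) [Category.{v} C] [Abelian C] :
    Cosimplicial C ⥤ CochainComplex C ℕ where
  obj := norm
  map {A B} φ := CochainComplex.ofHom (V := C) (normMap φ) fun n => by
    dsimp only [norm]
    rw [CochainComplex.of_d, CochainComplex.of_d]
    change normMap φ n ≫ B.normD n = A.normD n ≫ normMap φ (n + 1)
    rw [← cancel_mono (B.normι _), Category.assoc, Category.assoc, normD_ι, normMap_ι,
      normMap_ι_assoc, normD_ι_assoc, alt_f]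
  map_id A := by
    ext n
    change normMap (𝟙 A) n = 𝟙 (A.normX n)
    rw [← cancel_mono (A.normι _), normMap_ι, id_f, Category.comp_id, Category.id_comp]
  map_comp {A B D} φ ψ := by
    ext n
    change normMap (φ ≫ ψ) n = normMap φ n ≫ normMap ψ n
    rw [← cancel_mono (D.normι _), normMap_ι, comp_f, Category.assoc, normMap_ι, normMap_ι_assoc]

end Normalized

end Cosimplicial

/-! ### The cobar-type cosimplicial object of a comodule over a coaugmented comonad -/

section Cobar

variable {C : Type u} [Category.{v} C]

/-- A coaugmentation of a comonad `(⊥, Δ, ε)`: a natural transformation `η : Id → ⊥` such that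
`ε ∘ η = 1` and `Δ ∘ η = η_⊥ ∘ η`. -/
structure Coaugmentation (G : Comonad C) where
  η : 𝟭 C ⟶ G.toFunctor
  η_ε : ∀ Y : C, η.app Y ≫ G.ε.app Y = 𝟙 Y
  η_δ : ∀ Y : C, η.app Y ≫ G.δ.app Y = η.app Y ≫ η.app (G.obj Y)

variable {G : Comonad C} (c : Coaugmentation G)

lemma Coaugmentation.η_naturality {Y Z : C} (f : Y ⟶ Z) :
    f ≫ c.η.app Z = c.η.app Y ≫ G.map f := c.η.naturality f

/-- The iterate `⊥ⁿ Y`. -/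
def iter (G : Comonad C) (Y : C) : ℕ → C
  | 0 => Y
  | n + 1 => G.obj (iter G Y n)

/-- The cofaces `⊥ⁿ M → ⊥ⁿ⁺¹ M` of a comodule `(M, ψ)`: these are `d⁰ = η_{⊥ⁿ M}`,
`dⁱ = ⊥ⁱ⁻¹ Δ_{⊥ⁿ⁻ⁱ M}` for `0 < i < n + 1`, and `dⁿ⁺¹ = ⊥ⁿ ψ`. -/
def cobarD (M : G.Coalgebra) : ∀ n : ℕ, Fin (n + 2) → (iter G M.A n ⟶ iter G M.A (n + 1))
  | 0 => Fin.cases (c.η.app M.A) fun _ => M.a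
  | n + 1 => Fin.cases (c.η.app (G.obj (iter G M.A n)))
      (Fin.cases (G.δ.app (iter G M.A n)) fun i => G.map (cobarD M n i.succ))

/-- The codegeneracies `sʲ = ⊥ʲ ε_{⊥ⁿ⁻ʲ Y} : ⊥ⁿ⁺¹ Y → ⊥ⁿ Y`, for `0 ≤ j ≤ n`. -/
def cobarS (G : Comonad C) (Y : C) : ∀ n : ℕ, Fin (n + 1) → (iter G Y (n + 1) ⟶ iter G Y n)
  | 0 => fun _ => G.ε.app Y
  | n + 1 => Fin.cases (G.ε.app (G.obj (iter G Y n))) fun j => G.map (cobarS G Y n j)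

lemma cobarD_zero (M : G.Coalgebra) (n : ℕ) :
    cobarD c M n 0 = c.η.app (iter G M.A n) := by
  cases n <;> rfl

lemma cobarS_zero (Y : C) (n : ℕ) : cobarS G Y n 0 = G.ε.app (iter G Y n) := by
  cases n <;> rfl

lemma cobarD_succ_one (M : G.Coalgebra) (n : ℕ) :
    cobarD c M (n + 1) (Fin.succ 0) = G.δ.app (iter G M.A n) := rfl

lemma cobarD_succ_succ (M : G.Coalgebra) (n : ℕ) (i : Fin (n + 1)) :
    cobarD c M (n + 1) i.succ.succ = G.map (cobarD c M n i.succ) := rfl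

lemma cobarS_succ (Y : C) (n : ℕ) (j : Fin (n + 1)) :
    cobarS G Y (n + 1) j.succ = G.map (cobarS G Y n j) := rfl

lemma cobar_d_d (M : G.Coalgebra) (n : ℕ) : ∀ i j : Fin (n + 2), i ≤ j →
    cobarD c M n i ≫ cobarD c M (n + 1) j.succ =
      cobarD c M n j ≫ cobarD c M (n + 1) i.castSucc := by
  induction n with
  | zero =>
    intro i j h
    induction i using Fin.cases with
    | zero =>
      induction j using Fin.cases with
      | zero => exact c.η_δ M.A
      | succ j => exact (c.η_naturality M.a).symm
    | succ i =>
      induction j using Fin.cases with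
      | zero => exact absurd h (by simp)
      | succ j =>
        obtain rfl := Fin.fin_one_eq_zero i
        obtain rfl := Fin.fin_one_eq_zero j
        exact M.coassoc.symm
  | succ n ih =>
    intro i j h
    induction i using Fin.cases with
    | zero =>
      induction j using Fin.cases with
      | zero => exact c.η_δ _
      | succ j => exact (c.η_naturality (cobarD c M (n + 1) j.succ)).symm
    | succ i =>
      induction j using Fin.cases with
      | zero => exact absurd h (by simp)
      | succ j =>
        induction i using Fin.cases with
        | zero =>
          induction j using Fin.cases with
          | zero => exact G.coassoc _
          | succ j => exact (G.δ.naturality (cobarD c M n j.succ)).symm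
        | succ i =>
          induction j using Fin.cases with
          | zero => exact absurd h (by simp [Fin.le_def])
          | succ j =>
            have := ih i.succ j.succ (Fin.succ_le_succ_iff.mp h)
            exact (G.map_comp _ _).symm.trans ((congrArg G.map this).trans (G.map_comp _ _))

lemma cobar_d_s_of_le (M : G.Coalgebra) (n : ℕ) : ∀ (i : Fin (n + 2)) (j : Fin (n + 1)),
    i ≤ j.castSucc → cobarD c M (n + 1) i.castSucc ≫ cobarS G M.A (n + 1) j.succ =
      cobarS G M.A n j ≫ cobarD c M n i := by
  induction n with
  | zero =>
    intro i j h
    obtain rfl := Fin.fin_one_eq_zero j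
    obtain rfl : i = 0 := Fin.le_zero_iff.mp h
    exact (c.η_naturality _).symm
  | succ n ih =>
    intro i j h
    induction i using Fin.cases with
    | zero => exact (c.η_naturality _).symm
    | succ i =>
      induction j using Fin.cases with
      | zero => exact absurd h (by simp)
      | succ j =>
        induction i using Fin.cases with
        | zero => exact (G.δ.naturality (cobarS G M.A n j)).symm
        | succ i =>
          have := ih i.succ j (by simpa [Fin.le_def] using h)
          exact (G.map_comp _ _).symm.trans ((congrArg G.map this).trans (G.map_comp _ _))

lemma cobar_d_s_self (M : G.Coalgebra) (n : ℕ) : ∀ i : Fin (n + 1),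
    cobarD c M n i.castSucc ≫ cobarS G M.A n i = 𝟙 (iter G M.A n) := by
  induction n with
  | zero =>
    intro i
    obtain rfl := Fin.fin_one_eq_zero i
    exact c.η_ε _
  | succ n ih =>
    intro i
    induction i using Fin.cases with
    | zero => exact c.η_ε _
    | succ i =>
      induction i using Fin.cases with
      | zero =>
        refine Eq.trans ?_ (G.right_counit (iter G M.A n))
        exact congrArg (fun f => G.δ.app (iter G M.A n) ≫ G.map f) (cobarS_zero M.A n)
      | succ i =>
        have := ih i.succ
        exact (G.map_comp _ _).symm.trans ((congrArg G.map this).trans (G.map_id _))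

lemma cobar_d_s_succ (M : G.Coalgebra) (n : ℕ) : ∀ i : Fin (n + 1),
    cobarD c M n i.succ ≫ cobarS G M.A n i = 𝟙 (iter G M.A n) := by
  induction n with
  | zero =>
    intro i
    exact M.counit
  | succ n ih =>
    intro i
    induction i using Fin.cases with
    | zero => exact G.left_counit _
    | succ i =>
      have := ih i
      exact (G.map_comp _ _).symm.trans ((congrArg G.map this).trans (G.map_id _))

lemma cobar_d_s_of_gt (M : G.Coalgebra) (n : ℕ) : ∀ (i : Fin (n + 2)) (j : Fin (n + 1)),
    j.castSucc < i → cobarD c M (n + 1) i.succ ≫ cobarS G M.A (n + 1) j.castSucc =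
      cobarS G M.A n j ≫ cobarD c M n i := by
  induction n with
  | zero =>
    intro i j h
    obtain rfl := Fin.fin_one_eq_zero j
    induction i using Fin.cases with
    | zero => exact absurd h (by simp)
    | succ i => exact G.ε.naturality M.a
  | succ n ih =>
    intro i j h
    induction i using Fin.cases with
    | zero => exact absurd h (by simp)
    | succ i =>
      induction j using Fin.cases with
      | zero => exact G.ε.naturality (cobarD c M (n + 1) i.succ)
      | succ j =>
        induction i using Fin.cases with
        | zero => exact absurd h (by simp [Fin.lt_def])
        | succ i =>
          have := ih i.succ j (by simpa [Fin.lt_def] using h)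
          exact (G.map_comp _ _).symm.trans ((congrArg G.map this).trans (G.map_comp _ _))

lemma cobar_s_s (Y : C) (n : ℕ) : ∀ i j : Fin (n + 1), i ≤ j →
    cobarS G Y (n + 1) i.castSucc ≫ cobarS G Y n j =
      cobarS G Y (n + 1) j.succ ≫ cobarS G Y n i := by
  induction n with
  | zero =>
    intro i j _
    obtain rfl := Fin.fin_one_eq_zero i
    obtain rfl := Fin.fin_one_eq_zero j
    exact (G.ε.naturality _).symm
  | succ n ih =>
    intro i j h
    induction i using Fin.cases with
    | zero => exact (G.ε.naturality _).symm
    | succ i =>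
      induction j using Fin.cases with
      | zero => exact absurd h (by simp)
      | succ j =>
        have := ih i j (Fin.succ_le_succ_iff.mp h)
        exact (G.map_comp _ _).symm.trans ((congrArg G.map this).trans (G.map_comp _ _))

/-- The cobar-type cosimplicial object `ℭ M` of a comodule `M`, with `ℭⁿ M = ⊥ⁿ M`. -/
def cobar (M : G.Coalgebra) : Cosimplicial C where
  X := iter G M.A
  d {n} := cobarD c M n
  s {n} := cobarS G M.A n
  d_d {n} := cobar_d_d c M n
  d_s_of_le {n} := cobar_d_s_of_le c M n
  d_s_self {n} := cobar_d_s_self c M n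
  d_s_succ {n} := cobar_d_s_succ c M n
  d_s_of_gt {n} := cobar_d_s_of_gt c M n
  s_s {n} := cobar_s_s M.A n

/-- The map induced by a morphism on iterates. -/
def iterMap (G : Comonad C) {Y Z : C} (f : Y ⟶ Z) : ∀ n : ℕ, iter G Y n ⟶ iter G Z n
  | 0 => f
  | n + 1 => G.map (iterMap G f n)

/-- The morphism of cobar-type cosimplicial objects induced by a morphism of comodules. -/
def cobarMap {M N : G.Coalgebra} (φ : M ⟶ N) : Cosimplicial.Hom (cobar c M) (cobar c N) where
  f := iterMap G φ.f
  comm_d {n} i := by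
    induction n with
    | zero =>
      induction i using Fin.cases with
      | zero => exact (c.η_naturality φ.f).symm
      | succ i => exact φ.h
    | succ n ih =>
      induction i using Fin.cases with
      | zero => exact (c.η_naturality (iterMap G φ.f (n + 1))).symm
      | succ i =>
        induction i using Fin.cases with
        | zero => exact (G.δ.naturality (iterMap G φ.f n)).symm
        | succ i =>
          exact (G.map_comp _ _).symm.trans ((congrArg G.map (ih i.succ)).trans (G.map_comp _ _))
  comm_s {n} j := by
    induction n with
    | zero => exact (G.ε.naturality φ.f).symm
    | succ n ih =>
      induction j using Fin.cases with
      | zero => exact (G.ε.naturality (iterMap G φ.f (n + 1))).symm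
      | succ j =>
        exact (G.map_comp _ _).symm.trans ((congrArg G.map (ih j)).trans (G.map_comp _ _))

lemma iterMap_id (G : Comonad C) (Y : C) (n : ℕ) : iterMap G (𝟙 Y) n = 𝟙 _ := by
  induction n with
  | zero => rfl
  | succ n ih => exact (congrArg G.map ih).trans (G.map_id _)

lemma iterMap_comp (G : Comonad C) {Y Z W : C} (f : Y ⟶ Z) (g : Z ⟶ W) (n : ℕ) :
    iterMap G (f ≫ g) n = iterMap G f n ≫ iterMap G g n := by
  induction n with
  | zero => rfl
  | succ n ih => exact (congrArg G.map ih).trans (G.map_comp _ _)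

/-- The cobar-type cosimplicial object, as a functor on comodules. -/
def cobarFunctor : G.Coalgebra ⥤ Cosimplicial C where
  obj := cobar c
  map φ := cobarMap c φ
  map_id M := Cosimplicial.Hom.ext (funext fun n => iterMap_id G M.A n)
  map_comp φ ψ := Cosimplicial.Hom.ext (funext fun n => iterMap_comp G φ.f ψ.f n)

end Cobar

/-! ### Modules over finite sets and injections, and over finite sets and bijections -/

/-- The category of finite sets and injections. -/
structure FI where
  carrier : Type
  [finite : Finite carrier]

/-- The category of finite sets and bijections. -/
structure Sig where
  carrier : Type
  [finite : Finite carrier]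

instance : CoeSort FI Type := ⟨FI.carrier⟩
instance : CoeSort Sig Type := ⟨Sig.carrier⟩
instance (S : FI) : Finite S := S.finite
instance (S : Sig) : Finite S := S.finite

instance : Category FI where
  Hom S T := S ↪ T
  id S := Function.Embedding.refl S
  comp f g := Function.Embedding.trans f g

instance : Category Sig where
  Hom S T := S ≃ T
  id S := Equiv.refl S
  comp f g := Equiv.trans f g

/-- The inclusion of the finite sets and bijections in the finite sets and injections. -/
def sigToFI : Sig ⥤ FI where
  obj S := ⟨S⟩
  map f := Equiv.toEmbedding f

/-- A subset of a finite set, as a finite set. -/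
abbrev Sig.sub (S : Sig) (B : Set S) : Sig := ⟨B⟩

/-- A subset of a finite set, as a finite set. -/
abbrev FI.sub (S : FI) (B : Set S) : FI := ⟨B⟩

section Modules

variable (k : Type u) [CommRing k]

/-- The category of `𝐅𝐈ᵒᵖ`-modules. -/
abbrev FIopMod := FIᵒᵖ ⥤ ModuleCat.{u} k

/-- The category of `𝚺ᵒᵖ`-modules. -/
abbrev SigopMod := Sigᵒᵖ ⥤ ModuleCat.{u} k

/-- The restriction of `𝐅𝐈ᵒᵖ`-modules to `𝚺ᵒᵖ`-modules. -/
abbrev down : FIopMod k ⥤ SigopMod k := (Functor.whiskeringLeft _ _ _).obj sigToFI.op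

variable {k}

lemma module_ext {D : Type*} [Category D] {F G : D ⥤ ModuleCat.{u} k} {φ ψ : F ⟶ G}
    (h : ∀ (S : D) (y : F.obj S), (φ.app S).hom y = (ψ.app S).hom y) : φ = ψ :=
  NatTrans.ext (funext fun S => ModuleCat.hom_ext (LinearMap.ext (h S)))

/-- The action `G(T) → G(S)` of a bijection `e : S ≃ T` on a `𝚺ᵒᵖ`-module `G`. -/
def act (G : SigopMod k) {S T : Type} [Finite S] [Finite T] (e : S ≃ T) :
    G.obj (op ⟨T⟩) →ₗ[k] G.obj (op ⟨S⟩) :=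
  (G.map (Quiver.Hom.op (show (⟨S⟩ : Sig) ⟶ ⟨T⟩ from e))).hom

lemma act_refl (G : SigopMod k) {S : Type} [Finite S] (y : G.obj (op ⟨S⟩)) :
    act G (Equiv.refl S) y = y :=
  congrArg (fun f => f.hom y) (G.map_id (op ⟨S⟩))

lemma act_act (G : SigopMod k) {S T U : Type} [Finite S] [Finite T] [Finite U] (e : S ≃ T)
    (f : T ≃ U) (y : G.obj (op ⟨U⟩)) : act G e (act G f y) = act G (e.trans f) y :=
  (congrArg (fun f => f.hom y) (G.map_comp (Quiver.Hom.op (show (⟨T⟩ : Sig) ⟶ ⟨U⟩ from f))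
    (Quiver.Hom.op (show (⟨S⟩ : Sig) ⟶ ⟨T⟩ from e)))).symm

lemma act_naturality {G H : SigopMod k} (φ : G ⟶ H) {S T : Type} [Finite S] [Finite T] (e : S ≃ T)
    (y : G.obj (op ⟨T⟩)) :
    (φ.app (op ⟨S⟩)).hom (act G e y) = act H e ((φ.app (op ⟨T⟩)).hom y) :=
  congrArg (fun f => f.hom y) (φ.naturality (Quiver.Hom.op (show (⟨S⟩ : Sig) ⟶ ⟨T⟩ from e)))

/-- The action `F(T) → F(S)` of an injection `f : S ↪ T` on an `𝐅𝐈ᵒᵖ`-module `F`. -/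
def pull (F : FIopMod k) {S T : Type} [Finite S] [Finite T] (f : S ↪ T) :
    F.obj (op ⟨T⟩) →ₗ[k] F.obj (op ⟨S⟩) :=
  (F.map (Quiver.Hom.op (show (⟨S⟩ : FI) ⟶ ⟨T⟩ from f))).hom

lemma pull_refl (F : FIopMod k) {S : Type} [Finite S] (y : F.obj (op ⟨S⟩)) :
    pull F (Function.Embedding.refl S) y = y :=
  congrArg (fun f => f.hom y) (F.map_id (op ⟨S⟩))

lemma pull_pull (F : FIopMod k) {S T U : Type} [Finite S] [Finite T] [Finite U] (e : S ↪ T)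
    (f : T ↪ U) (y : F.obj (op ⟨U⟩)) : pull F e (pull F f y) = pull F (e.trans f) y :=
  (congrArg (fun f => f.hom y) (F.map_comp (Quiver.Hom.op (show (⟨T⟩ : FI) ⟶ ⟨U⟩ from f))
    (Quiver.Hom.op (show (⟨S⟩ : FI) ⟶ ⟨T⟩ from e)))).symm

lemma pull_naturality {G H : FIopMod k} (φ : G ⟶ H) {S T : Type} [Finite S] [Finite T] (e : S ↪ T)
    (y : G.obj (op ⟨T⟩)) :
    (φ.app (op ⟨S⟩)).hom (pull G e y) = pull H e ((φ.app (op ⟨T⟩)).hom y) :=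
  congrArg (fun f => f.hom y) (φ.naturality (Quiver.Hom.op (show (⟨S⟩ : FI) ⟶ ⟨T⟩ from e)))

/-- The bijection `B ≃ f(B)` given by an injection `f`. -/
noncomputable def imageEquiv {S T : Type} (f : S ↪ T) (B : Set S) : B ≃ (f '' B : Set T) :=
  Equiv.Set.image f B f.injective

lemma imageEquiv_coe {S T : Type} (f : S ↪ T) (B : Set S) (x : B) :
    (imageEquiv f B x : T) = f x := rfl

/-- Components of a family indexed by subsets, viewed through bijections with subsets, depend only
on the underlying injection. -/
lemma act_congr (G : SigopMod k) {S T : Type} [Finite S] [Finite T]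
    (z : ∀ B : Set T, G.obj (op ⟨B⟩)) {B B' : Set T} (e : S ≃ B) (e' : S ≃ B')
    (h : ∀ x, (e x : T) = e' x) : act G e (z B) = act G e' (z B') := by
  obtain rfl : B = B' := by
    ext t
    constructor
    · intro ht
      obtain ⟨x, hx⟩ := e.surjective ⟨t, ht⟩
      have h1 : t = e' x := by rw [← h x, hx]
      exact h1 ▸ (e' x).2
    · intro ht
      obtain ⟨x, hx⟩ := e'.surjective ⟨t, ht⟩
      have h1 : t = e x := by rw [h x, hx]
      exact h1 ▸ (e x).2
  obtain rfl : e = e' := Equiv.ext fun x => Subtype.ext (h x)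
  rfl

/-- The action of an injection `f : S ↪ T` on `⨁_{B ⊆ T} G(B)`: the component at `B ⊆ S` of the
image of `z` is obtained from the component of `z` at `f(B)` by the bijection `B ≃ f(B)`. So the
summand of `B' ⊆ T` is mapped to zero if `B'` is not contained in `f(S)`. -/
noncomputable def upMap (G : SigopMod k) {S T : Type} [Finite S] [Finite T] (f : S ↪ T) :
    (∀ B : Set T, G.obj (op ⟨B⟩)) →ₗ[k] (∀ B : Set S, G.obj (op ⟨B⟩)) :=
  LinearMap.pi fun B => act G (imageEquiv f B) ∘ₗ LinearMap.proj (f '' B : Set T)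

lemma upMap_apply (G : SigopMod k) {S T : Type} [Finite S] [Finite T] (f : S ↪ T)
    (z : ∀ B : Set T, G.obj (op ⟨B⟩)) (B : Set S) :
    upMap G f z B = act G (imageEquiv f B) (z (f '' B)) := rfl

lemma act_upMap (G : SigopMod k) {A S T : Type} [Finite A] [Finite S] [Finite T] (f : S ↪ T)
    (z : ∀ B : Set T, G.obj (op ⟨B⟩)) {B : Set S} {B' : Set T} (e : A ≃ B) (e' : A ≃ B')
    (h : ∀ x, f (e x) = e' x) : act G e (upMap G f z B) = act G e' (z B') := by
  rw [upMap_apply, act_act]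
  exact act_congr G z _ _ h

/-- The `𝐅𝐈ᵒᵖ`-module `↑G : S ↦ ⨁_{B ⊆ S} G(B)` given by a `𝚺ᵒᵖ`-module `G`. (The sum is finite,
and written as a product.) -/
noncomputable def upObj (G : SigopMod k) : FIopMod k where
  obj S := ModuleCat.of k (∀ B : Set S.unop, G.obj (op ⟨B⟩))
  map f := ModuleCat.ofHom (upMap G f.unop)
  map_id S := by
    refine ModuleCat.hom_ext (LinearMap.ext fun z => funext fun B => ?_)
    exact (act_congr G z (imageEquiv (Function.Embedding.refl S.unop) B) (Equiv.refl B)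
      fun x => rfl).trans (act_refl G _)
  map_comp {S T U} f g := by
    refine ModuleCat.hom_ext (LinearMap.ext fun z => funext fun B => ?_)
    exact (act_upMap G f.unop z _ _ fun x => rfl).symm

/-- The functor `↑` from `𝚺ᵒᵖ`-modules to `𝐅𝐈ᵒᵖ`-modules. -/
noncomputable def up : SigopMod k ⥤ FIopMod k where
  obj := upObj
  map φ :=
    { app := fun S => ModuleCat.ofHom
        (LinearMap.pi fun B => (φ.app (op ⟨B⟩)).hom ∘ₗ LinearMap.proj B)
      naturality := fun S T f => by
        refine ModuleCat.hom_ext (LinearMap.ext fun z => funext fun B => ?_)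
        exact act_naturality φ _ _ }

/-- The unit `F → ↑↓F` has components `F(S) → F(B)` induced by the inclusions `B ⊆ S`. -/
noncomputable def upUnit (F : FIopMod k) : F ⟶ up.obj ((down k).obj F) where
  app S := ModuleCat.ofHom (LinearMap.pi fun B : Set S.unop =>
    pull F (Function.Embedding.subtype (· ∈ B)))
  naturality S T f := by
    refine ModuleCat.hom_ext (LinearMap.ext fun z => funext fun B => ?_)
    let g : T.unop.carrier ↪ S.unop.carrier := f.unop
    have h1 := pull_pull F (Function.Embedding.subtype (· ∈ B)) g z
    have h2 := pull_pull F (imageEquiv g B).toEmbedding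
      (Function.Embedding.subtype (· ∈ g '' B)) z
    exact h1.trans h2.symm

/-- The counit `↓↑G → G` is the projection to the summand `G(S)` of `⨁_{B ⊆ S} G(B)`. -/
noncomputable def upCounit (G : SigopMod k) : (down k).obj (up.obj G) ⟶ G where
  app S := ModuleCat.ofHom (act G (Equiv.Set.univ S.unop).symm ∘ₗ LinearMap.proj Set.univ)
  naturality S T f := by
    refine ModuleCat.hom_ext (LinearMap.ext fun z => ?_)
    refine (act_upMap G (Equiv.toEmbedding f.unop) z _
      (Equiv.trans f.unop (Equiv.Set.univ S.unop).symm) fun x => rfl).trans ?_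
    exact (act_act G f.unop (Equiv.Set.univ S.unop).symm (z Set.univ)).symm

variable (k) in
/-- The adjunction `↓ ⊣ ↑`. -/
noncomputable def adj : down k ⊣ up where
  unit :=
    { app := upUnit
      naturality := fun F H φ => by
        refine module_ext fun S z => funext fun B => ?_
        exact (pull_naturality φ _ z).symm }
  counit :=
    { app := upCounit
      naturality := fun G H φ => by
        refine module_ext fun S z => ?_
        exact (act_naturality φ _ (z Set.univ)).symm }
  left_triangle_components F := by
    refine module_ext fun S z => ?_
    have h := pull_pull F (Equiv.Set.univ S.unop).symm.toEmbedding
      (Function.Embedding.subtype (· ∈ (Set.univ : Set S.unop))) z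
    exact h.trans (pull_refl F z)
  right_triangle_components G := by
    refine module_ext fun S z => funext fun B => ?_
    refine (act_upMap G (Function.Embedding.subtype (· ∈ B)) z _ (Equiv.refl B)
      fun x => rfl).trans (act_refl G _)

variable (k) in
/-- The comonad `⊥ = ↓↑` on `𝚺ᵒᵖ`-modules. -/
noncomputable abbrev perp : Comonad (SigopMod k) := (adj k).toComonad

open Classical in
/-- The inclusion of the summand `G(S)` in `⨁_{B ⊆ S} G(B)`. -/
noncomputable def incl (G : SigopMod k) (S : Type) [Finite S] :
    G.obj (op ⟨S⟩) →ₗ[k] (∀ B : Set S, G.obj (op ⟨B⟩)) :=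
  LinearMap.pi fun B =>
    if h : B = Set.univ then act G ((Equiv.setCongr h).trans (Equiv.Set.univ S)) else 0

lemma incl_univ (G : SigopMod k) {S : Type} [Finite S] (y : G.obj (op ⟨S⟩)) :
    incl G S y Set.univ = act G (Equiv.Set.univ S) y := by
  simp only [incl, LinearMap.pi_apply, dite_true]
  rfl

lemma incl_of_eq (G : SigopMod k) {A S : Type} [Finite A] [Finite S] (y : G.obj (op ⟨S⟩))
    {B : Set S} (e : A ≃ B) (e' : A ≃ S) (h : ∀ x, (e x : S) = e' x) :
    act G e (incl G S y B) = act G e' y := by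
  obtain rfl : B = Set.univ := Set.eq_univ_of_forall fun s => by
    obtain ⟨x, rfl⟩ := e'.surjective s
    exact h x ▸ (e x).2
  rw [incl_univ, act_act]
  congr 2
  exact Equiv.ext h

lemma incl_of_ne (G : SigopMod k) {S : Type} [Finite S] (y : G.obj (op ⟨S⟩))
    {B : Set S} (h : B ≠ Set.univ) : incl G S y B = 0 := by
  simp [incl, h]

variable (k) in
/-- The coaugmentation `η : Id → ⊥`, given by the inclusions of `G(S)` in `⨁_{B ⊆ S} G(B)`. -/
noncomputable def coaug : Coaugmentation (perp k) where
  η :=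
    { app := fun G =>
        { app := fun S => ModuleCat.ofHom (incl G S.unop)
          naturality := fun S T f => by
            refine ModuleCat.hom_ext (LinearMap.ext fun y => funext fun B => ?_)
            by_cases h : B = Set.univ
            · subst h
              refine (incl_univ G _).trans ((act_act G _ _ y).trans ?_)
              exact (incl_of_eq G y _ _ fun x => rfl).symm
            · refine (incl_of_ne G _ h).trans (Eq.symm ?_)
              refine (congrArg (act G _) (incl_of_ne G y ?_)).trans (map_zero (act G _))
              intro h1
              refine h (Set.eq_univ_of_forall fun t => ?_)
              let e : T.unop.carrier ≃ S.unop.carrier := f.unop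
              have h2 : e t ∈ e '' B := (Set.ext_iff.mp h1 (e t)).mpr (Set.mem_univ _)
              exact e.injective.mem_set_image.mp h2 }
      naturality := fun G H φ => by
        refine module_ext fun S y => funext fun B => ?_
        by_cases h : B = Set.univ
        · subst h
          refine Eq.symm ((congrArg (φ.app (op ⟨(Set.univ : Set S.unop)⟩)).hom
            (incl_univ G y)).trans ?_)
          exact (act_naturality φ _ y).trans (incl_univ H _).symm
        · exact Eq.symm ((congrArg (φ.app (op ⟨B⟩)).hom (incl_of_ne G y h)).trans
            ((map_zero (φ.app (op ⟨B⟩)).hom).trans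
              (incl_of_ne H ((φ.app S).hom y) h).symm)) }
  η_ε G := by
    refine module_ext fun S y => ?_
    exact (incl_of_eq G y _ (Equiv.refl _) fun x => rfl).trans (act_refl G y)
  η_δ G := by
    refine module_ext fun S y => funext fun B => funext fun B' => ?_
    by_cases h : B = Set.univ
    · subst h
      refine Eq.trans ?_ (congrFun (incl_univ ((perp k).obj G) (incl G S.unop y)).symm B')
      exact act_congr G (incl G S.unop y) (imageEquiv (Function.Embedding.subtype _) B')
        (imageEquiv (Equiv.Set.univ S.unop).toEmbedding B') fun x => rfl
    · refine Eq.trans ?_ (congrFun (incl_of_ne ((perp k).obj G) (incl G S.unop y) h).symm B')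
      refine (congrArg (act G _) (incl_of_ne G y ?_)).trans (map_zero (act G _))
      intro h1
      refine h (Set.eq_univ_of_forall fun t => ?_)
      obtain ⟨x, -, rfl⟩ := h1 ▸ Set.mem_univ t
      exact x.2

variable (k) in
/-- The cobar-type cosimplicial `𝚺ᵒᵖ`-module `ℭF` of an `𝐅𝐈ᵒᵖ`-module `F`, viewed as a
`⊥`-comodule. -/
noncomputable def cobarFI : FIopMod k ⥤ Cosimplicial (SigopMod k) :=
  Comonad.comparison (adj k) ⋙ cobarFunctor (coaug k)

variable (k) in
/-- The normalized complex `N((ℭF)ᵒᵖ)`, as a functor of the `𝐅𝐈ᵒᵖ`-module `F`. -/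
noncomputable def normCobar : FIopMod k ⥤ CochainComplex (SigopMod k) ℕ :=
  cobarFI k ⋙ Cosimplicial.oppFunctor ⋙ Cosimplicial.normFunctor (SigopMod k)


/-! ### The Koszul complex -/

variable (k) in
/-- The exterior power `Λᵗ(kS)`. If `S` has `t` elements, it is the orientation module of `S`. -/
abbrev orient (S : Type) (t : ℕ) : Type u := ⋀[k]^t (S →₀ k)

/-- The map of exterior powers induced by a map of sets. -/
noncomputable def orientMap {S T : Type} (t : ℕ) (f : S → T) : orient k S t →ₗ[k] orient k T t :=
  exteriorPower.map t (Finsupp.lmapDomain k k f)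

/-- The map `α ↦ x ∧ α`. -/
noncomputable def wedge {S : Type} (t : ℕ) (x : S) : orient k S t →ₗ[k] orient k S (t + 1) :=
  (LinearMap.mulLeft k (ExteriorAlgebra.ι k (Finsupp.single x (1 : k)))).restrict fun a ha => by
    have h := Submodule.mul_mem_mul
      (LinearMap.mem_range_self (ExteriorAlgebra.ι k) (Finsupp.single x (1 : k))) ha
    rwa [← pow_succ'] at h

lemma wedge_coe {S : Type} (t : ℕ) (x : S) (a : orient k S t) :
    (wedge t x a : ExteriorAlgebra k (S →₀ k)) =
      ExteriorAlgebra.ι k (Finsupp.single x (1 : k)) * a := rfl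

lemma orientMap_coe {S T : Type} (t : ℕ) (f : S → T) (a : orient k S t) :
    (orientMap t f a : ExteriorAlgebra k (T →₀ k)) =
      ExteriorAlgebra.map (Finsupp.lmapDomain k k f) a := by
  have h : (⋀[k]^t (T →₀ k)).subtype ∘ₗ orientMap t f =
      (ExteriorAlgebra.map (Finsupp.lmapDomain k k f)).toLinearMap ∘ₗ (⋀[k]^t (S →₀ k)).subtype := by
    refine exteriorPower.linearMap_ext (AlternatingMap.ext fun m => ?_)
    simp [orientMap, exteriorPower.map_apply_ιMulti, ExteriorAlgebra.map_apply_ιMulti]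
  exact congrArg (fun g => g a) h

lemma wedge_wedge {S : Type} (t : ℕ) (x y : S) (a : orient k S t) :
    wedge (t + 1) x (wedge t y a) + wedge (t + 1) y (wedge t x a) = 0 := by
  apply Subtype.ext
  rw [Submodule.coe_add, wedge_coe, wedge_coe, wedge_coe, wedge_coe, ← mul_assoc, ← mul_assoc,
    ← add_mul, ExteriorAlgebra.ι_add_mul_swap, zero_mul]
  rfl

lemma orientMap_wedge {S T : Type} (t : ℕ) (f : S → T) (x : S) (a : orient k S t) :
    orientMap (t + 1) f (wedge t x a) = wedge t (f x) (orientMap t f a) := by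
  apply Subtype.ext
  rw [orientMap_coe, wedge_coe, wedge_coe, orientMap_coe, map_mul, ExteriorAlgebra.map_apply_ι,
    Finsupp.lmapDomain_apply, Finsupp.mapDomain_single]

lemma orientMap_id {S : Type} (t : ℕ) (f : S → S) (h : ∀ x, f x = x) (a : orient k S t) :
    orientMap t f a = a := by
  obtain rfl : f = id := funext h
  rw [orientMap, Finsupp.lmapDomain_id, exteriorPower.map_id]
  rfl

lemma orientMap_orientMap {S T U : Type} (t : ℕ) (f : S → T) (g : T → U) (a : orient k S t) :
    orientMap t g (orientMap t f a) = orientMap t (fun x => g (f x)) a := by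
  have : (fun x => g (f x)) = g ∘ f := rfl
  rw [this, orientMap, orientMap, orientMap, Finsupp.lmapDomain_comp, ← LinearMap.comp_apply,
    exteriorPower.map_comp]

/-- The subsets `B` of `S` whose complement has `t` elements. -/
abbrev KzIndex (S : Type) (t : ℕ) : Type := {B : Set S // Bᶜ.ncard = t}

/-- The term `⨁_B F(B) ⊗ Or(S \ B)` of the Koszul complex; the sum is over the subsets `B` of `S`
whose complement has `t` elements. (The sum is finite, and written as a product.) -/
abbrev KzTerm (F : FIopMod k) (S : Type) [Finite S] (t : ℕ) : Type u :=
  ∀ B : KzIndex S t, F.obj (op ⟨(B.1 : Type)⟩) ⊗[k] orient k (B.1ᶜ : Set S) t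

/-- For `x ∈ B' \ B`, where `B ⊆ B'`, the map `Y ⊗ α ↦ Y|_B ⊗ (x ∧ α)`. -/
noncomputable def kzFace (F : FIopMod k) {S : Type} [Finite S] (t : ℕ) {B B' : Set S} (h : B ⊆ B')
    (x : S) (hx : x ∈ Bᶜ) :
    F.obj (op ⟨(B' : Type)⟩) ⊗[k] orient k (B'ᶜ : Set S) t →ₗ[k]
      F.obj (op ⟨(B : Type)⟩) ⊗[k] orient k (Bᶜ : Set S) (t + 1) :=
  TensorProduct.map (pull F (Set.embeddingOfSubset B B' h))
    (wedge t ⟨x, hx⟩ ∘ₗ orientMap t (Set.inclusion (Set.compl_subset_compl.mpr h)))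

/-- For a bijection `e : S ≃ T` which restricts to a bijection `B ≃ B'`, the map
`F(B') ⊗ Or(T \ B') → F(B) ⊗ Or(S \ B)` induced by `e`. -/
noncomputable def kzAct (F : FIopMod k) {S T : Type} [Finite S] [Finite T] (t : ℕ) (e : S ≃ T)
    {B : Set S} {B' : Set T} (h : ∀ s, s ∈ B ↔ e s ∈ B') :
    F.obj (op ⟨(B' : Type)⟩) ⊗[k] orient k (B'ᶜ : Set T) t →ₗ[k]
      F.obj (op ⟨(B : Type)⟩) ⊗[k] orient k (Bᶜ : Set S) t :=
  TensorProduct.map (pull F (e.subtypeEquiv h).toEmbedding)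
    (orientMap t (e.subtypeEquiv fun s => not_congr (h s)).symm)

lemma pull_congr (F : FIopMod k) {S T : Type} [Finite S] [Finite T] {f g : S ↪ T}
    (h : ∀ x, f x = g x) (y : F.obj (op ⟨T⟩)) : pull F f y = pull F g y := by
  rw [Function.Embedding.ext h]

lemma kzFace_kzFace (F : FIopMod k) {S : Type} [Finite S] (t : ℕ) {B B₁ B₂ B' : Set S} (h₁ : B ⊆ B₁)
    (h₂ : B ⊆ B₂) (h₁' : B₁ ⊆ B') (h₂' : B₂ ⊆ B') {x y : S} (hx : x ∈ Bᶜ) (hy : y ∈ B₁ᶜ)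
    (hy' : y ∈ Bᶜ) (hx' : x ∈ B₂ᶜ) (w : F.obj (op ⟨(B' : Type)⟩) ⊗[k] orient k (B'ᶜ : Set S) t) :
    kzFace F (t + 1) h₁ x hx (kzFace F t h₁' y hy w) +
      kzFace F (t + 1) h₂ y hy' (kzFace F t h₂' x hx' w) = 0 := by
  induction w using TensorProduct.induction_on with
  | zero => simp only [map_zero, add_zero]
  | add v w hv hw =>
    simp only [map_add]
    rw [add_add_add_comm, hv, hw, add_zero]
  | tmul Y a =>
    simp only [kzFace, TensorProduct.map_tmul, LinearMap.comp_apply, orientMap_wedge,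
      orientMap_orientMap, pull_pull]
    refine Eq.trans (TensorProduct.tmul_add _ _ _).symm ?_
    refine Eq.trans ?_ (TensorProduct.tmul_zero _ (pull F (Set.embeddingOfSubset B B' (h₁.trans h₁')) Y))
    exact congrArg _ (wedge_wedge _ _ _ _)

lemma kzFace_kzFace_index (F : FIopMod k) {S : Type} [Finite S] {t : ℕ} (z : KzTerm F S t)
    {C C' : KzIndex S t} (hC : C.1 = C'.1) {B B₁ B₂ : Set S} (h₁ : B ⊆ B₁) (h₂ : B ⊆ B₂)
    (h₁' : B₁ ⊆ C.1) (h₂' : B₂ ⊆ C'.1) {x y : S} (hx : x ∈ Bᶜ) (hy : y ∈ B₁ᶜ) (hy' : y ∈ Bᶜ)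
    (hx' : x ∈ B₂ᶜ) :
    kzFace F (t + 1) h₁ x hx (kzFace F t h₁' y hy (z C)) +
      kzFace F (t + 1) h₂ y hy' (kzFace F t h₂' x hx' (z C')) = 0 := by
  obtain rfl : C = C' := Subtype.ext hC
  exact kzFace_kzFace F t h₁ h₂ h₁' h₂' hx hy hy' hx' (z C)

lemma kzAct_kzAct (F : FIopMod k) {S T U : Type} [Finite S] [Finite T] [Finite U] (t : ℕ)
    (e : S ≃ T) (e' : T ≃ U) {B : Set S} {B' : Set T} {B'' : Set U} (h : ∀ s, s ∈ B ↔ e s ∈ B')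
    (h' : ∀ s, s ∈ B' ↔ e' s ∈ B'')
    (w : F.obj (op ⟨(B'' : Type)⟩) ⊗[k] orient k (B''ᶜ : Set U) t) :
    kzAct F t e h (kzAct F t e' h' w) =
      kzAct F t (e.trans e') (fun s => (h s).trans (h' (e s))) w := by
  induction w using TensorProduct.induction_on with
  | zero => simp only [map_zero]
  | add v w hv hw => simp only [map_add, hv, hw]
  | tmul Y a =>
    simp only [kzAct, TensorProduct.map_tmul, orientMap_orientMap, pull_pull]
    rfl

lemma kzAct_refl (F : FIopMod k) {S : Type} [Finite S] (t : ℕ) {B : Set S}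
    (h : ∀ s, s ∈ B ↔ Equiv.refl S s ∈ B)
    (w : F.obj (op ⟨(B : Type)⟩) ⊗[k] orient k (Bᶜ : Set S) t) :
    kzAct F t (Equiv.refl S) h w = w := by
  induction w using TensorProduct.induction_on with
  | zero => simp only [map_zero]
  | add v w hv hw => simp only [map_add, hv, hw]
  | tmul Y a =>
    simp only [kzAct, TensorProduct.map_tmul]
    exact congrArg₂ (fun y b => y ⊗ₜ[k] b) (pull_refl F Y) (orientMap_id t _ (fun x => rfl) a)

lemma kzAct_kzFace (F : FIopMod k) {S T : Type} [Finite S] [Finite T] (t : ℕ) (e : S ≃ T)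
    {B B₁ : Set S} {B' B₁' : Set T} (h : ∀ s, s ∈ B ↔ e s ∈ B') (h₁ : ∀ s, s ∈ B₁ ↔ e s ∈ B₁')
    (i : B ⊆ B₁) (i' : B' ⊆ B₁') {x : S} {y : T} (hx : x ∈ Bᶜ) (hy : y ∈ B'ᶜ) (hxy : e x = y)
    (w : F.obj (op ⟨(B₁' : Type)⟩) ⊗[k] orient k (B₁'ᶜ : Set T) t) :
    kzAct F (t + 1) e h (kzFace F t i' y hy w) = kzFace F t i x hx (kzAct F t e h₁ w) := by
  subst hxy
  induction w using TensorProduct.induction_on with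
  | zero => simp only [map_zero]
  | add v w hv hw => simp only [map_add, hv, hw]
  | tmul Y a =>
    simp only [kzAct, kzFace, TensorProduct.map_tmul, LinearMap.comp_apply, orientMap_wedge,
      orientMap_orientMap, pull_pull]
    have : (e.subtypeEquiv fun s => not_congr (h s)).symm ⟨e x, hy⟩ = ⟨x, hx⟩ :=
      Subtype.ext (e.symm_apply_apply x)
    rw [this]
    rfl

lemma ncard_image_compl {S T : Type} (e : S ≃ T) {B : Set S} {t : ℕ} (h : Bᶜ.ncard = t) :
    (e '' B)ᶜ.ncard = t := by
  rw [← Set.image_compl_eq e.bijective, Set.ncard_image_of_injective _ e.injective, h]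

lemma ncard_insert_compl {S : Type} [Finite S] {B : Set S} {t : ℕ} (h : Bᶜ.ncard = t + 1) (x : S)
    (hx : x ∈ Bᶜ) : (insert x B)ᶜ.ncard = t := by
  have h1 : (insert x B)ᶜ = Bᶜ \ {x} := by
    ext y
    simp only [Set.mem_compl_iff, Set.mem_insert_iff, Set.mem_sdiff, Set.mem_singleton_iff]
    tauto
  rw [h1, Set.ncard_sdiff_singleton_of_mem hx, h, Nat.add_sub_cancel]

/-- The image of a subset under a bijection. -/
abbrev KzIndex.image {S T : Type} {t : ℕ} (B : KzIndex S t) (e : S ≃ T) : KzIndex T t :=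
  ⟨e '' B.1, ncard_image_compl e B.2⟩

/-- The subset `B ∪ {x}`, for `x ∉ B`. -/
abbrev KzIndex.insert {S : Type} [Finite S] {t : ℕ} (B : KzIndex S (t + 1))
    (x : (B.1ᶜ : Set S)) : KzIndex S t :=
  ⟨Insert.insert x.1 B.1, ncard_insert_compl B.2 x.1 x.2⟩

/-- The action of a bijection `e : S ≃ T` on the terms of the Koszul complex: it maps the summand
indexed by `B' ⊆ T` to that indexed by `e⁻¹(B')`. -/
noncomputable def kzMap (F : FIopMod k) {S T : Type} [Finite S] [Finite T] (t : ℕ) (e : S ≃ T) :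
    KzTerm F T t →ₗ[k] KzTerm F S t :=
  LinearMap.pi fun B =>
    kzAct F t e (fun _ => (e.injective.mem_set_image).symm) ∘ₗ
      LinearMap.proj (B.image e)

lemma kzAct_congr (F : FIopMod k) {S T : Type} [Finite S] [Finite T] {t : ℕ} {e e' : S ≃ T}
    (he : e = e') (z : KzTerm F T t) {B : Set S} {B₁ B₂ : KzIndex T t}
    (h₁ : ∀ s, s ∈ B ↔ e s ∈ B₁.1) (h₂ : ∀ s, s ∈ B ↔ e' s ∈ B₂.1) :
    kzAct F t e h₁ (z B₁) = kzAct F t e' h₂ (z B₂) := by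
  subst he
  obtain rfl : B₁ = B₂ := Subtype.ext (Set.ext fun y => by
    have := (h₁ (e.symm y)).symm.trans (h₂ (e.symm y))
    rwa [e.apply_symm_apply] at this)
  rfl

lemma kzMap_apply (F : FIopMod k) {S T : Type} [Finite S] [Finite T] {t : ℕ} (e : S ≃ T)
    (z : KzTerm F T t) (B : KzIndex S t) (B' : KzIndex T t) (h : ∀ s, s ∈ B.1 ↔ e s ∈ B'.1) :
    kzMap F t e z B = kzAct F t e h (z B') :=
  kzAct_congr F rfl z (B₁ := B.image e) (B₂ := B') _ h

lemma kzMap_refl (F : FIopMod k) {S : Type} [Finite S] {t : ℕ} (z : KzTerm F S t) :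
    kzMap F t (Equiv.refl S) z = z := by
  funext B
  exact (kzMap_apply F (Equiv.refl S) z B B fun _ => Iff.rfl).trans (kzAct_refl F t _ _)

lemma kzMap_kzMap (F : FIopMod k) {S T U : Type} [Finite S] [Finite T] [Finite U] {t : ℕ}
    (e : S ≃ T) (e' : T ≃ U) (z : KzTerm F U t) :
    kzMap F t e (kzMap F t e' z) = kzMap F t (e.trans e') z := by
  funext B
  have h : ∀ s, s ∈ B.1 ↔ e s ∈ (B.image e).1 := fun _ => (e.injective.mem_set_image).symm
  have h' : ∀ s, s ∈ (B.image e).1 ↔ e' s ∈ ((B.image e).image e').1 :=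
    fun _ => (e'.injective.mem_set_image).symm
  rw [kzMap_apply F e _ B (B.image e) h, kzMap_apply F e' z _ ((B.image e).image e') h',
    kzMap_apply F (e.trans e') z B ((B.image e).image e') fun s => (h s).trans (h' (e s)),
    kzAct_kzAct]

section Differential

attribute [local instance] Fintype.ofFinite

/-- The differential of the Koszul complex. For `Y ⊗ α` in the summand indexed by `B'`, it is
`d(Y ⊗ α) = ∑_{x ∈ B'} Y|_{B' \ {x}} ⊗ (x ∧ α)`; equivalently, the component of `d z` at `B` is the
sum over `x ∉ B` of the contributions of the components of `z` at `B ∪ {x}`. -/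
noncomputable def kzD (F : FIopMod k) (S : Type) [Finite S] (t : ℕ) :
    KzTerm F S t →ₗ[k] KzTerm F S (t + 1) :=
  LinearMap.pi fun B => ∑ x : (B.1ᶜ : Set S),
    kzFace F t (Set.subset_insert x.1 B.1) x.1 x.2 ∘ₗ
      LinearMap.proj (B.insert x)

lemma kzD_apply (F : FIopMod k) {S : Type} [Finite S] {t : ℕ} (z : KzTerm F S t)
    (B : KzIndex S (t + 1)) :
    kzD F S t z B = ∑ x : (B.1ᶜ : Set S), kzFace F t (Set.subset_insert x.1 B.1) x.1 x.2
      (z (B.insert x)) := by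
  rw [kzD, LinearMap.pi_apply, LinearMap.sum_apply]
  rfl

lemma kzD_kzD (F : FIopMod k) {S : Type} [Finite S] {t : ℕ} (z : KzTerm F S t) :
    kzD F S (t + 1) (kzD F S t z) = 0 := by
  funext B
  rw [kzD_apply]
  simp only [kzD_apply, map_sum]
  rw [Finset.sum_sigma' Finset.univ (fun x => Finset.univ)]
  have hne : ∀ a : (x : (B.1ᶜ : Set S)) × ((insert x.1 B.1)ᶜ : Set S), a.1.1 ≠ a.2.1 :=
    fun a h => a.2.2 (Set.mem_insert_iff.mpr (Or.inl h.symm))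
  refine Finset.sum_involution (fun a _ => ⟨⟨a.2.1, fun h => a.2.2 (Set.mem_insert_of_mem _ h)⟩,
    ⟨a.1.1, fun h => (Set.mem_insert_iff.mp h).elim (hne a) a.1.2⟩⟩) ?_ ?_ ?_ ?_
  · intro a _
    have h : a.2.1 ∈ B.1ᶜ := fun h => a.2.2 (Set.mem_insert_of_mem _ h)
    have h' : a.1.1 ∈ (B.insert ⟨a.2.1, h⟩).1ᶜ :=
      fun h => (Set.mem_insert_iff.mp h).elim (hne a) a.1.2
    exact kzFace_kzFace_index F z (C := (B.insert a.1).insert a.2)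
      (C' := (B.insert ⟨a.2.1, h⟩).insert ⟨a.1.1, h'⟩) (Set.insert_comm _ _ _)
      (Set.subset_insert _ _) (Set.subset_insert _ _) (Set.subset_insert _ _)
      (Set.subset_insert _ _) a.1.2 a.2.2 h h'
  · intro a _ _ h
    exact hne a (congrArg (fun b => b.1.1) h).symm
  · intro a _
    exact Finset.mem_univ _
  · intro a _
    rfl

lemma kzMap_kzD (F : FIopMod k) {S T : Type} [Finite S] [Finite T] {t : ℕ} (e : S ≃ T)
    (z : KzTerm F T t) : kzMap F (t + 1) e (kzD F T t z) = kzD F S t (kzMap F t e z) := by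
  funext B
  have h : ∀ s, s ∈ B.1 ↔ e s ∈ (B.image e).1 := fun _ => (e.injective.mem_set_image).symm
  rw [kzMap_apply F e _ B (B.image e) h, kzD_apply, kzD_apply, map_sum]
  refine (Fintype.sum_equiv (e.subtypeEquiv fun s => not_congr (h s)) _ _ fun x => ?_).symm
  have hx : e x.1 ∈ (B.image e).1ᶜ := fun h' => x.2 ((h _).mpr h')
  have h₁ : ∀ s, s ∈ (B.insert x).1 ↔ e s ∈ ((B.image e).insert ⟨e x.1, hx⟩).1 := fun s => by
    rw [Set.mem_insert_iff, Set.mem_insert_iff, e.injective.mem_set_image, e.injective.eq_iff]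
  rw [kzMap_apply F e z (B.insert x) ((B.image e).insert ⟨e x.1, hx⟩) h₁]
  exact (kzAct_kzFace F t e h h₁ (Set.subset_insert _ _) (Set.subset_insert _ _) x.2 hx rfl _).symm

end Differential

/-- The term `(Kz F)ᵗ` of the Koszul complex, as a `𝚺ᵒᵖ`-module. -/
noncomputable def kzX (F : FIopMod k) (t : ℕ) : SigopMod k where
  obj S := ModuleCat.of k (KzTerm F S.unop t)
  map f := ModuleCat.ofHom (kzMap F t f.unop)
  map_id _ := ModuleCat.hom_ext (LinearMap.ext fun z => kzMap_refl F z)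
  map_comp f g := ModuleCat.hom_ext (LinearMap.ext fun z => (kzMap_kzMap F g.unop f.unop z).symm)

/-- The Koszul complex `Kz F` of an `𝐅𝐈ᵒᵖ`-module `F`. -/
noncomputable def kz (F : FIopMod k) : CochainComplex (SigopMod k) ℕ :=
  CochainComplex.of (kzX F)
    (fun t =>
      { app := fun S => ModuleCat.ofHom (kzD F S.unop t)
        naturality := fun S T f => by
          refine ModuleCat.hom_ext (LinearMap.ext fun z => ?_)
          exact (kzMap_kzD F f.unop z).symm })
    fun t => module_ext fun S z => kzD_kzD F z

/-- The map induced by a morphism on the terms of the Koszul complexes. -/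
noncomputable def kzTermMap {F H : FIopMod k} (φ : F ⟶ H) (S : Type) [Finite S] (t : ℕ) :
    KzTerm F S t →ₗ[k] KzTerm H S t :=
  LinearMap.pi fun B =>
    TensorProduct.map (φ.app (op ⟨(B.1 : Type)⟩)).hom LinearMap.id ∘ₗ LinearMap.proj B

lemma kzTermMap_comp {F H J : FIopMod k} (φ : F ⟶ H) (ψ : H ⟶ J) (S : Type) [Finite S] {t : ℕ}
    (z : KzTerm F S t) : kzTermMap (φ ≫ ψ) S t z = kzTermMap ψ S t (kzTermMap φ S t z) := by
  funext B
  have key : ∀ w : F.obj (op ⟨(B.1 : Type)⟩) ⊗[k] orient k (B.1ᶜ : Set S) t,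
      TensorProduct.map ((φ ≫ ψ).app (op ⟨(B.1 : Type)⟩)).hom LinearMap.id w =
        TensorProduct.map (ψ.app (op ⟨(B.1 : Type)⟩)).hom LinearMap.id
          (TensorProduct.map (φ.app (op ⟨(B.1 : Type)⟩)).hom LinearMap.id w) := fun w => by
    induction w using TensorProduct.induction_on with
    | zero => simp only [map_zero]
    | add v w hv hw => simp only [map_add, hv, hw]
    | tmul Y a => rfl
  exact key (z B)

lemma map_kzAct {F H : FIopMod k} (φ : F ⟶ H) {S T : Type} [Finite S] [Finite T] {t : ℕ} (e : S ≃ T)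
    {B : Set S} {B' : Set T} (h : ∀ s, s ∈ B ↔ e s ∈ B')
    (w : F.obj (op ⟨(B' : Type)⟩) ⊗[k] orient k (B'ᶜ : Set T) t) :
    TensorProduct.map (φ.app (op ⟨(B : Type)⟩)).hom LinearMap.id (kzAct F t e h w) =
      kzAct H t e h (TensorProduct.map (φ.app (op ⟨(B' : Type)⟩)).hom LinearMap.id w) := by
  induction w using TensorProduct.induction_on with
  | zero => simp only [map_zero]
  | add v w hv hw => simp only [map_add, hv, hw]
  | tmul Y a =>
    simp only [kzAct, TensorProduct.map_tmul, pull_naturality]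
    rfl

lemma map_kzFace {F H : FIopMod k} (φ : F ⟶ H) {S : Type} [Finite S] {t : ℕ}
    {B B' : Set S} (h : B ⊆ B') {x : S} (hx : x ∈ Bᶜ)
    (w : F.obj (op ⟨(B' : Type)⟩) ⊗[k] orient k (B'ᶜ : Set S) t) :
    TensorProduct.map (φ.app (op ⟨(B : Type)⟩)).hom LinearMap.id (kzFace F t h x hx w) =
      kzFace H t h x hx (TensorProduct.map (φ.app (op ⟨(B' : Type)⟩)).hom LinearMap.id w) := by
  induction w using TensorProduct.induction_on with
  | zero => simp only [map_zero]
  | add v w hv hw => simp only [map_add, hv, hw]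
  | tmul Y a =>
    simp only [kzFace, TensorProduct.map_tmul, pull_naturality]
    rfl

lemma kzD_kzTermMap {F H : FIopMod k} (φ : F ⟶ H) (S : Type) [Finite S] {t : ℕ}
    (z : KzTerm F S t) :
    kzD H S t (kzTermMap φ S t z) = kzTermMap φ S (t + 1) (kzD F S t z) := by
  funext B
  have h : kzTermMap φ S (t + 1) (kzD F S t z) B =
      TensorProduct.map (φ.app (op ⟨(B.1 : Type)⟩)).hom LinearMap.id (kzD F S t z B) := rfl
  rw [h, kzD_apply, kzD_apply, map_sum]
  exact Finset.sum_congr rfl fun x _ => (map_kzFace φ (Set.subset_insert _ _) x.2 _).symm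

/-- The morphism `(Kz F)ᵗ → (Kz H)ᵗ` induced by a morphism `F → H`. -/
noncomputable def kzXMap {F H : FIopMod k} (φ : F ⟶ H) (t : ℕ) : kzX F t ⟶ kzX H t where
  app S := ModuleCat.ofHom (kzTermMap φ S.unop t)
  naturality S T f := by
    refine ModuleCat.hom_ext (LinearMap.ext fun z => funext fun B => ?_)
    exact map_kzAct φ f.unop (fun _ => (Equiv.injective _).mem_set_image.symm)
      (z (KzIndex.image B f.unop))

variable (k) in
/-- The Koszul complex, as a functor. -/
noncomputable def kzFunctor : FIopMod k ⥤ CochainComplex (SigopMod k) ℕ where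
  obj := kz
  map {F H} φ := CochainComplex.ofHom (V := SigopMod k) (kzXMap φ) fun t => by
    dsimp only [kz]
    rw [CochainComplex.of_d, CochainComplex.of_d]
    exact module_ext fun S z => kzD_kzTermMap φ S.unop z
  map_id F := by
    ext t : 1
    refine module_ext fun S z => funext fun B => ?_
    exact LinearMap.congr_fun TensorProduct.map_id (z B)
  map_comp {F H J} φ ψ := by
    ext t : 1
    exact module_ext fun S z => kzTermMap_comp φ ψ S.unop z

end Modules

end FIop

/-! The map is built from one operation. Let `rho : ⊥ Kzᵗ F → Kzᵗ⁺¹ F` be `α ↦ α ∧ x` on the summand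
of `S ∖ {x}`, and zero on the summands of all other subsets. Iterating it from `F ≅ Kz⁰ F` gives
`proj : ⊥ⁿ F → Kzⁿ F`, which deletes points one at a time and records their order in a wedge
product. The coface `η` inserts a step that deletes nothing, and `rho` kills it (`eta_rho`). A
coface `Δ` leads to the deletion of two points in both orders, and the two contributions cancel
(`delta_rho`). The last coface restricts elements of `F` and becomes the Koszul differential
(`cobarD_last_proj`). In the opposite object the last coface has index `0`, hence sign `+1`, so
`proj` is a cochain map even before normalization. It is onto on normalized elements because `rho`
is onto and ignores the summand of `S`, which can therefore be set to zero.

For the quasi-isomorphism it suffices that the kernel of the projection is acyclic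
(`quasiIso_of_surjective`). Suppose first that `F = ↑G`. The extra codegeneracy `⊥ⁿ⁺¹ ε` contracts
the normalized complex in positive degrees. Extension by zero splits the restriction maps of `↑G`,
which makes the Koszul complex exact in positive degrees (`exists_kzD_eq`). In degree `0` the
projection is bijective and the two complexes have the same cocycles (`altAt_zero_eq_zero`).
Together these give acyclicity of the kernel (`exists_kerAt_of_cofree`).

A general `F` embeds in `↑↓F` with cokernel `Q`, and this short exact sequence splits over `𝚺`. The
terms of both complexes and the map `proj` depend only on the underlying `𝚺ᵒᵖ`-module, so the
kernels form a short exact sequence of complexes that is split in each degree. Exactness for `F` in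
degree `n + 1` thus follows from exactness for `Q` in degree `n`, and the kernel vanishes in degree
`0` (`exists_kerAt`). -/

namespace FIop

/-! ### Wedging with a point, on orientation modules. -/

section Orientation

variable {k : Type u} [CommRing k]

/-- If `f : T → T'` is a bijection onto the complement of `x`, then `α ↦ x ∧ f(α)` is injective. -/
lemma wedge_orientMap_injective {T T' : Type} (t : ℕ) (x : T') (f : T → T')
    (hf : Function.Injective f) (hx : ∀ a, f a ≠ x) :
    Function.Injective (wedge (k := k) t x ∘ₗ orientMap t f) := by
  classical
  rw [← LinearMap.ker_eq_bot, LinearMap.ker_eq_bot']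
  intro α hα
  -- Contraction with the coordinate `D` at `x` turns `x ∧ f(α)` into `f(α) - x ∧ (D ⌟ f(α))`. The
  -- algebra map induced by `p` kills `x` and is a left inverse of the one induced by `f`, so it
  -- sends this to `α`.
  let p : (T' →₀ k) →ₗ[k] (T →₀ k) := Finsupp.lcomapDomain f hf
  let D : Module.Dual k (T' →₀ k) := Finsupp.lapply x
  have hp : p (Finsupp.single x 1) = 0 := by
    ext a
    simp [p, Finsupp.lcomapDomain, hx]
  have hpf : p ∘ₗ Finsupp.lmapDomain k k f = LinearMap.id := by
    ext a b
    simp [p, Finsupp.lcomapDomain, Finsupp.single_apply]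
  have h1 : ExteriorAlgebra.ι k (Finsupp.single x (1 : k)) *
      ExteriorAlgebra.map (Finsupp.lmapDomain k k f) α.1 = 0 := by
    have := congrArg Subtype.val hα
    rwa [LinearMap.comp_apply, wedge_coe, orientMap_coe] at this
  have h2 := congrArg (fun a => ExteriorAlgebra.map p (CliffordAlgebra.contractLeft D a)) h1
  have h3 := CliffordAlgebra.contractLeft_ι_mul (Q := (0 : QuadraticForm k (T' →₀ k)))
    (d := D) (Finsupp.single x (1 : k)) (ExteriorAlgebra.map (Finsupp.lmapDomain k k f) α.1)
  have h4 : D (Finsupp.single x 1) = 1 := by simp [D]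
  erw [h3] at h2
  rw [h4, one_smul, map_sub, map_mul] at h2
  erw [ExteriorAlgebra.map_apply_ι] at h2
  rw [hp, map_zero, zero_mul, sub_zero, map_zero, map_zero, ← AlgHom.comp_apply,
    ExteriorAlgebra.map_comp_map, hpf, ExteriorAlgebra.map_id] at h2
  exact Subtype.ext h2

lemma wedge_ιMulti {T : Type} (t : ℕ) (x : T) (v : Fin t → T →₀ k) :
    wedge t x (exteriorPower.ιMulti k t v) =
      exteriorPower.ιMulti k (t + 1) (Fin.cons (Finsupp.single x 1) v) := by
  apply Subtype.ext
  rw [wedge_coe, exteriorPower.ιMulti_apply_coe, exteriorPower.ιMulti_apply_coe,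
    ExteriorAlgebra.ιMulti_succ_apply]
  simp [Matrix.vecTail, Function.comp_def]

/-- If `f : T → T'` is onto the complement of `x`, and `T'` has `t + 1` elements, then
`α ↦ x ∧ f(α)` is onto the orientation module of `T'`. -/
lemma wedge_orientMap_surjective {T T' : Type} [Finite T'] (t : ℕ) (x : T') (f : T → T')
    (hf : ∀ y, y ≠ x → ∃ a, f a = y) (hT : Nat.card T' = t + 1) :
    Function.Surjective (wedge (k := k) t x ∘ₗ orientMap t f) := by
  classical
  rw [← LinearMap.range_eq_top, eq_top_iff]
  have hs : Submodule.span k (Set.range fun y : T' => Finsupp.single y (1 : k)) = ⊤ := by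
    have := (Finsupp.basisSingleOne (R := k) (ι := T')).span_eq
    rwa [Finsupp.coe_basisSingleOne] at this
  rw [← exteriorPower.ιMulti_span_of_span k (t + 1) _ hs, Submodule.span_le]
  rintro _ ⟨m, hm, rfl⟩
  choose v hv using fun i => hm (Set.mem_range_self i)
  obtain rfl : m = fun i => Finsupp.single (v i) (1 : k) := funext fun i => (hv i).symm
  clear hv hm
  -- In an injective tuple that starts with `x`, the later entries differ from `x` and hence lift
  -- along `f`.
  have key : ∀ v : Fin (t + 1) → T', Function.Injective v → v 0 = x →
      exteriorPower.ιMulti k (t + 1) (fun i => Finsupp.single (v i) (1 : k)) ∈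
        LinearMap.range (wedge (k := k) t x ∘ₗ orientMap t f) := by
    intro v hv h0
    choose a ha using fun i : Fin t => hf (v i.succ) fun h =>
      Fin.succ_ne_zero i (hv (h.trans h0.symm))
    refine ⟨exteriorPower.ιMulti k t fun i => Finsupp.single (a i) 1, ?_⟩
    rw [LinearMap.comp_apply, orientMap, exteriorPower.map_apply_ιMulti, wedge_ιMulti]
    congr 1
    funext i
    refine Fin.cases ?_ (fun i => ?_) i
    · rw [Fin.cons_zero, h0]
    · rw [Fin.cons_succ, Function.comp_apply, Finsupp.lmapDomain_apply, Finsupp.mapDomain_single,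
        ha]
  -- An injective tuple of length `t + 1` is a bijection onto `T'`, so `x` occurs in it and a
  -- transposition moves it to the front at the cost of a sign. Any other tuple has a repeated entry
  -- and its wedge product is zero.
  by_cases hv : Function.Injective v
  · have hb : Function.Bijective v := by
      have := Fintype.ofFinite T'
      rw [Fintype.bijective_iff_injective_and_card]
      exact ⟨hv, by rw [Fintype.card_fin, ← Nat.card_eq_fintype_card, hT]⟩
    obtain ⟨i, hi⟩ := hb.2 x
    by_cases h0 : i = 0
    · exact key v hv (h0 ▸ hi)
    · have := key (v ∘ Equiv.swap 0 i) (hv.comp (Equiv.injective _)) (by simp [hi])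
      have h2 := AlternatingMap.map_swap (exteriorPower.ιMulti k (t + 1))
        (fun i => Finsupp.single (v i) (1 : k)) (Ne.symm h0)
      change exteriorPower.ιMulti k (t + 1) ((fun i => Finsupp.single (v i) (1 : k)) ∘
        Equiv.swap 0 i) ∈ _ at this
      rw [h2] at this
      exact neg_mem_iff.mp this
  · obtain ⟨i, j, hij, hne⟩ : ∃ i j, v i = v j ∧ i ≠ j := by
      simpa [Function.Injective] using hv
    rw [SetLike.mem_coe, AlternatingMap.map_eq_zero_of_eq _ _ (by simp only [hij]) hne]
    exact zero_mem _

end Orientation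

/-! ### The map from `⨁_A Kzᵗ(A)` to `Kzᵗ⁺¹(S)` and its compatibilities. -/

section Rho

variable {k : Type u} [CommRing k]

/-- The map `Y ⊗ α ↦ g^* Y ⊗ f(α)`. -/
noncomputable def kzMov (F : FIopMod k) (t : ℕ) {A A' T T' : Type} [Finite A] [Finite A']
    (g : A ↪ A') (f : T' → T) :
    F.obj (op ⟨A'⟩) ⊗[k] orient k T' t →ₗ[k] F.obj (op ⟨A⟩) ⊗[k] orient k T t :=
  TensorProduct.map (pull F g) (orientMap t f)

/-- The map `Y ⊗ α ↦ g^* Y ⊗ (x ∧ f(α))`. -/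
noncomputable def kzGen (F : FIopMod k) (t : ℕ) {A A' T T' : Type} [Finite A] [Finite A']
    (g : A ↪ A') (f : T' → T) (x : T) :
    F.obj (op ⟨A'⟩) ⊗[k] orient k T' t →ₗ[k] F.obj (op ⟨A⟩) ⊗[k] orient k T (t + 1) :=
  TensorProduct.map (pull F g) (wedge t x ∘ₗ orientMap t f)

section Composition

variable (F : FIopMod k) (t : ℕ) {A A' A'' T T' T'' : Type} [Finite A] [Finite A'] [Finite A'']

lemma kzMov_kzGen (g : A ↪ A') (f : T' → T) (g' : A' ↪ A'') (f' : T'' → T') (x : T')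
    (w : F.obj (op ⟨A''⟩) ⊗[k] orient k T'' t) :
    kzMov F (t + 1) g f (kzGen F t g' f' x w) =
      kzGen F t (g.trans g') (fun u => f (f' u)) (f x) w := by
  induction w using TensorProduct.induction_on with
  | zero => simp only [map_zero]
  | add v w hv hw => simp only [map_add, hv, hw]
  | tmul Y a =>
    simp only [kzMov, kzGen, TensorProduct.map_tmul, LinearMap.comp_apply, orientMap_wedge,
      orientMap_orientMap, pull_pull]

lemma kzGen_kzMov (g : A ↪ A') (f : T' → T) (g' : A' ↪ A'') (f' : T'' → T') (x : T)
    (w : F.obj (op ⟨A''⟩) ⊗[k] orient k T'' t) :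
    kzGen F t g f x (kzMov F t g' f' w) = kzGen F t (g.trans g') (fun u => f (f' u)) x w := by
  induction w using TensorProduct.induction_on with
  | zero => simp only [map_zero]
  | add v w hv hw => simp only [map_add, hv, hw]
  | tmul Y a =>
    simp only [kzMov, kzGen, TensorProduct.map_tmul, LinearMap.comp_apply,
      orientMap_orientMap, pull_pull]

/-- The map `Y ⊗ α ↦ g^* Y ⊗ (x ∧ y ∧ f(α))`. -/
noncomputable def kzGen₂ (g : A ↪ A') (f : T' → T) (x y : T) :
    F.obj (op ⟨A'⟩) ⊗[k] orient k T' t →ₗ[k] F.obj (op ⟨A⟩) ⊗[k] orient k T (t + 2) :=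
  TensorProduct.map (pull F g) (wedge (t + 1) x ∘ₗ wedge t y ∘ₗ orientMap t f)

lemma kzGen_kzGen (g : A ↪ A') (f : T' → T) (g' : A' ↪ A'') (f' : T'' → T') (x : T) (y : T')
    (w : F.obj (op ⟨A''⟩) ⊗[k] orient k T'' t) :
    kzGen F (t + 1) g f x (kzGen F t g' f' y w) =
      kzGen₂ F t (g.trans g') (fun u => f (f' u)) x (f y) w := by
  induction w using TensorProduct.induction_on with
  | zero => simp only [map_zero]
  | add v w hv hw => simp only [map_add, hv, hw]
  | tmul Y a =>
    simp only [kzGen, kzGen₂, TensorProduct.map_tmul, LinearMap.comp_apply, orientMap_wedge,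
      orientMap_orientMap, pull_pull]

lemma kzGen₂_swap (g : A ↪ A') (f : T' → T) (x y : T)
    (w : F.obj (op ⟨A'⟩) ⊗[k] orient k T' t) :
    kzGen₂ F t g f x y w + kzGen₂ F t g f y x w = 0 := by
  induction w using TensorProduct.induction_on with
  | zero => simp only [map_zero, add_zero]
  | add v w hv hw =>
    simp only [map_add]
    rw [add_add_add_comm, hv, hw, add_zero]
  | tmul Y a =>
    simp only [kzGen₂, TensorProduct.map_tmul, LinearMap.comp_apply]
    rw [← TensorProduct.tmul_add, wedge_wedge, TensorProduct.tmul_zero]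

end Composition

section Congruence

variable (F : FIopMod k) {S : Type} [Finite S] {t : ℕ} {C T : Type} [Finite C]

/-- Components of a family of elements of Koszul terms of subsets, viewed through maps, depend only
on the underlying subsets and maps. -/
lemma kzGen_congr (w : ∀ A : Set S, KzTerm F A t) {A₁ A₂ : Set S} {B₁ : KzIndex A₁ t}
    {B₂ : KzIndex A₂ t} {g₁ : C ↪ B₁.1} {g₂ : C ↪ B₂.1} {f₁ : (B₁.1ᶜ : Set A₁) → T}
    {f₂ : (B₂.1ᶜ : Set A₂) → T} {x₁ x₂ : T} (hA : A₁ = A₂)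
    (hB : ∀ a (h₁ : a ∈ A₁) (h₂ : a ∈ A₂), ⟨a, h₁⟩ ∈ B₁.1 ↔ ⟨a, h₂⟩ ∈ B₂.1)
    (hg : ∀ c, ((g₁ c).1 : S) = (g₂ c).1)
    (hf : ∀ u₁ u₂, (u₁.1 : S) = u₂.1 → f₁ u₁ = f₂ u₂) (hx : x₁ = x₂) :
    kzGen F t g₁ f₁ x₁ (w A₁ B₁) = kzGen F t g₂ f₂ x₂ (w A₂ B₂) := by
  subst hA
  obtain rfl : B₁ = B₂ := Subtype.ext (Set.ext fun a => hB a.1 a.2 a.2)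
  obtain rfl : g₁ = g₂ := Function.Embedding.ext fun c => Subtype.ext (Subtype.ext (hg c))
  obtain rfl : f₁ = f₂ := funext fun u => hf u u rfl
  rw [hx]

/-- The factors `x` and `y` are wedged in opposite orders on the same component of `w`. The
hypotheses compare underlying elements of `S`, so that nothing has to be transported along the
equalities of subsets. -/
lemma kzGen₂_anticomm (w : ∀ A : Set S, KzTerm F A t) {A₁ A₂ : Set S} {B₁ : KzIndex A₁ t}
    {B₂ : KzIndex A₂ t} {g₁ : C ↪ B₁.1} {g₂ : C ↪ B₂.1} {f₁ : (B₁.1ᶜ : Set A₁) → T}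
    {f₂ : (B₂.1ᶜ : Set A₂) → T} {x₁ x₂ y₁ y₂ : T} (hA : A₁ = A₂)
    (hB : ∀ a (h₁ : a ∈ A₁) (h₂ : a ∈ A₂), ⟨a, h₁⟩ ∈ B₁.1 ↔ ⟨a, h₂⟩ ∈ B₂.1)
    (hg : ∀ c, ((g₁ c).1 : S) = (g₂ c).1)
    (hf : ∀ u₁ u₂, (u₁.1 : S) = u₂.1 → f₁ u₁ = f₂ u₂) (hx : x₁ = y₂) (hy : y₁ = x₂) :
    kzGen₂ F t g₁ f₁ x₁ y₁ (w A₁ B₁) + kzGen₂ F t g₂ f₂ x₂ y₂ (w A₂ B₂) = 0 := by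
  subst hA
  obtain rfl : B₁ = B₂ := Subtype.ext (Set.ext fun a => hB a.1 a.2 a.2)
  obtain rfl : g₁ = g₂ := Function.Embedding.ext fun c => Subtype.ext (Subtype.ext (hg c))
  obtain rfl : f₁ = f₂ := funext fun u => hf u u rfl
  rw [hx, hy]
  exact kzGen₂_swap F t _ _ _ _ _

lemma kzGen_kzGen_anticomm {C₁ C₂ T₁ T₂ : Type} [Finite C₁] [Finite C₂]
    (w : ∀ A : Set S, KzTerm F A t) {A₁ A₂ : Set S} {B₁ : KzIndex A₁ t}
    {B₂ : KzIndex A₂ t} {g₁ : C ↪ C₁} {g₂ : C ↪ C₂} {f₁ : T₁ → T} {f₂ : T₂ → T}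
    {g₁' : C₁ ↪ B₁.1} {g₂' : C₂ ↪ B₂.1} {f₁' : (B₁.1ᶜ : Set A₁) → T₁}
    {f₂' : (B₂.1ᶜ : Set A₂) → T₂} {x₁ x₂ : T} {y₁ : T₁} {y₂ : T₂} (hA : A₁ = A₂)
    (hB : ∀ a (h₁ : a ∈ A₁) (h₂ : a ∈ A₂), ⟨a, h₁⟩ ∈ B₁.1 ↔ ⟨a, h₂⟩ ∈ B₂.1)
    (hg : ∀ c, ((g₁' (g₁ c)).1 : S) = (g₂' (g₂ c)).1)
    (hf : ∀ u₁ u₂, (u₁.1 : S) = u₂.1 → f₁ (f₁' u₁) = f₂ (f₂' u₂)) (hx : x₁ = f₂ y₂)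
    (hy : f₁ y₁ = x₂) :
    kzGen F (t + 1) g₁ f₁ x₁ (kzGen F t g₁' f₁' y₁ (w A₁ B₁)) +
      kzGen F (t + 1) g₂ f₂ x₂ (kzGen F t g₂' f₂' y₂ (w A₂ B₂)) = 0 := by
  rw [kzGen_kzGen, kzGen_kzGen]
  exact kzGen₂_anticomm F w hA hB hg hf hx hy

end Congruence

/-- A subset not containing `x`, as a subset of the complement of `x`. -/
def KzIndex.erase {S : Type} [Finite S] {t : ℕ} (B : KzIndex S (t + 1)) (x : (B.1ᶜ : Set S)) :
    KzIndex ({x.1}ᶜ : Set S) t :=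
  ⟨Subtype.val ⁻¹' B.1, by
    rw [← Set.preimage_compl, ← Set.ncard_image_of_injective _ Subtype.val_injective,
      Subtype.image_preimage_coe, Set.inter_comm, ← Set.sdiff_eq,
      Set.ncard_sdiff_singleton_of_mem x.2, B.2, Nat.add_sub_cancel]⟩

/-- The inclusion of a subset not containing `x` in the complement of `x`. -/
def eraseEmb {S : Type} [Finite S] {t : ℕ} (B : KzIndex S (t + 1)) (x : (B.1ᶜ : Set S)) :
    B.1 ↪ (B.erase x).1 :=
  ⟨fun b => ⟨⟨b.1, fun h => x.2 (h ▸ b.2)⟩, b.2⟩, fun _ _ h =>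
    Subtype.ext (congrArg (fun c => c.1.1) h)⟩

/-- The inclusion of the complement of a subset in the complement of `x` in its complement. -/
def eraseCompl {S : Type} [Finite S] {t : ℕ} (B : KzIndex S (t + 1)) (x : (B.1ᶜ : Set S)) :
    ((B.erase x).1ᶜ : Set ({x.1}ᶜ : Set S)) → (B.1ᶜ : Set S) :=
  fun u => ⟨u.1.1, u.2⟩

attribute [local instance] Fintype.ofFinite

/-- The map `⨁_A Kzᵗ(A) → Kzᵗ⁺¹(S)` with components `α ↦ α ∧ x` at `A = S \ {x}`, and zero at the
other subsets `A`. -/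
noncomputable def rhoMap (F : FIopMod k) (S : Type) [Finite S] (t : ℕ) :
    (∀ A : Set S, KzTerm F A t) →ₗ[k] KzTerm F S (t + 1) :=
  -- The sign turns `x ∧ α` into `α ∧ x` for `α` of degree `t`. Without it the map would anticommute
  -- with the Koszul differential, which wedges on the left.
  LinearMap.pi fun B => (-1 : ℤ) ^ t • ∑ x : (B.1ᶜ : Set S),
    kzGen F t (eraseEmb B x) (eraseCompl B x) x ∘ₗ LinearMap.proj (B.erase x) ∘ₗ
      LinearMap.proj ({x.1}ᶜ : Set S)

lemma rhoMap_apply (F : FIopMod k) {S : Type} [Finite S] {t : ℕ} (w : ∀ A : Set S, KzTerm F A t)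
    (B : KzIndex S (t + 1)) :
    rhoMap F S t w B = (-1 : ℤ) ^ t • ∑ x : (B.1ᶜ : Set S),
      kzGen F t (eraseEmb B x) (eraseCompl B x) x (w {x.1}ᶜ (B.erase x)) := by
  rw [rhoMap, LinearMap.pi_apply, LinearMap.smul_apply, LinearMap.sum_apply]
  rfl

lemma kzMap_eq_kzMov (F : FIopMod k) {S T : Type} [Finite S] [Finite T] {t : ℕ} (e : S ≃ T)
    (z : KzTerm F T t) (B : KzIndex S t) : kzMap F t e z B =
      kzMov F t (e.subtypeEquiv fun _ => (e.injective.mem_set_image).symm :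
          B.1 ≃ (B.image e).1).toEmbedding
        (e.subtypeEquiv fun _ => not_congr (e.injective.mem_set_image).symm :
          (B.1ᶜ : Set S) ≃ ((B.image e).1ᶜ : Set T)).symm
        (z (B.image e)) := rfl

/-- The bijection `e` carries `S ∖ {x}` to `T ∖ {e x}`, so the sum over `x` is merely reindexed. -/
lemma rhoMap_kzMap (F : FIopMod k) {S T : Type} [Finite S] [Finite T] {t : ℕ} (e : S ≃ T)
    (w : ∀ A : Set T, KzTerm F A t) :
    rhoMap F S t (fun A => kzMap F t (imageEquiv e.toEmbedding A) (w (e.toEmbedding '' A))) =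
      kzMap F (t + 1) e (rhoMap F T t w) := by
  funext B
  rw [kzMap_eq_kzMov, rhoMap_apply, rhoMap_apply, map_zsmul, map_sum]
  congr 1
  refine Fintype.sum_equiv (e.subtypeEquiv fun s =>
    not_congr (e.injective.mem_set_image (a := s)).symm) _ _ fun x => ?_
  rw [kzMap_eq_kzMov, kzGen_kzMov, kzMov_kzGen]
  apply kzGen_congr F w
  · rw [Equiv.coe_toEmbedding, Set.image_compl_eq e.bijective, Set.image_singleton]
    rfl
  · rintro a ⟨b, hb, rfl⟩ h₂
    refine ((imageEquiv e.toEmbedding {x.1}ᶜ).injective.mem_set_image (a := ⟨b, hb⟩)).trans ?_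
    exact (e.injective.mem_set_image (s := B.1)).symm
  · intro c
    rfl
  · intro u₁ u₂ h
    obtain ⟨u, rfl⟩ := ((imageEquiv e.toEmbedding {x.1}ᶜ).subtypeEquiv fun _ => not_congr
      ((imageEquiv e.toEmbedding {x.1}ᶜ).injective.mem_set_image
        (s := (B.erase x).1)).symm).surjective u₁
    rw [Equiv.symm_apply_apply]
    refine Subtype.ext ?_
    exact (e.symm_apply_apply u.1.1).symm.trans (congrArg e.symm h)
  · simp

/-- The term of the composite of two of the maps `rhoMap`, indexed by `x` and `y`, on the image of
the comultiplication. -/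
noncomputable def rhoPair (F : FIopMod k) {S : Type} [Finite S] {t : ℕ}
    (w : ∀ A : Set S, KzTerm F A t) (B : KzIndex S (t + 2)) (x : (B.1ᶜ : Set S))
    (y : ((B.erase x).1ᶜ : Set ({x.1}ᶜ : Set S))) :
    F.obj (op ⟨(B.1 : Type)⟩) ⊗[k] orient k (B.1ᶜ : Set S) (t + 2) :=
  kzGen F (t + 1) (eraseEmb B x) (eraseCompl B x) x
    (kzGen F t (eraseEmb (B.erase x) y) (eraseCompl (B.erase x) y) y
      (kzMap F t (imageEquiv (Function.Embedding.subtype (· ∈ ({x.1}ᶜ : Set S))) {y.1}ᶜ)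
        (w (Function.Embedding.subtype (· ∈ ({x.1}ᶜ : Set S)) '' {y.1}ᶜ)) ((B.erase x).erase y)))

/-- Collapsing the composite to a single `kzGen₂` exposes the two wedged points and the one
component of `w` involved, which is the form that `kzGen₂_anticomm` takes. -/
lemma rhoPair_eq (F : FIopMod k) {S : Type} [Finite S] {t : ℕ}
    (w : ∀ A : Set S, KzTerm F A t) (B : KzIndex S (t + 2)) (x : (B.1ᶜ : Set S))
    (y : ((B.erase x).1ᶜ : Set ({x.1}ᶜ : Set S))) :
    rhoPair F w B x y = kzGen₂ F t
      ((eraseEmb B x).trans ((eraseEmb (B.erase x) y).trans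
        ((imageEquiv (Function.Embedding.subtype (· ∈ ({x.1}ᶜ : Set S))) {y.1}ᶜ).subtypeEquiv
          fun _ => ((imageEquiv (Function.Embedding.subtype (· ∈ ({x.1}ᶜ : Set S)))
            {y.1}ᶜ).injective.mem_set_image).symm :
          ((B.erase x).erase y).1 ≃ (((B.erase x).erase y).image (imageEquiv
            (Function.Embedding.subtype (· ∈ ({x.1}ᶜ : Set S))) {y.1}ᶜ)).1).toEmbedding))
      (fun u => eraseCompl B x (eraseCompl (B.erase x) y
        (((imageEquiv (Function.Embedding.subtype (· ∈ ({x.1}ᶜ : Set S))) {y.1}ᶜ).subtypeEquiv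
          fun _ => not_congr ((imageEquiv (Function.Embedding.subtype (· ∈ ({x.1}ᶜ : Set S)))
            {y.1}ᶜ).injective.mem_set_image).symm :
          (((B.erase x).erase y).1ᶜ : Set _) ≃ ((((B.erase x).erase y).image (imageEquiv
            (Function.Embedding.subtype (· ∈ ({x.1}ᶜ : Set S))) {y.1}ᶜ)).1ᶜ : Set _)).symm u)))
      x (eraseCompl B x y)
      (w (Function.Embedding.subtype (· ∈ ({x.1}ᶜ : Set S)) '' {y.1}ᶜ)
        (((B.erase x).erase y).image
          (imageEquiv (Function.Embedding.subtype (· ∈ ({x.1}ᶜ : Set S))) {y.1}ᶜ))) := by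
  refine (congrArg (kzGen F (t + 1) (eraseEmb B x) (eraseCompl B x) x)
    (kzGen_kzMov F t _ _ _ _ _ _)).trans ?_
  exact kzGen_kzGen F t _ _ _ _ _ _ _

/-- The comultiplication forgets the order in which two points are deleted: both terms read the
component of `w` at `S ∖ {x, x'}`, and they differ by `x ∧ x' = -x' ∧ x`. -/
lemma rhoPair_swap (F : FIopMod k) {S : Type} [Finite S] {t : ℕ}
    (w : ∀ A : Set S, KzTerm F A t) (B : KzIndex S (t + 2)) (x x' : (B.1ᶜ : Set S))
    (y : ((B.erase x).1ᶜ : Set ({x.1}ᶜ : Set S))) (y' : ((B.erase x').1ᶜ : Set ({x'.1}ᶜ : Set S)))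
    (h : y.1.1 = x'.1) (h' : y'.1.1 = x.1) :
    rhoPair F w B x y + rhoPair F w B x' y' = 0 := by
  refine (congrArg₂ (· + ·) (rhoPair_eq F w B x y) (rhoPair_eq F w B x' y')).trans ?_
  have hS : ∀ (a b : S) (ha : b ∈ ({a}ᶜ : Set S)), Function.Embedding.subtype
      (· ∈ ({a}ᶜ : Set S)) '' {⟨b, ha⟩}ᶜ = {a, b}ᶜ := by
    intro a b ha
    ext s
    simp only [Set.mem_image, Set.mem_compl_iff, Set.mem_singleton_iff, Set.mem_insert_iff,
      Function.Embedding.subtype_apply, Subtype.exists, Subtype.mk.injEq]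
    exact ⟨fun ⟨c, h1, h2, h3⟩ => h3 ▸ fun h => h.elim h1 h2,
      fun h => ⟨s, fun h1 => h (Or.inl h1), fun h2 => h (Or.inr h2), rfl⟩⟩
  apply kzGen₂_anticomm F w
  · rw [hS, hS, h, h', Set.pair_comm]
  · rintro a ⟨⟨b, hb⟩, hb', rfl⟩ ⟨⟨c, hc⟩, hc', hcb⟩
    obtain rfl : c = b := hcb
    have h1 := (imageEquiv (Function.Embedding.subtype (· ∈ ({x.1}ᶜ : Set S)))
      {y.1}ᶜ).injective.mem_set_image (s := ((B.erase x).erase y).1) (a := ⟨⟨c, hb⟩, hb'⟩)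
    have h2 := (imageEquiv (Function.Embedding.subtype (· ∈ ({x'.1}ᶜ : Set S)))
      {y'.1}ᶜ).injective.mem_set_image (s := ((B.erase x').erase y').1) (a := ⟨⟨c, hc⟩, hc'⟩)
    exact h1.trans h2.symm
  · intro c
    rfl
  · intro u₁ u₂ hu
    obtain ⟨u₁, rfl⟩ := ((imageEquiv _ {y.1}ᶜ).subtypeEquiv fun _ => not_congr
      ((imageEquiv _ {y.1}ᶜ).injective.mem_set_image
        (s := ((B.erase x).erase y).1)).symm).surjective u₁
    obtain ⟨u₂, rfl⟩ := ((imageEquiv _ {y'.1}ᶜ).subtypeEquiv fun _ => not_congr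
      ((imageEquiv _ {y'.1}ᶜ).injective.mem_set_image
        (s := ((B.erase x').erase y').1)).symm).surjective u₂
    rw [Equiv.symm_apply_apply, Equiv.symm_apply_apply]
    exact Subtype.ext hu
  · exact Subtype.ext h'.symm
  · exact Subtype.ext h

/-- The composite of two of the maps `rhoMap` on the image of the comultiplication vanishes, since
it is alternating. -/
lemma rhoMap_rhoMap (F : FIopMod k) {S : Type} [Finite S] {t : ℕ}
    (w : ∀ A : Set S, KzTerm F A t) :
    rhoMap F S (t + 1) (fun A => rhoMap F A t fun A' =>
      kzMap F t (imageEquiv (Function.Embedding.subtype (· ∈ A)) A')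
        (w (Function.Embedding.subtype (· ∈ A) '' A'))) = 0 := by
  funext B
  have h : ∀ x : (B.1ᶜ : Set S), kzGen F (t + 1) (eraseEmb B x) (eraseCompl B x) x
      (rhoMap F ({x.1}ᶜ : Set S) t (fun A' =>
        kzMap F t (imageEquiv (Function.Embedding.subtype (· ∈ ({x.1}ᶜ : Set S))) A')
          (w (Function.Embedding.subtype (· ∈ ({x.1}ᶜ : Set S)) '' A'))) (B.erase x)) =
      (-1 : ℤ) ^ t • ∑ y, rhoPair F w B x y := fun x => by
    rw [rhoMap_apply, map_zsmul, map_sum]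
    rfl
  have h2 : ∑ x, ∑ y, rhoPair F w B x y = 0 := by
    rw [Finset.sum_sigma' Finset.univ (fun x => Finset.univ)]
    have hne : ∀ a : (x : (B.1ᶜ : Set S)) × ((B.erase x).1ᶜ : Set ({x.1}ᶜ : Set S)),
        a.1.1 ≠ a.2.1.1 := fun a h => a.2.1.2 h.symm
    -- The involution exchanges `x` and `y`. It has no fixed point since `y` is taken in the
    -- complement of `x`.
    refine Finset.sum_involution (fun a _ => ⟨⟨a.2.1.1, a.2.2⟩, ⟨⟨a.1.1, hne a⟩, a.1.2⟩⟩)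
      ?_ ?_ ?_ ?_
    · intro a _
      exact rhoPair_swap F w B a.1 ⟨a.2.1.1, a.2.2⟩ a.2 ⟨⟨a.1.1, hne a⟩, a.1.2⟩ rfl rfl
    · intro a _ _ h
      exact hne a (congrArg (fun b => b.1.1) h).symm
    · intro a _
      exact Finset.mem_univ _
    · intro a _
      rfl
  rw [rhoMap_apply, Finset.sum_congr rfl fun x _ => h x, ← Finset.smul_sum, h2, smul_zero,
    smul_zero]
  rfl

lemma kzFace_eq_kzGen (F : FIopMod k) {S : Type} [Finite S] (t : ℕ) {B B' : Set S} (h : B ⊆ B')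
    (x : S) (hx : x ∈ Bᶜ) : kzFace F t h x hx = kzGen F t (Set.embeddingOfSubset B B' h)
      (Set.inclusion (Set.compl_subset_compl.mpr h)) ⟨x, hx⟩ := rfl

/-- Deleting a point from the ambient set and restricting along another point are independent
operations. Both composites start from the same component of `w`, and only the order of the two
wedge factors differs. -/
lemma kzGen_kzFace_swap (F : FIopMod k) {S : Type} [Finite S] {t : ℕ}
    (w : ∀ A : Set S, KzTerm F A t) (B : KzIndex S (t + 2)) (x x' : (B.1ᶜ : Set S))
    (y : ((B.erase x).1ᶜ : Set ({x.1}ᶜ : Set S))) (y' : ((B.insert x').1ᶜ : Set S))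
    (h : y.1.1 = x'.1) (h' : y'.1 = x.1) :
    kzGen F (t + 1) (eraseEmb B x) (eraseCompl B x) x
      (kzFace F t (Set.subset_insert _ (B.erase x).1) y.1 y.2
        (w {x.1}ᶜ ((B.erase x).insert y))) +
    kzFace F (t + 1) (Set.subset_insert _ B.1) x'.1 x'.2
      (kzGen F t (eraseEmb (B.insert x') y') (eraseCompl (B.insert x') y') y'
        (w {y'.1}ᶜ ((B.insert x').erase y'))) = 0 := by
  rw [kzFace_eq_kzGen, kzFace_eq_kzGen]
  refine kzGen_kzGen_anticomm F w (A₁ := {x.1}ᶜ) (A₂ := {y'.1}ᶜ) (B₁ := (B.erase x).insert y)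
    (B₂ := (B.insert x').erase y') ?_ ?_ ?_ ?_ ?_ ?_
  · rw [h']
  · intro a h₁ h₂
    refine or_congr ?_ Iff.rfl
    exact ⟨fun h3 => (congrArg Subtype.val h3).trans h, fun h3 => Subtype.ext (h3.trans h.symm)⟩
  · intro c
    rfl
  · intro u₁ u₂ h
    exact Subtype.ext h
  · exact Subtype.ext h'.symm
  · exact Subtype.ext h

/-- The term of `ρ d` indexed by `x` and `y`. -/
noncomputable def rhoFace (F : FIopMod k) {S : Type} [Finite S] {t : ℕ}
    (w : ∀ A : Set S, KzTerm F A t) (B : KzIndex S (t + 2)) (x : (B.1ᶜ : Set S))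
    (y : ((B.erase x).1ᶜ : Set ({x.1}ᶜ : Set S))) :
    F.obj (op ⟨(B.1 : Type)⟩) ⊗[k] orient k (B.1ᶜ : Set S) (t + 2) :=
  kzGen F (t + 1) (eraseEmb B x) (eraseCompl B x) x
    (kzFace F t (Set.subset_insert _ (B.erase x).1) y.1 y.2
      (w {x.1}ᶜ ((B.erase x).insert y)))

/-- The term of `d ρ` indexed by `x` and `y`, up to sign. -/
noncomputable def faceRho (F : FIopMod k) {S : Type} [Finite S] {t : ℕ}
    (w : ∀ A : Set S, KzTerm F A t) (B : KzIndex S (t + 2)) (x : (B.1ᶜ : Set S))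
    (y : ((B.insert x).1ᶜ : Set S)) :
    F.obj (op ⟨(B.1 : Type)⟩) ⊗[k] orient k (B.1ᶜ : Set S) (t + 2) :=
  kzFace F (t + 1) (Set.subset_insert _ B.1) x.1 x.2
    (kzGen F t (eraseEmb (B.insert x) y) (eraseCompl (B.insert x) y) y
      (w {y.1}ᶜ ((B.insert x).erase y)))

/-- Exchanging the roles of `x` and `y` is a bijection between the two index sets, and each matched
pair of terms cancels by `kzGen_kzFace_swap`. -/
lemma sum_rhoFace (F : FIopMod k) {S : Type} [Finite S] {t : ℕ} (w : ∀ A : Set S, KzTerm F A t)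
    (B : KzIndex S (t + 2)) :
    ∑ x, ∑ y, rhoFace F w B x y = - ∑ x, ∑ y, faceRho F w B x y := by
  rw [← Finset.sum_neg_distrib, Finset.sum_sigma' Finset.univ (fun x => Finset.univ)]
  simp only [← Finset.sum_neg_distrib]
  rw [Finset.sum_sigma' Finset.univ (fun x => Finset.univ)]
  have hne : ∀ (x : (B.1ᶜ : Set S)) (y : ((B.erase x).1ᶜ : Set ({x.1}ᶜ : Set S))),
      x.1 ∈ (B.insert ⟨y.1.1, y.2⟩).1ᶜ := fun x y h =>
    (Set.mem_insert_iff.mp h).elim (fun h => y.1.2 h.symm) x.2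
  have hne' : ∀ (x : (B.1ᶜ : Set S)) (y : ((B.insert x).1ᶜ : Set S)), x.1 ∈ ({y.1}ᶜ : Set S) :=
    fun x y h => y.2 (Set.mem_insert_iff.mpr (Or.inl h.symm))
  have hy : ∀ (x : (B.1ᶜ : Set S)) (y : ((B.insert x).1ᶜ : Set S)), y.1 ∈ B.1ᶜ :=
    fun x y h => y.2 (Set.mem_insert_of_mem _ h)
  refine Finset.sum_bij' (fun a _ => ⟨⟨a.2.1.1, a.2.2⟩, ⟨a.1.1, hne a.1 a.2⟩⟩)
    (fun a _ => ⟨⟨a.2.1, hy a.1 a.2⟩, ⟨⟨a.1.1, hne' a.1 a.2⟩, a.1.2⟩⟩) ?_ ?_ ?_ ?_ ?_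
  · exact fun _ _ => Finset.mem_univ _
  · exact fun _ _ => Finset.mem_univ _
  · exact fun _ _ => rfl
  · exact fun _ _ => rfl
  · intro a _
    rw [eq_neg_iff_add_eq_zero]
    exact kzGen_kzFace_swap F w B a.1 ⟨a.2.1.1, a.2.2⟩ a.2 ⟨a.1.1, hne a.1 a.2⟩ rfl rfl

/-- The sign from the exchange of two wedge factors is absorbed by the change from `(-1)ᵗ` to
`(-1)ᵗ⁺¹` in `rhoMap`. -/
lemma rhoMap_kzD (F : FIopMod k) {S : Type} [Finite S] {t : ℕ} (w : ∀ A : Set S, KzTerm F A t) :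
    rhoMap F S (t + 1) (fun A => kzD F A t (w A)) = kzD F S (t + 1) (rhoMap F S t w) := by
  funext B
  have h : ∀ x : (B.1ᶜ : Set S), kzGen F (t + 1) (eraseEmb B x) (eraseCompl B x) x
      (kzD F ({x.1}ᶜ : Set S) t (w {x.1}ᶜ) (B.erase x)) = ∑ y, rhoFace F w B x y := fun x => by
    rw [kzD_apply, map_sum]
    rfl
  have h' : ∀ x : (B.1ᶜ : Set S), kzFace F (t + 1) (Set.subset_insert _ B.1) x.1 x.2
      (rhoMap F S t w (B.insert x)) = (-1 : ℤ) ^ t • ∑ y, faceRho F w B x y := fun x => by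
    rw [rhoMap_apply, map_zsmul, map_sum]
    rfl
  refine (rhoMap_apply F _ B).trans (Eq.trans ?_ (kzD_apply F _ B).symm)
  refine (congrArg _ ((Finset.sum_congr rfl fun x _ => h x).trans (sum_rhoFace F w B))).trans
    (Eq.trans ?_ (Finset.sum_congr rfl fun x _ => h' x).symm)
  rw [← Finset.smul_sum, pow_succ, mul_smul, neg_one_zsmul, neg_neg]

end Rho

/-! ### Kernel and surjectivity of `rhoMap`, and the identification of `Kz⁰` with `F`. -/

section RhoProperties

variable {k : Type u} [CommRing k]

lemma pull_bijective (F : FIopMod k) {S T : Type} [Finite S] [Finite T] (g : S ↪ T)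
    (hg : Function.Surjective g) : Function.Bijective (pull F g) := by
  let e := Equiv.ofBijective g ⟨g.injective, hg⟩
  have h1 : ∀ y, pull F g (pull F e.symm.toEmbedding y) = y := fun y => by
    rw [pull_pull]
    exact (pull_congr F (fun x => e.symm_apply_apply x) y).trans (pull_refl F y)
  have h2 : ∀ y, pull F e.symm.toEmbedding (pull F g y) = y := fun y => by
    rw [pull_pull]
    exact (pull_congr F (fun x => e.apply_symm_apply x) y).trans (pull_refl F y)
  exact ⟨Function.LeftInverse.injective h2, Function.RightInverse.surjective h1⟩

lemma eraseEmb_surjective {S : Type} [Finite S] {t : ℕ} (B : KzIndex S (t + 1))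
    (x : (B.1ᶜ : Set S)) : Function.Surjective (eraseEmb B x) :=
  fun b => ⟨⟨b.1.1, b.2⟩, rfl⟩

lemma eraseCompl_surjective {S : Type} [Finite S] {t : ℕ} (B : KzIndex S (t + 1))
    (x y : (B.1ᶜ : Set S)) (h : y ≠ x) : ∃ u, eraseCompl B x u = y :=
  ⟨⟨⟨y.1, fun h' => h (Subtype.ext h')⟩, y.2⟩, rfl⟩

lemma kzGen_erase_surjective (F : FIopMod k) {S : Type} [Finite S] {t : ℕ} (B : KzIndex S (t + 1))
    (x : (B.1ᶜ : Set S)) :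
    Function.Surjective (kzGen F t (eraseEmb B x) (eraseCompl B x) x) :=
  TensorProduct.map_surjective (pull_bijective F _ (eraseEmb_surjective B x)).2
    (wedge_orientMap_surjective t x _ (eraseCompl_surjective B x) B.2)

attribute [local instance] Fintype.ofFinite

/-- Only the subsets `S ∖ {x}` contribute, and they are proper. This is why `rho` kills the image of
`η`, and why the component at `S` can be altered freely when elements are lifted. -/
lemma rhoMap_eq_zero (F : FIopMod k) {S : Type} [Finite S] {t : ℕ} (w : ∀ A : Set S, KzTerm F A t)
    (hw : ∀ A, A ≠ Set.univ → w A = 0) : rhoMap F S t w = 0 := by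
  funext B
  rw [rhoMap_apply, Finset.sum_eq_zero, smul_zero]
  · rfl
  · intro x _
    have h : w {x.1}ᶜ = 0 := hw _ fun h => by
      have := h ▸ Set.mem_univ x.1
      exact this rfl
    rw [h]
    exact map_zero _

/-- By linearity the target may be concentrated at one subset `B`. Its complement has `t + 1 > 0`
elements, and any single `x` in it yields a preimage supported at `S ∖ {x}`. -/
lemma rhoMap_surjective (F : FIopMod k) (S : Type) [Finite S] (t : ℕ) :
    Function.Surjective (rhoMap F S t) := by
  let _ : DecidableEq (Set S) := Classical.decEq _
  let _ : ∀ A : Set S, DecidableEq (KzIndex A t) := fun _ => Classical.decEq _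
  let _ : DecidableEq (KzIndex S (t + 1)) := Classical.decEq _
  rw [← LinearMap.range_eq_top, eq_top_iff]
  intro W _
  rw [← Finset.univ_sum_single W]
  refine sum_mem fun B _ => ?_
  have hne : B.1ᶜ.Nonempty := by
    rw [Set.nonempty_iff_ne_empty]
    intro h
    have := B.2
    rw [h, Set.ncard_empty] at this
    omega
  obtain ⟨x, hx⟩ := hne
  -- The factor `(-1)ᵗ` cancels the sign in `rhoMap`.
  obtain ⟨v, hv⟩ := kzGen_erase_surjective F B ⟨x, hx⟩ ((-1 : ℤ) ^ t • W B)
  let w : ∀ A : Set S, KzTerm F A t := Pi.single {x}ᶜ (Pi.single (B.erase ⟨x, hx⟩) v)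
  -- The subset is kept as a variable with an equation, so that the claim can be applied at `{y}ᶜ`
  -- when only `{y}ᶜ = {x}ᶜ` is known.
  have hw : ∀ (A : Set S) (D : KzIndex A t), A = {x}ᶜ → (∀ a : A, a ∈ D.1 ↔ a.1 ∈ B.1) ∨ w A D = 0 := by
    rintro A D rfl
    by_cases h : D = B.erase ⟨x, hx⟩
    · exact Or.inl fun a => by rw [h]; rfl
    · refine Or.inr ?_
      simp only [w, Pi.single_eq_same, Pi.single_eq_of_ne h]
  refine ⟨w, ?_⟩
  funext C
  rw [rhoMap_apply]
  by_cases hC : C = B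
  · subst hC
    rw [Finset.sum_eq_single ⟨x, hx⟩]
    · have : w {x}ᶜ (C.erase ⟨x, hx⟩) = v := by simp only [w, Pi.single_eq_same]
      rw [Pi.single_eq_same, this, hv, smul_smul, ← mul_pow]
      simp
    · intro y _ hy
      have : w {y.1}ᶜ = 0 := Pi.single_eq_of_ne (fun h => hy (Subtype.ext (by simpa using h))) _
      rw [this]
      exact map_zero _
    · intro h
      exact absurd (Finset.mem_univ _) h
  · rw [Pi.single_eq_of_ne hC, Finset.sum_eq_zero, smul_zero]
    intro y _
    suffices h : w {y.1}ᶜ (C.erase y) = 0 by rw [h, map_zero]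
    by_cases hy : ({y.1}ᶜ : Set S) = {x}ᶜ
    · refine (hw _ (C.erase y) hy).resolve_left fun h => hC (Subtype.ext (Set.ext fun s => ?_))
      by_cases hs : s = y.1
      · have hyx : y.1 = x := by simpa using hy
        exact iff_of_false (hs ▸ y.2) (hs ▸ hyx ▸ hx)
      · exact h ⟨s, hs⟩
    · have : w {y.1}ᶜ = 0 := Pi.single_eq_of_ne hy _
      rw [this]
      rfl

/-- The unit of the exterior algebra. -/
noncomputable def orientOne (k : Type u) [CommRing k] (S : Type) : orient k S 0 :=
  (exteriorPower.zeroEquiv k (S →₀ k)).symm 1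

lemma orientMap_one {S T : Type} (f : S → T) :
    orientMap 0 f (orientOne k S) = orientOne k T := by
  rw [orientOne, orientOne, LinearEquiv.eq_symm_apply, orientMap,
    ← LinearEquiv.coe_coe, ← LinearMap.comp_apply, exteriorPower.zeroEquiv_naturality,
    LinearEquiv.coe_coe, LinearEquiv.apply_symm_apply]

/-- The isomorphism `F(S) ≃ Kz⁰(S)`. -/
noncomputable def kzZero (F : FIopMod k) (S : Type) [Finite S] :
    F.obj (op ⟨S⟩) →ₗ[k] KzTerm F S 0 :=
  LinearMap.pi fun B => (TensorProduct.mk k _ _).flip (orientOne k (B.1ᶜ : Set S)) ∘ₗ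
    pull F (Function.Embedding.subtype (· ∈ B.1))

lemma kzZero_apply (F : FIopMod k) {S : Type} [Finite S] (y : F.obj (op ⟨S⟩)) (B : KzIndex S 0) :
    kzZero F S y B = pull F (Function.Embedding.subtype (· ∈ B.1)) y ⊗ₜ
      orientOne k (B.1ᶜ : Set S) := rfl

lemma KzIndex.eq_univ {S : Type} [Finite S] (B : KzIndex S 0) : B.1 = Set.univ := by
  have := (Set.ncard_eq_zero (Set.toFinite _)).mp B.2
  rwa [Set.compl_empty_iff] at this

lemma kzZero_bijective (F : FIopMod k) (S : Type) [Finite S] :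
    Function.Bijective (kzZero F S) := by
  have hm : ∀ A C : Type, [Finite A] → Function.Bijective
      ((TensorProduct.mk k (F.obj (op ⟨A⟩)) (orient k C 0)).flip (orientOne k C)) := by
    intro A C _
    let e : F.obj (op ⟨A⟩) ≃ₗ[k] F.obj (op ⟨A⟩) ⊗[k] orient k C 0 :=
      (TensorProduct.rid k _).symm ≪≫ₗ
        TensorProduct.congr (LinearEquiv.refl k _) (exteriorPower.zeroEquiv k (C →₀ k)).symm
    have : ((TensorProduct.mk k (F.obj (op ⟨A⟩)) (orient k C 0)).flip (orientOne k C)) =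
        e.toLinearMap := by
      ext y
      rfl
    rw [this]
    exact e.bijective
  let U : KzIndex S 0 := ⟨Set.univ, by simp⟩
  have hU : ∀ B : KzIndex S 0, B = U := fun B => Subtype.ext B.eq_univ
  have hb : Function.Bijective (fun y => kzZero F S y U) :=
    (hm _ _).comp (pull_bijective F _ fun s => ⟨⟨s, Set.mem_univ s⟩, rfl⟩)
  refine ⟨fun y y' h => hb.1 (congrFun h U), fun z => ?_⟩
  obtain ⟨y, hy⟩ := hb.2 (z U)
  exact ⟨y, funext fun B => by rw [hU B]; exact hy⟩

/-- In degree `0` the sign is `1`. The restriction to `B` passes through `S ∖ {x}` on one side and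
through `B ∪ {x}` on the other, and the two agree by functoriality. -/
lemma rhoMap_kzZero (F : FIopMod k) {S : Type} [Finite S] (y : F.obj (op ⟨S⟩)) :
    rhoMap F S 0 (fun A => kzZero F A (pull F (Function.Embedding.subtype (· ∈ A)) y)) =
      kzD F S 0 (kzZero F S y) := by
  funext B
  rw [rhoMap_apply, kzD_apply, pow_zero, one_smul]
  refine Finset.sum_congr rfl fun x _ => ?_
  rw [kzFace_eq_kzGen, kzZero_apply, kzZero_apply, kzGen, kzGen]
  refine (TensorProduct.map_tmul _ _ _ _).trans (Eq.trans ?_ (TensorProduct.map_tmul _ _ _ _).symm)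
  rw [LinearMap.comp_apply, LinearMap.comp_apply, orientMap_one, orientMap_one, pull_pull,
    pull_pull, pull_pull]
  rfl

lemma kzMap_kzZero (F : FIopMod k) {S T : Type} [Finite S] [Finite T] (e : S ≃ T)
    (y : F.obj (op ⟨T⟩)) :
    kzMap F 0 e (kzZero F T y) = kzZero F S (pull F e.toEmbedding y) := by
  funext B
  rw [kzMap_eq_kzMov, kzZero_apply, kzZero_apply, kzMov]
  refine (TensorProduct.map_tmul _ _ _ _).trans ?_
  rw [orientMap_one, pull_pull, pull_pull]
  rfl

/-! ### Functoriality for morphisms of `𝚺ᵒᵖ`-modules -/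

/-- The map `F(S) → H(S)` given by a morphism of the underlying `𝚺ᵒᵖ`-modules. -/
def sigApp {F H : FIopMod k} (φ : (down k).obj F ⟶ (down k).obj H) (S : Type) [Finite S] :
    F.obj (op ⟨S⟩) →ₗ[k] H.obj (op ⟨S⟩) :=
  (φ.app (op ⟨S⟩)).hom

/-- A morphism of `𝚺ᵒᵖ`-modules respects bijections only, and surjectivity makes the injection `g`
one of these. -/
lemma sigApp_pull {F H : FIopMod k} (φ : (down k).obj F ⟶ (down k).obj H) {S T : Type} [Finite S]
    [Finite T] (g : S ↪ T) (hg : Function.Surjective g) (y : F.obj (op ⟨T⟩)) :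
    sigApp φ S (pull F g y) = pull H g (sigApp φ T y) := by
  let e := Equiv.ofBijective g ⟨g.injective, hg⟩
  exact act_naturality φ e y

/-- The map of Koszul terms induced by a morphism of the underlying `𝚺ᵒᵖ`-modules. -/
noncomputable def kzSig {F H : FIopMod k} (φ : (down k).obj F ⟶ (down k).obj H) (S : Type)
    [Finite S] (t : ℕ) : KzTerm F S t →ₗ[k] KzTerm H S t :=
  LinearMap.pi fun B => TensorProduct.map (sigApp φ B.1) LinearMap.id ∘ₗ LinearMap.proj B

lemma kzSig_apply {F H : FIopMod k} (φ : (down k).obj F ⟶ (down k).obj H) {S : Type}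
    [Finite S] {t : ℕ} (z : KzTerm F S t) (B : KzIndex S t) :
    kzSig φ S t z B = TensorProduct.map (sigApp φ B.1) LinearMap.id (z B) := rfl

lemma map_kzGen {F H : FIopMod k} (φ : (down k).obj F ⟶ (down k).obj H) (t : ℕ)
    {A A' T T' : Type} [Finite A] [Finite A'] (g : A ↪ A') (hg : Function.Surjective g)
    (f : T' → T) (x : T) (w : F.obj (op ⟨A'⟩) ⊗[k] orient k T' t) :
    TensorProduct.map (sigApp φ A) LinearMap.id (kzGen F t g f x w) =
      kzGen H t g f x (TensorProduct.map (sigApp φ A') LinearMap.id w) := by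
  induction w using TensorProduct.induction_on with
  | zero => simp only [map_zero]
  | add v w hv hw => simp only [map_add, hv, hw]
  | tmul Y a =>
    simp only [kzGen, TensorProduct.map_tmul, sigApp_pull φ g hg, LinearMap.id_apply]

/-- The embedding of `B` in `B.erase x` is onto, so `rhoMap` moves elements of `F` along bijections
only. Unlike the Koszul differential, it is therefore natural in the underlying `𝚺ᵒᵖ`-module, and
the projection to `Kz` will respect splittings over `𝚺`. -/
lemma rhoMap_kzSig {F H : FIopMod k} (φ : (down k).obj F ⟶ (down k).obj H) {S : Type}
    [Finite S] {t : ℕ} (w : ∀ A : Set S, KzTerm F A t) :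
    rhoMap H S t (fun A => kzSig φ A t (w A)) = kzSig φ S (t + 1) (rhoMap F S t w) := by
  funext B
  rw [kzSig_apply, rhoMap_apply, rhoMap_apply, map_zsmul, map_sum]
  congr 1
  refine Finset.sum_congr rfl fun x _ => ?_
  rw [map_kzGen φ t _ (eraseEmb_surjective B x)]
  rfl

lemma kzZero_sigApp {F H : FIopMod k} (φ : (down k).obj F ⟶ (down k).obj H) {S : Type}
    [Finite S] (y : F.obj (op ⟨S⟩)) : kzZero H S (sigApp φ S y) = kzSig φ S 0 (kzZero F S y) := by
  funext B
  have hg : Function.Surjective (Function.Embedding.subtype (· ∈ B.1)) := fun s =>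
    ⟨⟨s, B.eq_univ ▸ Set.mem_univ s⟩, rfl⟩
  rw [kzSig_apply, kzZero_apply, kzZero_apply, ← sigApp_pull φ _ hg]
  rfl

end RhoProperties

lemma Cosimplicial.alt_comp_eq {C : Type u} [Category.{v} C] [Abelian C] (A : Cosimplicial C)
    {n : ℕ} {Y : C} (f : A.X (n + 1) ⟶ Y) {g : A.X n ⟶ Y} (h : ∀ i : Fin (n + 1), A.d i.succ ≫ f = 0)
    (h0 : A.d 0 ≫ f = g) : A.alt n ≫ f = g := by
  rw [Cosimplicial.alt, Preadditive.sum_comp, Fin.sum_univ_succ, Finset.sum_eq_zero, add_zero,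
    Fin.val_zero, pow_zero, one_smul, h0]
  intro i _
  rw [Preadditive.zsmul_comp, h, smul_zero]

lemma map_comp_comp {C : Type u} [Category.{v} C] (G : C ⥤ C) {X Y Z W : C} (f : X ⟶ Y) (g : Y ⟶ Z)
    (h : G.obj Z ⟶ W) : G.map f ≫ G.map g ≫ h = G.map (f ≫ g) ≫ h := by
  rw [G.map_comp, Category.assoc]

/-! ### The projection `⊥ⁿ F → Kzⁿ F` as a cochain map. -/

section Projection

variable {k : Type u} [CommRing k]

lemma map_kzMov {F H : FIopMod k} (φ : (down k).obj F ⟶ (down k).obj H) (t : ℕ)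
    {A A' T T' : Type} [Finite A] [Finite A'] (g : A ↪ A') (hg : Function.Surjective g)
    (f : T' → T) (w : F.obj (op ⟨A'⟩) ⊗[k] orient k T' t) :
    TensorProduct.map (sigApp φ A) LinearMap.id (kzMov F t g f w) =
      kzMov H t g f (TensorProduct.map (sigApp φ A') LinearMap.id w) := by
  induction w using TensorProduct.induction_on with
  | zero => simp only [map_zero]
  | add v w hv hw => simp only [map_add, hv, hw]
  | tmul Y a =>
    simp only [kzMov, TensorProduct.map_tmul, sigApp_pull φ g hg, LinearMap.id_apply]

lemma kzMap_kzSig {F H : FIopMod k} (φ : (down k).obj F ⟶ (down k).obj H) {S T : Type} [Finite S]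
    [Finite T] {t : ℕ} (e : S ≃ T) (z : KzTerm F T t) :
    kzMap H t e (kzSig φ T t z) = kzSig φ S t (kzMap F t e z) := by
  funext B
  rw [kzSig_apply, kzMap_eq_kzMov, kzMap_eq_kzMov, map_kzMov φ t _ (Equiv.surjective _)]
  rfl

/-- The morphism `(Kz F)ᵗ → (Kz H)ᵗ` induced by a morphism of the underlying `𝚺ᵒᵖ`-modules. -/
noncomputable def kzXSig {F H : FIopMod k} (φ : (down k).obj F ⟶ (down k).obj H) (t : ℕ) :
    kzX F t ⟶ kzX H t where
  app S := ModuleCat.ofHom (kzSig φ S.unop t)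
  naturality _ _ f :=
    ModuleCat.hom_ext (LinearMap.ext fun z => (kzMap_kzSig φ f.unop z).symm)

/-- The differential of the Koszul complex, as a morphism of `𝚺ᵒᵖ`-modules. -/
noncomputable def kzd (F : FIopMod k) (t : ℕ) : kzX F t ⟶ kzX F (t + 1) where
  app S := ModuleCat.ofHom (kzD F S.unop t)
  naturality _ _ f :=
    ModuleCat.hom_ext (LinearMap.ext fun z => (kzMap_kzD F f.unop z).symm)

/-- The maps `⨁_A Kzᵗ(A) → Kzᵗ⁺¹(S)`, as a morphism of `𝚺ᵒᵖ`-modules. -/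
noncomputable def rho (F : FIopMod k) (t : ℕ) : (perp k).obj (kzX F t) ⟶ kzX F (t + 1) where
  app S := ModuleCat.ofHom (rhoMap F S.unop t)
  naturality _ _ f :=
    ModuleCat.hom_ext (LinearMap.ext fun w => rhoMap_kzMap F f.unop w)

/-- The isomorphism of `F` with `Kz⁰ F`, as a morphism of `𝚺ᵒᵖ`-modules. -/
noncomputable def kzIn (F : FIopMod k) : (down k).obj F ⟶ kzX F 0 where
  app S := ModuleCat.ofHom (kzZero F S.unop)
  naturality _ _ f :=
    ModuleCat.hom_ext (LinearMap.ext fun y => (kzMap_kzZero F f.unop y).symm)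

/-- The `⊥`-comodule given by an `𝐅𝐈ᵒᵖ`-module. -/
noncomputable abbrev comod (F : FIopMod k) : (perp k).Coalgebra :=
  (Comonad.comparison (adj k)).obj F

/-- The projection `⊥ⁿ F → Kzⁿ F`. -/
noncomputable def proj (F : FIopMod k) : ∀ n, iter (perp k) (comod F).A n ⟶ kzX F n
  | 0 => kzIn F
  | n + 1 => (perp k).map (proj F n) ≫ rho F n

lemma proj_succ (F : FIopMod k) (n : ℕ) :
    proj F (n + 1) = (perp k).map (proj F n) ≫ rho F n := rfl

lemma eta_rho (F : FIopMod k) (t : ℕ) : (coaug k).η.app (kzX F t) ≫ rho F t = 0 :=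
  module_ext fun S y => rhoMap_eq_zero F (incl (kzX F t) S.unop y) fun _ hA =>
    incl_of_ne (kzX F t) y hA

lemma delta_rho (F : FIopMod k) (t : ℕ) :
    (perp k).δ.app (kzX F t) ≫ (perp k).map (rho F t) ≫ rho F (t + 1) = 0 :=
  module_ext fun S w => rhoMap_rhoMap F (S := S.unop) w

lemma map_kzd_rho (F : FIopMod k) (t : ℕ) :
    (perp k).map (kzd F t) ≫ rho F (t + 1) = rho F t ≫ kzd F (t + 1) :=
  module_ext fun S w => rhoMap_kzD F (S := S.unop) w

lemma comod_rho (F : FIopMod k) :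
    (comod F).a ≫ (perp k).map (kzIn F) ≫ rho F 0 = kzIn F ≫ kzd F 0 :=
  module_ext fun S y => rhoMap_kzZero F (S := S.unop) y

lemma perp_map_zero (X Y : SigopMod k) : (perp k).map (0 : X ⟶ Y) = 0 :=
  module_ext fun _ _ => rfl

lemma eta_proj (F : FIopMod k) (n : ℕ) :
    (coaug k).η.app (iter (perp k) (comod F).A n) ≫ proj F (n + 1) = 0 := by
  rw [proj_succ, ← Category.assoc, ← (coaug k).η_naturality, Category.assoc, eta_rho, comp_zero]

/-- The coface `d⁰ = η` dies under the outermost `rho`, and `d¹ = Δ` dies under the two outermost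
ones. The other cofaces are `⊥` of a coface one degree lower, which dies by induction. -/
lemma cobarD_castSucc_proj (F : FIopMod k) (n : ℕ) (i : Fin (n + 1)) :
    cobarD (coaug k) (comod F) n i.castSucc ≫ proj F (n + 1) = 0 := by
  induction n with
  | zero =>
    obtain rfl := Fin.fin_one_eq_zero i
    exact eta_proj F 0
  | succ n ih =>
    induction i using Fin.cases with
    | zero => exact eta_proj F (n + 1)
    | succ j =>
      by_cases hj : j = 0
      · subst hj
        -- Naturality of `δ` moves `proj F n` to the left of the comultiplication, which then meets
        -- two consecutive `rho`.
        refine Eq.trans ?_ ((congrArg ((perp k).map (proj F n) ≫ ·) (delta_rho F n)).trans comp_zero)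
        refine Eq.trans ?_ (Category.assoc _ _ _)
        refine Eq.trans ?_ (congrArg (· ≫ (perp k).map (rho F n) ≫ rho F (n + 1))
          ((perp k).δ.naturality (proj F n)).symm)
        refine Eq.trans ?_ (Category.assoc _ _ _).symm
        exact congrArg ((perp k).δ.app (iter (perp k) (comod F).A n) ≫ ·)
          (map_comp_comp (perp k).toFunctor ((perp k).map (proj F n)) (rho F n)
            (rho F (n + 1))).symm
      · obtain ⟨i, hi⟩ := Fin.exists_succ_eq.mpr hj
        have h : cobarD (coaug k) (comod F) (n + 1) j.succ.castSucc =
            (perp k).map (cobarD (coaug k) (comod F) n j.castSucc) := by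
          cases n with
          | zero => exact absurd (Fin.fin_one_eq_zero j) hj
          | succ n =>
            subst hi
            rfl
        refine (congrArg (· ≫ proj F (n + 2)) h).trans ?_
        refine (map_comp_comp (perp k).toFunctor _ (proj F (n + 1)) (rho F (n + 1))).trans ?_
        refine (congrArg (fun f => (perp k).map f ≫ rho F (n + 1)) (ih j)).trans ?_
        exact (congrArg (· ≫ rho F (n + 1)) (perp_map_zero _ _)).trans zero_comp

/-- The last coface is `⊥` of the last coface one degree lower. The identity holds in degree `0` by
the definition of the comodule structure and propagates because `rho` commutes with the Koszul
differential. -/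
lemma cobarD_last_proj (F : FIopMod k) (n : ℕ) :
    cobarD (coaug k) (comod F) n (Fin.last (n + 1)) ≫ proj F (n + 1) = proj F n ≫ kzd F n := by
  induction n with
  | zero => exact comod_rho F
  | succ n ih =>
    have h : cobarD (coaug k) (comod F) (n + 1) (Fin.last (n + 2)) =
        (perp k).map (cobarD (coaug k) (comod F) n (Fin.last (n + 1))) := rfl
    refine (congrArg (· ≫ proj F (n + 2)) h).trans ?_
    refine (map_comp_comp (perp k).toFunctor _ (proj F (n + 1)) (rho F (n + 1))).trans ?_
    refine (congrArg (fun f => (perp k).map f ≫ rho F (n + 1)) ih).trans ?_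
    refine (map_comp_comp (perp k).toFunctor (proj F n) (kzd F n) (rho F (n + 1))).symm.trans ?_
    rw [map_kzd_rho]
    exact (Category.assoc _ _ _).symm

/-- The opposite of the cosimplicial `𝚺ᵒᵖ`-module `ℭF`. -/
noncomputable abbrev oppCobar (F : FIopMod k) : Cosimplicial (SigopMod k) :=
  ((cobarFI k).obj F).opp

/-- In the opposite object the one coface that survives `proj` has index `0`, so it enters the
alternating sum with sign `+1`. In `ℭF` itself its sign would be `(-1)ⁿ⁺¹`. -/
lemma alt_proj (F : FIopMod k) (n : ℕ) :
    (oppCobar F).alt n ≫ proj F (n + 1) = proj F n ≫ kzd F n := by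
  refine (oppCobar F).alt_comp_eq (proj F (n + 1)) (fun i => ?_) (cobarD_last_proj F n)
  change cobarD (coaug k) (comod F) n i.succ.rev ≫ _ = 0
  rw [Fin.rev_succ]
  exact cobarD_castSucc_proj F n _

lemma map_kzXSig_rho {F H : FIopMod k} (φ : (down k).obj F ⟶ (down k).obj H) (t : ℕ) :
    (perp k).map (kzXSig φ t) ≫ rho H t = rho F t ≫ kzXSig φ (t + 1) :=
  module_ext fun S w => rhoMap_kzSig φ (S := S.unop) w

lemma iterMap_proj {F H : FIopMod k} (φ : (down k).obj F ⟶ (down k).obj H) (n : ℕ) :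
    iterMap (perp k) φ n ≫ proj H n = proj F n ≫ kzXSig φ n := by
  induction n with
  | zero => exact module_ext fun S y => kzZero_sigApp φ (S := S.unop) y
  | succ n ih =>
    refine (map_comp_comp (perp k).toFunctor (iterMap (perp k) φ n) (proj H n) (rho H n)).trans ?_
    refine (congrArg (fun f => (perp k).map f ≫ rho H n) ih).trans ?_
    refine (map_comp_comp (perp k).toFunctor (proj F n) (kzXSig φ n) (rho H n)).symm.trans ?_
    rw [map_kzXSig_rho]
    exact (Category.assoc _ _ _).symm

variable (k) in
/-- The morphism `N((ℭF)ᵒᵖ) → Kz F`. -/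
noncomputable def koszulProj : normCobar k ⟶ kzFunctor k where
  app F := CochainComplex.ofHom (V := SigopMod k)
    (fun n => (oppCobar F).normι n ≫ proj F n) fun n => by
      dsimp only [normCobar, kzFunctor, kz, Functor.comp_obj, Cosimplicial.normFunctor,
        Cosimplicial.norm]
      rw [CochainComplex.of_d, CochainComplex.of_d]
      refine (Category.assoc _ _ _).trans ?_
      refine Eq.trans ?_ ((oppCobar F).normD_ι_assoc n (proj F (n + 1))).symm
      rw [alt_proj]
      rfl
  naturality F H φ := by
    ext n : 1
    refine ((oppCobar F).normMap_ι_assoc (B := oppCobar H)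
      (Cosimplicial.oppFunctor.map ((cobarFI k).map φ)) n (proj H n)).trans ?_
    refine Eq.trans ?_ (Category.assoc _ _ _).symm
    exact congrArg ((oppCobar F).normι n ≫ ·) (iterMap_proj ((down k).map φ) n)

end Projection

/-! ### Contracting homotopies, and elements of the normalized complex. -/

namespace Cosimplicial

/-- An extra codegeneracy gives a contracting homotopy of the unnormalized complex. -/
lemma alt_comp_add_comp_alt {C : Type u} [Category.{v} C] [Abelian C] (A : Cosimplicial C)
    (h : ∀ n, A.X (n + 1) ⟶ A.X n) {n : ℕ} (h0 : A.d 0 ≫ h (n + 1) = 𝟙 (A.X (n + 1)))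
    (hs : ∀ i : Fin (n + 2), A.d i.succ ≫ h (n + 1) = h n ≫ A.d i) :
    A.alt (n + 1) ≫ h (n + 1) + h n ≫ A.alt n = 𝟙 (A.X (n + 1)) := by
  simp only [alt, Preadditive.sum_comp, Preadditive.comp_sum, Preadditive.zsmul_comp,
    Preadditive.comp_zsmul]
  rw [Fin.sum_univ_succ, h0, Fin.val_zero, pow_zero, one_smul, add_assoc,
    ← Finset.sum_add_distrib, Finset.sum_eq_zero, add_zero]
  intro i _
  rw [hs, Fin.val_succ, pow_succ, mul_neg_one, neg_smul, neg_add_cancel]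

variable {k : Type u} [CommRing k]

lemma normι_injective (A : Cosimplicial (SigopMod k)) (n : ℕ) (S : Sigᵒᵖ) :
    Function.Injective ((A.normι n).app S).hom := by
  rw [← ModuleCat.mono_iff_injective]
  infer_instance

lemma exists_normι_eq (A : Cosimplicial (SigopMod k)) (n : ℕ) (S : Sigᵒᵖ) (z : (A.X n).obj S)
    (hz : ∀ j, ((A.codegen n j).app S).hom z = 0) : ∃ y, ((A.normι n).app S).hom y = z := by
  let K : ShortComplex (SigopMod k) :=
    ShortComplex.mk (A.normι n) (A.degen n) (kernel.condition _)
  have hK : K.Exact := K.exact_of_f_is_kernel (kernelIsKernel (A.degen n))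
  have h := hK.map ((evaluation Sigᵒᵖ (ModuleCat.{u} k)).obj S)
  rw [ShortComplex.moduleCat_exact_iff] at h
  refine h z ?_
  -- The identity of the product is the sum of the projections followed by the insertions `i j`.
  -- Hence `degen` is a sum of maps factoring through the codegeneracies, and its vanishing on `z`
  -- needs no description of the elements of the product.
  let i : ∀ _ : Fin n, A.X (n - 1) ⟶ ∏ᶜ fun _ : Fin n => A.X (n - 1) := fun j =>
    Pi.lift fun j' => if j = j' then 𝟙 _ else 0
  have hi : 𝟙 (∏ᶜ fun _ : Fin n => A.X (n - 1)) = ∑ j, Pi.π _ j ≫ i j := by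
    refine Pi.hom_ext _ _ fun j' => ?_
    rw [Preadditive.sum_comp, Finset.sum_eq_single j']
    · simp [i]
    · intro j _ hj
      simp [i, hj]
    · simp
  have hd : A.degen n = ∑ j, A.codegen n j ≫ i j := by
    rw [← Category.comp_id (A.degen n), hi, Preadditive.comp_sum]
    refine Finset.sum_congr rfl fun j _ => ?_
    rw [← Category.assoc, degen, Pi.lift_π]
  change ((A.degen n).app S).hom z = 0
  rw [hd, NatTrans.app_sum, ModuleCat.hom_sum, LinearMap.sum_apply]
  refine Finset.sum_eq_zero fun j _ => ?_
  exact (congrArg ((i j).app S).hom (hz j)).trans (map_zero _)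

end Cosimplicial

/-! ### The extra codegeneracy of a cofree comodule. -/

section ExtraCodegeneracy

variable {C : Type u} [Category.{v} C] {G : Comonad C} (c : Coaugmentation G)

/-- The extra codegeneracy `⊥ⁿ⁺¹ ε_Y` of the cobar-type cosimplicial object of a cofree comodule. -/
def extra (G : Comonad C) (Y : C) : ∀ n : ℕ, iter G (G.obj Y) (n + 1) ⟶ iter G (G.obj Y) n
  | 0 => G.map (G.ε.app Y)
  | n + 1 => G.map (extra G Y n)

/-- The structure morphism of a cofree comodule is `Δ`, so this is `⊥ⁿ` applied to a counit law of
the comonad. -/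
lemma cobarD_last_extra (Y : C) (n : ℕ) :
    cobarD c (G.cofree.obj Y) n (Fin.last (n + 1)) ≫ extra G Y n = 𝟙 _ := by
  induction n with
  | zero => exact G.right_counit Y
  | succ n ih => exact (G.map_comp _ _).symm.trans ((congrArg G.map ih).trans (G.map_id _))

lemma cobarD_castSucc_extra (Y : C) (n : ℕ) (i : Fin (n + 2)) :
    cobarD c (G.cofree.obj Y) (n + 1) i.castSucc ≫ extra G Y (n + 1) =
      extra G Y n ≫ cobarD c (G.cofree.obj Y) n i := by
  induction n with
  | zero =>
    induction i using Fin.cases with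
    | zero => exact (c.η_naturality (extra G Y 0)).symm
    | succ i =>
      obtain rfl := Fin.fin_one_eq_zero i
      exact (G.δ.naturality (G.ε.app Y)).symm
  | succ n ih =>
    induction i using Fin.cases with
    | zero => exact (c.η_naturality (extra G Y (n + 1))).symm
    | succ i =>
      induction i using Fin.cases with
      | zero => exact (G.δ.naturality (extra G Y n)).symm
      | succ i =>
        exact (G.map_comp _ _).symm.trans ((congrArg G.map (ih i.succ)).trans (G.map_comp _ _))

/-- Each `sʲ` acts further out than the extra codegeneracy, so the two commute. Consequently the
contracting homotopy preserves normalized elements. -/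
lemma extra_cobarS (Y : C) (n : ℕ) (j : Fin (n + 1)) :
    extra G Y (n + 1) ≫ cobarS G (G.obj Y) n j =
      cobarS G (G.obj Y) (n + 1) j.castSucc ≫ extra G Y n := by
  induction n with
  | zero =>
    obtain rfl := Fin.fin_one_eq_zero j
    exact G.ε.naturality _
  | succ n ih =>
    induction j using Fin.cases with
    | zero => exact G.ε.naturality (extra G Y (n + 1))
    | succ j =>
      exact (G.map_comp _ _).symm.trans ((congrArg G.map (ih j)).trans (G.map_comp _ _))

lemma iterMap_cobarS {Y Z : C} (f : Y ⟶ Z) (n : ℕ) (j : Fin (n + 1)) :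
    cobarS G Y n j ≫ iterMap G f n = iterMap G f (n + 1) ≫ cobarS G Z n j := by
  induction n with
  | zero => exact (G.ε.naturality f).symm
  | succ n ih =>
    induction j using Fin.cases with
    | zero => exact (G.ε.naturality (iterMap G f (n + 1))).symm
    | succ j =>
      exact (G.map_comp _ _).symm.trans ((congrArg G.map (ih j)).trans (G.map_comp _ _))

end ExtraCodegeneracy

/-! ### Normalized elements and surjectivity of the projection. -/

section Elements

variable {k : Type u} [CommRing k]

/-- The elements of `⊥ⁿ Y (S)` which are killed by the codegeneracies. -/
def IsNorm (Y : SigopMod k) : ∀ (n : ℕ) (S : Sigᵒᵖ) (_ : (iter (perp k) Y n).obj S), Prop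
  | 0 => fun _ _ => True
  | n + 1 => fun S z => ∀ j : Fin (n + 1), ((cobarS (perp k) Y n j).app S).hom z = 0

/-- The codegeneracy `s⁰ = ε` reads the component at `S`, and `sʲ⁺¹ = ⊥ sʲ` acts on each component
separately. -/
lemma IsNorm.of_components {Y : SigopMod k} {n : ℕ} {S : Sigᵒᵖ}
    (z : ∀ A : Set S.unop, (iter (perp k) Y n).obj (op ⟨A⟩)) (h : z Set.univ = 0)
    (hz : ∀ A : Set S.unop, IsNorm Y n (op ⟨A⟩) (z A)) : IsNorm Y (n + 1) S z := by
  intro j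
  have h0 : ((cobarS (perp k) Y n 0).app S).hom z = 0 := by
    rw [cobarS_zero]
    exact (congrArg (act (iter (perp k) Y n) (Equiv.Set.univ S.unop).symm) h).trans (map_zero _)
  cases n with
  | zero =>
    obtain rfl := Fin.fin_one_eq_zero j
    exact h0
  | succ n =>
    induction j using Fin.cases with
    | zero => exact h0
    | succ j => exact funext fun A => hz A j

lemma IsNorm.sub {Y : SigopMod k} {n : ℕ} {S : Sigᵒᵖ} {z z' : (iter (perp k) Y n).obj S}
    (h : IsNorm Y n S z) (h' : IsNorm Y n S z') : IsNorm Y n S (z - z') := by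
  cases n with
  | zero => trivial
  | succ n => exact fun j => by rw [map_sub, h j, h' j, sub_zero]

lemma IsNorm.iterMap {Y Z : SigopMod k} (f : Y ⟶ Z) {n : ℕ} {S : Sigᵒᵖ}
    {z : (iter (perp k) Y n).obj S} (h : IsNorm Y n S z) :
    IsNorm Z n S (((FIop.iterMap (perp k) f n).app S).hom z) := by
  cases n with
  | zero => trivial
  | succ n =>
    intro j
    have h1 := congrArg (fun g => (g.app S).hom z) (iterMap_cobarS (G := perp k) f n j)
    exact h1.symm.trans ((congrArg ((FIop.iterMap (perp k) f n).app S).hom (h j)).trans (map_zero _))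

lemma IsNorm.extra {Y : SigopMod k} {n : ℕ} {S : Sigᵒᵖ}
    {z : (iter (perp k) ((perp k).obj Y) (n + 1)).obj S}
    (h : IsNorm ((perp k).obj Y) (n + 1) S z) :
    IsNorm ((perp k).obj Y) n S (((FIop.extra (perp k) Y n).app S).hom z) := by
  cases n with
  | zero => trivial
  | succ n =>
    intro j
    have h1 := congrArg (fun g => (g.app S).hom z) (extra_cobarS (G := perp k) Y n j)
    exact h1.trans ((congrArg ((FIop.extra (perp k) Y n).app S).hom (h j.castSucc)).trans
      (map_zero _))

/-- The opposite object has the same codegeneracies in reverse order, so the two conditions cut out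
the same elements. -/
lemma IsNorm.normι (F : FIopMod k) {n : ℕ} {S : Sigᵒᵖ} (y : ((oppCobar F).normX n).obj S) :
    IsNorm (comod F).A n S ((((oppCobar F).normι n).app S).hom y) := by
  cases n with
  | zero => trivial
  | succ n =>
    intro j
    have h := congrArg (fun g => (g.app S).hom y) ((oppCobar F).normι_s j.rev)
    have h2 : (oppCobar F).s j.rev = cobarS (perp k) (comod F).A n j :=
      congrArg (cobarS (perp k) (comod F).A n) (Fin.rev_rev j)
    exact (congrArg (fun g => (g.app S).hom ((((oppCobar F).normι (n + 1)).app S).hom y))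
      h2.symm).trans h

lemma IsNorm.exists_normι_eq (F : FIopMod k) {n : ℕ} {S : Sigᵒᵖ}
    {z : (iter (perp k) (comod F).A n).obj S} (h : IsNorm (comod F).A n S z) :
    ∃ y, (((oppCobar F).normι n).app S).hom y = z := by
  refine (oppCobar F).exists_normι_eq n S z fun j => ?_
  cases n with
  | zero => exact j.elim0
  | succ n => exact h j.rev

lemma rhoMap_congr (F : FIopMod k) {S : Type} [Finite S] {t : ℕ} {w w' : ∀ A : Set S, KzTerm F A t}
    (h : ∀ A, A ≠ Set.univ → w A = w' A) : rhoMap F S t w = rhoMap F S t w' := by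
  rw [← sub_eq_zero, ← map_sub]
  exact rhoMap_eq_zero F _ fun A hA => sub_eq_zero.mpr (h A hA)

/-- After lifting along `rhoMap`, the components are lifted by induction. The component at `S` is
then replaced by zero: this makes `s⁰` vanish and is invisible to `rhoMap`. -/
lemma IsNorm.exists_proj_eq (F : FIopMod k) (n : ℕ) (S : Sigᵒᵖ) (W : KzTerm F S.unop n) :
    ∃ z, IsNorm (comod F).A n S z ∧ ((proj F n).app S).hom z = W := by
  induction n generalizing S with
  | zero =>
    obtain ⟨y, hy⟩ := (kzZero_bijective F S.unop).2 W
    exact ⟨y, trivial, hy⟩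
  | succ n ih =>
    classical
    obtain ⟨w, rfl⟩ := rhoMap_surjective F S.unop n W
    choose z hz hzw using fun A : Set S.unop => ih (op ⟨A⟩) (w A)
    let z' : ∀ A : Set S.unop, (iter (perp k) (comod F).A n).obj (op ⟨A⟩) :=
      fun A => if A = Set.univ then 0 else z A
    refine ⟨z', IsNorm.of_components z' (if_pos rfl) fun A => ?_, ?_⟩
    · by_cases hA : A = Set.univ
      -- Zero is written as a difference so that `IsNorm.sub` shows it to be normalized.
      · have h : z' A = z A - z A := by rw [sub_self]; exact if_pos hA
        rw [h]
        exact (hz A).sub (hz A)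
      · have h : z' A = z A := if_neg hA
        rw [h]
        exact hz A
    · refine rhoMap_congr F (w := fun A => ((proj F n).app (op ⟨A⟩)).hom (z' A)) fun A hA => ?_
      have h : z' A = z A := if_neg hA
      exact (congrArg ((proj F n).app (op ⟨A⟩)).hom h).trans (hzw A)

lemma koszulProj_surjective (F : FIopMod k) (n : ℕ) (S : Sigᵒᵖ) :
    Function.Surjective (((((koszulProj k).app F).f n).app S).hom) := by
  intro W
  obtain ⟨z, hz, hW⟩ := IsNorm.exists_proj_eq F n S W
  obtain ⟨y, rfl⟩ := hz.exists_normι_eq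
  exact ⟨y, hW⟩

end Elements

/-! ### Exactness of the Koszul complex of a cofree module in positive degrees. -/

section KoszulCofree

variable {k : Type u} [CommRing k]

/-- The bijection `f⁻¹(A) ≃ A`, for `A` contained in the range of an injection `f`. -/
noncomputable def preimageEquiv {S T : Type} (f : S ↪ T) {A : Set T} (h : A ⊆ Set.range f) :
    (f ⁻¹' A : Set S) ≃ A :=
  Equiv.ofBijective (fun s => ⟨f s.1, s.2⟩)
    ⟨fun _ _ h' => Subtype.ext (f.injective (congrArg Subtype.val h')), fun a => by
      obtain ⟨s, hs⟩ := h a.2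
      exact ⟨⟨s, show f s ∈ A from hs ▸ a.2⟩, Subtype.ext hs⟩⟩

open Classical in
/-- Extension by zero `⨁_{A ⊆ S} G(A) → ⨁_{A ⊆ T} G(A)` along an injection `S ↪ T`. -/
noncomputable def upExt (G : SigopMod k) {S T : Type} [Finite S] [Finite T] (f : S ↪ T) :
    (up.obj G).obj (op ⟨S⟩) →ₗ[k] (up.obj G).obj (op ⟨T⟩) :=
  (LinearMap.pi fun A => if h : A ⊆ Set.range f then
    act G (preimageEquiv f h).symm ∘ₗ LinearMap.proj (f ⁻¹' A : Set S) else 0 :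
    (∀ A : Set S, G.obj (op ⟨A⟩)) →ₗ[k] (∀ A : Set T, G.obj (op ⟨A⟩)))

lemma upExt_of_not (G : SigopMod k) {S T : Type} [Finite S] [Finite T] (f : S ↪ T)
    (z : ∀ A : Set S, G.obj (op ⟨A⟩)) {A : Set T} (h : ¬ A ⊆ Set.range f) :
    (upExt G f z : ∀ A : Set T, G.obj (op ⟨A⟩)) A = 0 := by
  change (LinearMap.pi _ : (∀ A : Set S, G.obj (op ⟨A⟩)) →ₗ[k] _) z A = 0
  rw [LinearMap.pi_apply, dif_neg h]
  rfl

lemma upExt_of_subset (G : SigopMod k) {S T : Type} [Finite S] [Finite T] (f : S ↪ T)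
    (z : ∀ A : Set S, G.obj (op ⟨A⟩)) {A : Set T} (h : A ⊆ Set.range f) :
    (upExt G f z : ∀ A : Set T, G.obj (op ⟨A⟩)) A =
      act G (preimageEquiv f h).symm (z (f ⁻¹' A)) := by
  change (LinearMap.pi _ : (∀ A : Set S, G.obj (op ⟨A⟩)) →ₗ[k] _) z A = _
  rw [LinearMap.pi_apply, dif_pos h]
  rfl

lemma act_upExt (G : SigopMod k) {C S T : Type} [Finite C] [Finite S] [Finite T] (f : S ↪ T)
    (z : ∀ A : Set S, G.obj (op ⟨A⟩)) {A : Set T} {A' : Set S} (e : C ≃ A) (e' : C ≃ A')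
    (h : ∀ c, f (e' c) = e c) :
    act G e ((upExt G f z : ∀ A : Set T, G.obj (op ⟨A⟩)) A) = act G e' (z A') := by
  have hA : A ⊆ Set.range f := fun a ha =>
    ⟨e' (e.symm ⟨a, ha⟩), by rw [h, Equiv.apply_symm_apply]⟩
  rw [upExt_of_subset G f z hA, act_act]
  refine act_congr G z _ _ fun c => f.injective ?_
  rw [h]
  exact congrArg Subtype.val ((preimageEquiv f hA).apply_symm_apply (e c))

/-- Base change for extension by zero and restriction. -/
lemma pull_upExt (G : SigopMod k) {P P' Q Q' : Type} [Finite P] [Finite P'] [Finite Q] [Finite Q']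
    (f : P ↪ Q) (f' : P' ↪ Q') (a : P ↪ P') (b : Q ↪ Q') (h : ∀ p, b (f p) = f' (a p))
    (hb : ∀ q, b q ∈ Set.range f' → q ∈ Set.range f) (z : (up.obj G).obj (op ⟨P'⟩)) :
    pull (up.obj G) b (upExt G f' z) = upExt G f (pull (up.obj G) a z) := by
  refine funext fun A : Set Q => ?_
  change act G (imageEquiv b A) ((upExt G f' z : ∀ A : Set Q', G.obj (op ⟨A⟩)) (b '' A)) =
    (upExt G f (upMap G a z) : ∀ A : Set Q, G.obj (op ⟨A⟩)) A
  by_cases hA : A ⊆ Set.range f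
  · rw [upExt_of_subset G f _ hA, act_upMap G a z (preimageEquiv f hA).symm
      ((preimageEquiv f hA).symm.trans (imageEquiv a _)) fun _ => rfl]
    refine act_upExt G f' z _ _ fun c => ?_
    obtain ⟨c, rfl⟩ := (preimageEquiv f hA).surjective c
    rw [Equiv.trans_apply, Equiv.symm_apply_apply]
    exact (h c.1).symm
  -- The hypothesis `hb` says that the square is cartesian: if `b(A)` lies in the range of `f'`,
  -- then `A` lies in the range of `f`. So both sides vanish at `A`.
  · rw [upExt_of_not G f _ hA]
    refine (congrArg (act G _) (upExt_of_not G f' z fun h' => hA fun q hq => ?_)).trans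
      (map_zero _)
    exact hb q (h' (Set.mem_image_of_mem b hq))

lemma pull_upExt_self (G : SigopMod k) {S T : Type} [Finite S] [Finite T] (f : S ↪ T)
    (z : (up.obj G).obj (op ⟨S⟩)) : pull (up.obj G) f (upExt G f z) = z := by
  refine funext fun A : Set S => ?_
  exact (act_upExt G f z (imageEquiv f A) (Equiv.refl A) fun _ => rfl).trans (act_refl G _)

variable {S : Type} [Finite S]

/-- The isomorphism `α ↦ x ∧ α` of orientation modules. -/
noncomputable def wedgeEquiv {t : ℕ} {C : KzIndex S (t + 1)} {B : KzIndex S t} {x : S}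
    (hx : x ∈ C.1ᶜ) (h : B.1 = insert x C.1) :
    orient k (B.1ᶜ : Set S) t ≃ₗ[k] orient k (C.1ᶜ : Set S) (t + 1) :=
  LinearEquiv.ofBijective (wedge t ⟨x, hx⟩ ∘ₗ
      orientMap t (Set.inclusion (Set.compl_subset_compl.mpr (h ▸ Set.subset_insert x C.1))))
    ⟨wedge_orientMap_injective t _ _ (Set.inclusion_injective _) fun a ha => a.2
        ((Set.ext_iff.mp h a.1).mpr (Or.inl (congrArg Subtype.val ha))),
      wedge_orientMap_surjective t _ _ (fun y hy => ⟨⟨y.1, fun hB => by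
        rw [h] at hB
        exact hB.elim (fun h' => hy (Subtype.ext h')) y.2⟩, rfl⟩) C.2⟩

lemma wedgeEquiv_apply {t : ℕ} {C : KzIndex S (t + 1)} {B : KzIndex S t} {x : S}
    (hx : x ∈ C.1ᶜ) (h : B.1 = insert x C.1) (hCB : C.1 ⊆ B.1) (a : orient k (B.1ᶜ : Set S) t) :
    wedgeEquiv hx h a = wedge t ⟨x, hx⟩
      (orientMap t (Set.inclusion (Set.compl_subset_compl.mpr hCB)) a) := rfl

/-- For `B = C ∪ {x}`, the map in the opposite direction to that of the differential, for the
Koszul complex of a cofree module. -/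
noncomputable def kzBack (G : SigopMod k) {t : ℕ} {C : KzIndex S (t + 1)} {B : KzIndex S t} {x : S}
    (hx : x ∈ C.1ᶜ) (h : B.1 = insert x C.1) :
    (up.obj G).obj (op ⟨(C.1 : Type)⟩) ⊗[k] orient k (C.1ᶜ : Set S) (t + 1) →ₗ[k]
      (up.obj G).obj (op ⟨(B.1 : Type)⟩) ⊗[k] orient k (B.1ᶜ : Set S) t :=
  TensorProduct.map (upExt G (Set.embeddingOfSubset C.1 B.1 (h ▸ Set.subset_insert x C.1)))
    (wedgeEquiv hx h).symm.toLinearMap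

/-- Restriction undoes extension by zero. The opposite composite loses the summands of subsets
containing `x`, so `kzBack` is only a one-sided inverse. -/
lemma kzFace_kzBack (G : SigopMod k) {t : ℕ} {C : KzIndex S (t + 1)} {B : KzIndex S t} {x : S}
    (hx : x ∈ C.1ᶜ) (h : B.1 = insert x C.1) (hCB : C.1 ⊆ B.1)
    (w : (up.obj G).obj (op ⟨(C.1 : Type)⟩) ⊗[k] orient k (C.1ᶜ : Set S) (t + 1)) :
    kzFace (up.obj G) t hCB x hx (kzBack G hx h w) = w := by
  induction w using TensorProduct.induction_on with
  | zero => simp only [map_zero]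
  | add v w hv hw => simp only [map_add, hv, hw]
  | tmul Y a =>
    refine congrArg₂ (· ⊗ₜ[k] ·) (pull_upExt_self G _ Y) ?_
    exact (wedgeEquiv hx h).apply_symm_apply a

/-- Since `x ∉ Dy`, the intersection of `Dx` and `Dy` is `D`, so the square of inclusions is
cartesian and base change applies. -/
lemma pull_upExt_insert (G : SigopMod k) {D Dx Dy Dxy : Set S} {x : S} (hx' : x ∈ Dyᶜ)
    (hDx : Dx = insert x D) (l : D ⊆ Dx) (h : Dy ⊆ Dxy) (i : Dx ⊆ Dxy) (j : D ⊆ Dy)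
    (Y : (up.obj G).obj (op ⟨Dy⟩)) :
    pull (up.obj G) (Set.embeddingOfSubset Dx Dxy i)
        (upExt G (Set.embeddingOfSubset Dy Dxy h) Y) =
      upExt G (Set.embeddingOfSubset D Dx l)
        (pull (up.obj G) (Set.embeddingOfSubset D Dy j) Y) := by
  refine pull_upExt G (Set.embeddingOfSubset D Dx l) (Set.embeddingOfSubset Dy Dxy h)
    (Set.embeddingOfSubset D Dy j) (Set.embeddingOfSubset Dx Dxy i) (fun _ => rfl) ?_ Y
  rintro q ⟨p, hp⟩
  have hpq : p.1 = q.1 := congrArg Subtype.val hp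
  have hq : q.1 ∈ D := by
    have h2 : q.1 ∈ insert x D := hDx ▸ q.2
    exact h2.resolve_left fun h3 => hx' (h3 ▸ hpq ▸ p.2)
  exact ⟨⟨q.1, hq⟩, rfl⟩

/-- After applying the isomorphism `x ∧ -`, the claim becomes `x ∧ y ∧ b + y ∧ x ∧ b = 0`. -/
lemma wedge_wedgeEquiv_symm {t : ℕ} {D : KzIndex S (t + 2)}
    {Dx Dy : KzIndex S (t + 1)} {Dxy : KzIndex S t} {x y : S} (hx : x ∈ D.1ᶜ) (hy : y ∈ D.1ᶜ)
    (hx' : x ∈ Dy.1ᶜ) (hy' : y ∈ Dx.1ᶜ) (hDx : Dx.1 = insert x D.1)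
    (h : Dxy.1 = insert x Dy.1) (i : Dx.1 ⊆ Dxy.1) (j : D.1 ⊆ Dy.1)
    (a : orient k (Dy.1ᶜ : Set S) (t + 1)) :
    wedge t ⟨y, hy'⟩ (orientMap t (Set.inclusion (Set.compl_subset_compl.mpr i))
        ((wedgeEquiv hx' h).symm a)) +
      (wedgeEquiv hx hDx).symm (wedge (t + 1) ⟨y, hy⟩ (orientMap (t + 1)
          (Set.inclusion (Set.compl_subset_compl.mpr j)) a)) = 0 := by
  obtain ⟨b, rfl⟩ := (wedgeEquiv hx' h).surjective a
  apply (wedgeEquiv (k := k) hx hDx).injective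
  rw [map_add, map_zero, LinearEquiv.apply_symm_apply, LinearEquiv.symm_apply_apply,
    wedgeEquiv_apply hx hDx (hDx ▸ Set.subset_insert x D.1),
    wedgeEquiv_apply hx' h (h ▸ Set.subset_insert x Dy.1), orientMap_wedge, orientMap_wedge,
    orientMap_orientMap, orientMap_orientMap]
  exact wedge_wedge _ _ _ _

lemma kzFace_kzBack_tmul (G : SigopMod k) {t : ℕ} {Dx Dy : KzIndex S (t + 1)} {Dxy : KzIndex S t}
    {x y : S} (hx' : x ∈ Dy.1ᶜ) (hy' : y ∈ Dx.1ᶜ) (h : Dxy.1 = insert x Dy.1) (l : Dy.1 ⊆ Dxy.1)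
    (i : Dx.1 ⊆ Dxy.1) (Y : (up.obj G).obj (op ⟨(Dy.1 : Type)⟩))
    (a : orient k (Dy.1ᶜ : Set S) (t + 1)) :
    kzFace (up.obj G) t i y hy' (kzBack G hx' h (Y ⊗ₜ[k] a)) =
      (pull (up.obj G) (Set.embeddingOfSubset Dx.1 Dxy.1 i)
        (upExt G (Set.embeddingOfSubset Dy.1 Dxy.1 l) Y)) ⊗ₜ[k]
      wedge t ⟨y, hy'⟩ (orientMap t (Set.inclusion (Set.compl_subset_compl.mpr i))
        ((wedgeEquiv hx' h).symm a)) := rfl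

lemma kzBack_kzFace_tmul (G : SigopMod k) {t : ℕ} {D : KzIndex S (t + 2)}
    {Dx Dy : KzIndex S (t + 1)} {x y : S} (hx : x ∈ D.1ᶜ) (hy : y ∈ D.1ᶜ)
    (hDx : Dx.1 = insert x D.1) (l : D.1 ⊆ Dx.1) (j : D.1 ⊆ Dy.1)
    (Y : (up.obj G).obj (op ⟨(Dy.1 : Type)⟩)) (a : orient k (Dy.1ᶜ : Set S) (t + 1)) :
    kzBack G hx hDx (kzFace (up.obj G) (t + 1) j y hy (Y ⊗ₜ[k] a)) =
      (upExt G (Set.embeddingOfSubset D.1 Dx.1 l)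
        (pull (up.obj G) (Set.embeddingOfSubset D.1 Dy.1 j) Y)) ⊗ₜ[k]
      (wedgeEquiv hx hDx).symm (wedge (t + 1) ⟨y, hy⟩ (orientMap (t + 1)
          (Set.inclusion (Set.compl_subset_compl.mpr j)) a)) := rfl

/-- On the first tensor factor the operations for `x` and `y` commute by base change. On the second,
`y ∧ -` anticommutes with the inverse of `x ∧ -`. -/
lemma kzFace_kzBack_anticomm (G : SigopMod k) {t : ℕ} {D : KzIndex S (t + 2)}
    {Dx Dy : KzIndex S (t + 1)} {Dxy : KzIndex S t} {x y : S} (hx : x ∈ D.1ᶜ) (hy : y ∈ D.1ᶜ)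
    (hx' : x ∈ Dy.1ᶜ) (hy' : y ∈ Dx.1ᶜ) (hDx : Dx.1 = insert x D.1)
    (h : Dxy.1 = insert x Dy.1) (i : Dx.1 ⊆ Dxy.1) (j : D.1 ⊆ Dy.1)
    (w : (up.obj G).obj (op ⟨(Dy.1 : Type)⟩) ⊗[k] orient k (Dy.1ᶜ : Set S) (t + 1)) :
    kzFace (up.obj G) t i y hy' (kzBack G hx' h w) +
      kzBack G hx hDx (kzFace (up.obj G) (t + 1) j y hy w) = 0 := by
  induction w using TensorProduct.induction_on with
  | zero => simp only [map_zero, add_zero]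
  | add v w hv hw =>
    simp only [map_add]
    rw [add_add_add_comm, hv, hw, add_zero]
  | tmul Y a =>
    have l : D.1 ⊆ Dx.1 := hDx ▸ Set.subset_insert x D.1
    have l' : Dy.1 ⊆ Dxy.1 := h ▸ Set.subset_insert x Dy.1
    rw [kzFace_kzBack_tmul G hx' hy' h l' i, kzBack_kzFace_tmul G hx hy hDx l j,
      pull_upExt_insert G hx' hDx l l' i j, ← TensorProduct.tmul_add,
      wedge_wedgeEquiv_symm hx hy hx' hy' hDx h i j, TensorProduct.tmul_zero]

/-- The subset `B \ {x}`, for `x ∈ B`. -/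
def KzIndex.remove {t : ℕ} (B : KzIndex S t) (x : S) (hx : x ∈ B.1) : KzIndex S (t + 1) :=
  ⟨B.1 \ {x}, by
    rw [Set.compl_sdiff, Set.union_comm, Set.union_singleton,
      Set.ncard_insert_of_notMem (fun h : x ∈ B.1ᶜ => h hx), B.2]⟩

lemma KzIndex.insert_remove {t : ℕ} (B : KzIndex S t) {x : S} (hx : x ∈ B.1) :
    B.1 = Insert.insert x (B.remove x hx).1 :=
  (Set.insert_sdiff_self_of_mem hx).symm

open Classical in
/-- The map `Kzᵗ⁺¹(S) → Kzᵗ(S)` with components `kzBack`, for a cofree module. -/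
noncomputable def kzHomotopy (G : SigopMod k) (x : S) {t : ℕ} (w : KzTerm (up.obj G) S (t + 1)) :
    KzTerm (up.obj G) S t := fun B =>
  if hx : x ∈ B.1 then
    kzBack G (C := B.remove x hx) (fun h => h.2 rfl) (B.insert_remove hx) (w (B.remove x hx))
  else 0

lemma kzHomotopy_of_notMem (G : SigopMod k) {x : S} {t : ℕ} (w : KzTerm (up.obj G) S (t + 1))
    {B : KzIndex S t} (hx : x ∉ B.1) : kzHomotopy G x w B = 0 := dif_neg hx

lemma kzHomotopy_of_eq (G : SigopMod k) {x : S} {t : ℕ} (w : KzTerm (up.obj G) S (t + 1))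
    {C : KzIndex S (t + 1)} {B : KzIndex S t} (hx : x ∈ C.1ᶜ) (h : B.1 = insert x C.1) :
    kzHomotopy G x w B = kzBack G hx h (w C) := by
  have hB : x ∈ B.1 := h ▸ Set.mem_insert x C.1
  obtain rfl : C = B.remove x hB := Subtype.ext (by
    change C.1 = B.1 \ {x}
    rw [h, Set.insert_sdiff_of_mem _ (Set.mem_singleton x), Set.sdiff_singleton_eq_self hx])
  exact dif_pos hB

attribute [local instance] Fintype.ofFinite

/-- When `x ∉ B`, the only set `B ∪ {y}` containing `x` is the one with `y = x`, and its term is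
`kzFace` after `kzBack`. -/
lemma kzD_kzHomotopy_of_notMem (G : SigopMod k) {x : S} {t : ℕ} (w : KzTerm (up.obj G) S (t + 1))
    {B : KzIndex S (t + 1)} (hx : x ∉ B.1) :
    kzD (up.obj G) S t (kzHomotopy G x w) B = w B := by
  rw [kzD_apply]
  refine (Finset.sum_eq_single ⟨x, hx⟩ ?_ fun h => absurd (Finset.mem_univ _) h).trans ?_
  · intro y _ hy
    rw [kzHomotopy_of_notMem, map_zero]
    exact fun h => h.elim (fun h => hy (Subtype.ext h.symm)) hx
  · have h : (B.insert ⟨x, hx⟩).1 = insert x B.1 := rfl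
    exact (congrArg (kzFace (up.obj G) t (Set.subset_insert x B.1) x hx)
      (kzHomotopy_of_eq G w hx h)).trans (kzFace_kzBack G hx h _ (w B))

/-- Anticommutation moves the sum over `y` inside `kzBack`, where it becomes the component of `d w`
at `B ∖ {x}` without its term `y = x`. That term comes from `w B = 0`, so nothing is missing, and `d
w = 0`. -/
lemma kzD_kzHomotopy_of_eq_zero (G : SigopMod k) {x : S} {t : ℕ}
    (w : KzTerm (up.obj G) S (t + 1)) (hw : kzD (up.obj G) S (t + 1) w = 0)
    {B : KzIndex S (t + 1)} (hx : x ∈ B.1) (hB : w B = 0) :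
    kzD (up.obj G) S t (kzHomotopy G x w) B = 0 := by
  have hxD : x ∈ (B.remove x hx).1ᶜ := fun h => h.2 rfl
  have hy : ∀ y : (B.1ᶜ : Set S), y.1 ∈ (B.remove x hx).1ᶜ := fun y h => y.2 h.1
  have hxy : ∀ y : (B.1ᶜ : Set S), x ∈ ((B.remove x hx).insert ⟨y.1, hy y⟩).1ᶜ := fun y h =>
    h.elim (fun h => y.2 (h ▸ hx)) hxD
  have h1 : ∀ y : (B.1ᶜ : Set S), kzFace (up.obj G) t (Set.subset_insert y.1 B.1) y.1 y.2
      (kzHomotopy G x w (B.insert y)) = - kzBack G hxD (B.insert_remove hx)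
        (kzFace (up.obj G) (t + 1) (Set.subset_insert y.1 (B.remove x hx).1) y.1 (hy y)
          (w ((B.remove x hx).insert ⟨y.1, hy y⟩))) := fun y => by
    have h : (B.insert y).1 = insert x ((B.remove x hx).insert ⟨y.1, hy y⟩).1 :=
      (congrArg (insert y.1) (B.insert_remove hx)).trans (Set.insert_comm _ _ _)
    rw [kzHomotopy_of_eq G w (hxy y) h, eq_neg_iff_add_eq_zero]
    exact kzFace_kzBack_anticomm G hxD (hy y) (hxy y) y.2 (B.insert_remove hx) h _ _ _
  have h2 : ∑ y : (B.1ᶜ : Set S),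
      kzFace (up.obj G) (t + 1) (Set.subset_insert y.1 (B.remove x hx).1) y.1 (hy y)
        (w ((B.remove x hx).insert ⟨y.1, hy y⟩)) = 0 := by
    -- The sum over `y ∉ B` is extended to `y ∉ B ∖ {x}`. The only new index is `x`, where the term
    -- vanishes by `hB`.
    refine (Fintype.sum_of_injective (fun y : (B.1ᶜ : Set S) =>
      (⟨y.1, hy y⟩ : ((B.remove x hx).1ᶜ : Set S))) (fun y y' h => Subtype.ext
        (congrArg (fun c => c.1) h)) _ (fun y => kzFace (up.obj G) (t + 1)
          (Set.subset_insert y.1 (B.remove x hx).1) y.1 y.2 (w ((B.remove x hx).insert y)))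
      ?_ fun y => rfl).trans ((kzD_apply (up.obj G) w (B.remove x hx)).symm.trans
        (congrFun hw _))
    intro y hyr
    have hyx : y.1 = x := by
      by_contra h
      exact hyr ⟨⟨y.1, fun h' => y.2 ⟨h', h⟩⟩, rfl⟩
    have h3 : w ((B.remove x hx).insert y) = 0 := by
      have : (B.remove x hx).insert y = B :=
        Subtype.ext ((congrArg (fun s => insert s (B.remove x hx).1) hyx).trans
          (B.insert_remove hx).symm)
      rw [this, hB]
    rw [h3, map_zero]
  rw [kzD_apply, Finset.sum_congr rfl fun y _ => h1 y, Finset.sum_neg_distrib, ← map_sum, h2,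
    map_zero, neg_zero]

/-- The Koszul complex of a cofree module is exact in positive degrees. -/
lemma exists_kzD_eq (G : SigopMod k) {t : ℕ} (w : KzTerm (up.obj G) S (t + 1))
    (hw : kzD (up.obj G) S (t + 1) w = 0) : ∃ v, kzD (up.obj G) S t v = w := by
  classical
  -- Subtracting the coboundary of the homotopy for `x` clears every component at a `B` that misses
  -- `x`, and keeps the components already cleared equal to zero. Applying this to each point of `S`
  -- in turn clears all `B ≠ S`.
  have key : ∀ X : Finset S, ∃ v, ∀ B : KzIndex S (t + 1), (∃ x ∈ X, x ∉ B.1) →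
      (w - kzD (up.obj G) S t v) B = 0 := by
    intro X
    induction X using Finset.induction_on with
    | empty => exact ⟨0, fun B ⟨x, hx, _⟩ => absurd hx (Finset.notMem_empty x)⟩
    | insert x X _ ih =>
      obtain ⟨v, hv⟩ := ih
      set w' := w - kzD (up.obj G) S t v with hw'
      have hdw' : kzD (up.obj G) S (t + 1) w' = 0 := by rw [hw', map_sub, hw, kzD_kzD, sub_zero]
      refine ⟨v + kzHomotopy G x w', fun B hB => ?_⟩
      rw [map_add, ← sub_sub, ← hw', Pi.sub_apply]
      by_cases hx : x ∈ B.1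
      · obtain ⟨y, hy, hyB⟩ := hB
        have h0 : w' B = 0 := hv B ⟨y, (Finset.mem_insert.mp hy).resolve_left
          fun h => hyB (h ▸ hx), hyB⟩
        rw [kzD_kzHomotopy_of_eq_zero G w' hdw' hx h0, h0, sub_zero]
      · rw [kzD_kzHomotopy_of_notMem G w' hx, sub_self]
  obtain ⟨v, hv⟩ := key Finset.univ
  refine ⟨v, (sub_eq_zero.mp (funext fun B => hv B ?_)).symm⟩
  -- The complement of `B` has `t + 1` elements, so `B` misses some point of `S`.
  by_contra h
  push Not at h
  have := B.2
  rw [Set.eq_univ_of_forall fun s => h s (Finset.mem_univ s), Set.compl_univ,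
    Set.ncard_empty] at this
  omega

end KoszulCofree

/-! ### Surjections of complexes with acyclic kernel. -/

section QuasiIsomorphism

variable {k : Type u} [CommRing k]

/-- A family of elements which depends on the elements of a module extends to a morphism on the free
module generated by these elements. -/
lemma exists_refinement {A X Y : ModuleCat.{u} k} (x : A ⟶ Y) (d : X ⟶ Y)
    (P : X → Prop) (h : ∀ a : A, ∃ b, P b ∧ d.hom b = x.hom a) :
    ∃ (A' : ModuleCat.{u} k) (p : A' ⟶ A) (_ : Epi p) (x' : A' ⟶ X), p ≫ x = x' ≫ d ∧
      ∀ {Z : ModuleCat.{u} k} (e : X ⟶ Z), (∀ b, P b → e.hom b = 0) → x' ≫ e = 0 := by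
  choose b hP hb using h
  refine ⟨ModuleCat.of k (A →₀ k), ModuleCat.ofHom (Finsupp.linearCombination k id), ?_,
    ModuleCat.ofHom (Finsupp.linearCombination k b), ?_, fun e he => ?_⟩
  · rw [ModuleCat.epi_iff_surjective]
    exact fun a => ⟨Finsupp.single a 1, by simp⟩
  · ext a
    simp [hb]
  · ext a
    simp [he _ (hP a)]

/-- The hypotheses `h0` and `hn` say that the kernel of `f` is acyclic. The usual chase is made on
elements; the choices are made linear by passing to a free cover, as the criteria up to refinements
permit. -/
lemma quasiIso_of_surjective {K L : CochainComplex (ModuleCat.{u} k) ℕ} (f : K ⟶ L)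
    (hs : ∀ n, Function.Surjective (f.f n).hom)
    (h0 : ∀ x : K.X 0, (f.f 0).hom x = 0 → (K.d 0 1).hom x = 0 → x = 0)
    (hn : ∀ (n : ℕ) (x : K.X (n + 1)), (f.f (n + 1)).hom x = 0 →
      (K.d (n + 1) (n + 2)).hom x = 0 → ∃ w, (f.f n).hom w = 0 ∧ (K.d n (n + 1)).hom w = x) :
    QuasiIso f := by
  have hc : ∀ (i j : ℕ) (w : K.X i), (L.d i j).hom ((f.f i).hom w) =
      (f.f j).hom ((K.d i j).hom w) := fun i j w =>
    congrArg (fun g => g.hom w) (f.comm i j)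
  have hdd : ∀ (i j l : ℕ) (w : K.X i), (K.d j l).hom ((K.d i j).hom w) = 0 := fun i j l w =>
    congrArg (fun g => g.hom w) (K.d_comp_d i j l)
  refine ⟨fun j => ?_⟩
  rw [quasiIsoAt_iff_isIso_homologyMap]
  obtain ⟨i, hi, hker⟩ : ∃ i, (ComplexShape.up ℕ).prev j = i ∧ ∀ x : K.X j, (f.f j).hom x = 0 →
      (K.d j (j + 1)).hom x = 0 → ∃ w, (f.f i).hom w = 0 ∧ (K.d i j).hom w = x := by
    cases j with
    -- By convention the predecessor of `0` is `0` itself. Here `h0` forces `x = 0`, so `w = 0`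
    -- serves.
    | zero => exact ⟨0, CochainComplex.prev_nat_zero, fun x hx hdx => ⟨0, map_zero _, by
        rw [map_zero, h0 x hx hdx]⟩⟩
    | succ j => exact ⟨j, CochainComplex.prev_nat_succ j, hn j⟩
  have hj : (ComplexShape.up ℕ).next j = j + 1 := CochainComplex.next ℕ j
  have hmono : Mono (HomologicalComplex.homologyMap f j) := by
    rw [HomologicalComplex.mono_homologyMap_iff_up_to_refinements _ i j (j + 1) hi hj]
    intro A x₂ hx₂ y₁ hy₁
    obtain ⟨A', p, hp, x', hx', -⟩ := exists_refinement x₂ (K.d i j) (fun _ => True) fun a => by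
      -- Subtracting the differential of a lift of the bounding element leaves a cocycle of the
      -- kernel, which is a coboundary.
      obtain ⟨u, hu⟩ := hs i (y₁.hom a)
      have h1 : (f.f j).hom (x₂.hom a - (K.d i j).hom u) = 0 := by
        rw [map_sub, ← hc, hu, sub_eq_zero]
        exact congrArg (fun g => g.hom a) hy₁
      have h2 : (K.d j (j + 1)).hom (x₂.hom a - (K.d i j).hom u) = 0 := by
        rw [map_sub, hdd, sub_zero]
        exact congrArg (fun g => g.hom a) hx₂
      obtain ⟨w, -, hw⟩ := hker _ h1 h2
      exact ⟨w + u, trivial, by rw [map_add, hw, sub_add_cancel]⟩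
    exact ⟨A', p, hp, x', hx'⟩
  have hepi : Epi (HomologicalComplex.homologyMap f j) := by
    rw [HomologicalComplex.epi_homologyMap_iff_up_to_refinements _ i j (j + 1) hi hj]
    intro A y₂ hy₂
    -- The differential of an arbitrary lift is a cocycle of the kernel, hence `d w` with `w` in the
    -- kernel, and subtracting `w` makes the lift a cocycle. The predicate carries this cocycle
    -- condition over to the free cover.
    obtain ⟨A', p, hp, x', hx', he⟩ := exists_refinement y₂ (f.f j)
      (fun x => (K.d j (j + 1)).hom x = 0) fun a => by
        obtain ⟨x, hx⟩ := hs j (y₂.hom a)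
        have h1 : (f.f (j + 1)).hom ((K.d j (j + 1)).hom x) = 0 := by
          rw [← hc, hx]
          exact congrArg (fun g => g.hom a) hy₂
        obtain ⟨w, hw, hw'⟩ := hn j _ h1 (hdd _ _ _ x)
        exact ⟨x - w, by rw [map_sub, hw', sub_self], by rw [map_sub, hw, sub_zero, hx]⟩
    exact ⟨A', p, hp, x', he _ fun _ h => h, 0, by rw [zero_comp, add_zero, hx']⟩
  exact isIso_of_mono_of_epi _

end QuasiIsomorphism

/-! ### Acyclicity of the kernel of the projection. -/

section Kernel

variable {k : Type u} [CommRing k]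

/-- The map `⊥ⁿ F (S) → Kzⁿ F (S)`. -/
noncomputable def projAt (F : FIopMod k) (n : ℕ) (S : Sigᵒᵖ) :
    (iter (perp k) (comod F).A n).obj S →ₗ[k] KzTerm F S.unop n :=
  ((proj F n).app S).hom

/-- The differential of the unnormalized complex of `(ℭF)ᵒᵖ` at `S`. -/
noncomputable def altAt (F : FIopMod k) (n : ℕ) (S : Sigᵒᵖ) :
    (iter (perp k) (comod F).A n).obj S →ₗ[k] (iter (perp k) (comod F).A (n + 1)).obj S :=
  (((oppCobar F).alt n).app S).hom

/-- The map on `⊥ⁿ F (S)` induced by a morphism of the underlying `𝚺ᵒᵖ`-modules. -/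
noncomputable def iterAt {F H : FIopMod k} (φ : (down k).obj F ⟶ (down k).obj H) (n : ℕ)
    (S : Sigᵒᵖ) :
    (iter (perp k) (comod F).A n).obj S →ₗ[k] (iter (perp k) (comod H).A n).obj S :=
  ((iterMap (perp k) φ n).app S).hom

lemma projAt_altAt (F : FIopMod k) (n : ℕ) (S : Sigᵒᵖ) (z) :
    projAt F (n + 1) S (altAt F n S z) = kzD F S.unop n (projAt F n S z) :=
  congrArg (fun g => (g.app S).hom z) (alt_proj F n)

lemma altAt_altAt (F : FIopMod k) (n : ℕ) (S : Sigᵒᵖ) (z) :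
    altAt F (n + 1) S (altAt F n S z) = 0 :=
  congrArg (fun g => (g.app S).hom z) ((oppCobar F).alt_alt n)

lemma projAt_iterAt {F H : FIopMod k} (φ : (down k).obj F ⟶ (down k).obj H) (n : ℕ)
    (S : Sigᵒᵖ) (z) : projAt H n S (iterAt φ n S z) = kzSig φ S.unop n (projAt F n S z) :=
  congrArg (fun g => (g.app S).hom z) (iterMap_proj φ n)

lemma altAt_iterAt {F H : FIopMod k} (φ : F ⟶ H) (n : ℕ) (S : Sigᵒᵖ) (z) :
    altAt H n S (iterAt ((down k).map φ) n S z) =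
      iterAt ((down k).map φ) (n + 1) S (altAt F n S z) :=
  (congrArg (fun g => (g.app S).hom z) (Cosimplicial.alt_f (A := oppCobar F) (B := oppCobar H)
    (Cosimplicial.oppFunctor.map ((cobarFI k).map φ)) n)).symm

lemma iterAt_id (F : FIopMod k) (n : ℕ) (S : Sigᵒᵖ) (z) :
    iterAt (𝟙 ((down k).obj F)) n S z = z :=
  congrArg (fun g => (g.app S).hom z) (iterMap_id (perp k) ((down k).obj F) n)

lemma iterAt_comp {F H J : FIopMod k} (φ : (down k).obj F ⟶ (down k).obj H)
    (ψ : (down k).obj H ⟶ (down k).obj J) (n : ℕ) (S : Sigᵒᵖ) (z) :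
    iterAt (φ ≫ ψ) n S z = iterAt ψ n S (iterAt φ n S z) :=
  congrArg (fun g => (g.app S).hom z) (iterMap_comp (perp k) φ ψ n)

/-- Additivity transfers the splitting identity of a short exact sequence from `𝚺ᵒᵖ`-modules to the
iterates `⊥ⁿ`. -/
lemma iterMap_add {Y Z : SigopMod k} (f g : Y ⟶ Z) (n : ℕ) :
    iterMap (perp k) (f + g) n = iterMap (perp k) f n + iterMap (perp k) g n := by
  induction n with
  | zero => rfl
  | succ n ih => exact (congrArg (perp k).map ih).trans (module_ext fun _ _ => rfl)

lemma iterAt_add {F H : FIopMod k} (φ ψ : (down k).obj F ⟶ (down k).obj H) (n : ℕ) (S : Sigᵒᵖ)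
    (z) : iterAt (φ + ψ) n S z = iterAt φ n S z + iterAt ψ n S z :=
  congrArg (fun g => (g.app S).hom z) (iterMap_add φ ψ n)

lemma IsNorm.altAt {F : FIopMod k} {n : ℕ} {S : Sigᵒᵖ} {z} (h : IsNorm (comod F).A n S z) :
    IsNorm (comod F).A (n + 1) S (FIop.altAt F n S z) := by
  obtain ⟨y, rfl⟩ := h.exists_normι_eq
  have h1 := congrArg (fun g => (g.app S).hom y) ((oppCobar F).normD_ι n)
  exact (congrArg (IsNorm (comod F).A (n + 1) S) h1).mp (IsNorm.normι F _)

lemma IsNorm.iterAt {F H : FIopMod k} (φ : (down k).obj F ⟶ (down k).obj H) {n : ℕ}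
    {S : Sigᵒᵖ} {z} (h : IsNorm (comod F).A n S z) :
    IsNorm (comod H).A n S (FIop.iterAt φ n S z) :=
  IsNorm.iterMap φ h

/-- The kernel of `N((ℭF)ᵒᵖ) → Kz F` at `S`. -/
def KerAt (F : FIopMod k) (n : ℕ) (S : Sigᵒᵖ) (z : (iter (perp k) (comod F).A n).obj S) : Prop :=
  IsNorm (comod F).A n S z ∧ projAt F n S z = 0

lemma KerAt.sub {F : FIopMod k} {n : ℕ} {S : Sigᵒᵖ} {z z'} (h : KerAt F n S z)
    (h' : KerAt F n S z') : KerAt F n S (z - z') :=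
  ⟨h.1.sub h'.1, by rw [map_sub, h.2, h'.2, sub_zero]⟩

lemma KerAt.altAt {F : FIopMod k} {n : ℕ} {S : Sigᵒᵖ} {z} (h : KerAt F n S z) :
    KerAt F (n + 1) S (FIop.altAt F n S z) :=
  ⟨h.1.altAt, by rw [projAt_altAt, h.2, map_zero]⟩

lemma KerAt.iterAt {F H : FIopMod k} (φ : (down k).obj F ⟶ (down k).obj H) {n : ℕ}
    {S : Sigᵒᵖ} {z} (h : KerAt F n S z) : KerAt H n S (FIop.iterAt φ n S z) :=
  ⟨h.1.iterAt φ, by rw [projAt_iterAt, h.2, map_zero]⟩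

/-- In degree `0` the projection is the isomorphism of `F` with `Kz⁰ F`. -/
lemma KerAt.eq_zero {F : FIopMod k} {S : Sigᵒᵖ} {z} (h : KerAt F 0 S z) : z = 0 :=
  (kzZero_bijective F S.unop).1 (h.2.trans (map_zero (kzZero F S.unop)).symm)

/-- The extra codegeneracy at `S`, for a cofree module. -/
noncomputable def extraAt (G : SigopMod k) (n : ℕ) (S : Sigᵒᵖ) :
    (iter (perp k) (comod (up.obj G)).A (n + 1)).obj S →ₗ[k]
      (iter (perp k) (comod (up.obj G)).A n).obj S :=
  ((extra (perp k) G n).app S).hom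

lemma extraAt_altAt (G : SigopMod k) (n : ℕ) (S : Sigᵒᵖ) (z) :
    extraAt G (n + 1) S (altAt (up.obj G) (n + 1) S z) +
      altAt (up.obj G) n S (extraAt G n S z) = z := by
  have h := (oppCobar (up.obj G)).alt_comp_add_comp_alt (extra (perp k) G) (n := n)
    (cobarD_last_extra (coaug k) G (n + 1)) fun i => by
      refine Eq.trans ?_ (cobarD_castSucc_extra (coaug k) G n i.rev)
      exact congrArg (fun j => cobarD (coaug k) (comod (up.obj G)) (n + 1) j ≫
        extra (perp k) G (n + 1)) (Fin.rev_succ i)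
  exact congrArg (fun g => (g.app S).hom z) h

lemma exists_altAt_eq_of_cofree (G : SigopMod k) (n : ℕ) (S : Sigᵒᵖ) (z)
    (hz : IsNorm (comod (up.obj G)).A (n + 1) S z) (hd : altAt (up.obj G) (n + 1) S z = 0) :
    ∃ w, IsNorm (comod (up.obj G)).A n S w ∧ altAt (up.obj G) n S w = z := by
  refine ⟨extraAt G n S z, IsNorm.extra hz, ?_⟩
  have h := extraAt_altAt G n S z
  rwa [hd, map_zero, zero_add] at h

lemma kzGen_erase_injective (F : FIopMod k) {S : Type} [Finite S] {t : ℕ} (B : KzIndex S (t + 1))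
    (x : (B.1ᶜ : Set S)) :
    Function.Injective (kzGen F t (eraseEmb B x) (eraseCompl B x) x) := by
  let e := LinearEquiv.ofBijective _ (pull_bijective F _ (eraseEmb_surjective B x))
  let e' := LinearEquiv.ofBijective (wedge (k := k) t x ∘ₗ orientMap t (eraseCompl B x))
    ⟨wedge_orientMap_injective t x _ (fun _ _ h => Subtype.ext (Subtype.ext
        (congrArg (fun c => c.1) h))) fun u h => u.1.2 (congrArg Subtype.val h),
      wedge_orientMap_surjective t x _ (eraseCompl_surjective B x) B.2⟩
  exact (TensorProduct.congr e e').injective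

attribute [local instance] Fintype.ofFinite

/-- An element of `F(S)` which is a cocycle of the Koszul complex is killed by all the restrictions
to proper subsets. -/
lemma pull_eq_zero_of_kzD (F : FIopMod k) {S : Type} [Finite S] (y : F.obj (op ⟨S⟩))
    (hy : kzD F S 0 (kzZero F S y) = 0) {A : Set S} (hA : A ≠ Set.univ) :
    pull F (Function.Embedding.subtype (· ∈ A)) y = 0 := by
  obtain ⟨x, hx⟩ := (Set.ne_univ_iff_exists_notMem A).mp hA
  -- The component of the Koszul differential at `S ∖ {x}` consists of one term, the restriction of
  -- `y` wedged with `x`, and the wedge is injective. Since `A` misses `x`, the restriction of `y`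
  -- to `A` factors through `S ∖ {x}`.
  let B : KzIndex S 1 := ⟨{x}ᶜ, by rw [compl_compl, Set.ncard_singleton]⟩
  have hxB : x ∈ B.1ᶜ := fun h => h rfl
  have hB (y : (B.1ᶜ : Set S)) : y.1 = x := by_contra fun h => y.2 h
  have h1 := congrFun hy B
  rw [← rhoMap_kzZero, rhoMap_apply, pow_zero, one_smul] at h1
  have h2 := (Finset.sum_eq_single (s := Finset.univ) (⟨x, hxB⟩ : (B.1ᶜ : Set S))
    (fun y _ hy => absurd (Subtype.ext (hB y)) hy)
    fun h => absurd (Finset.mem_univ _) h).symm.trans h1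
  have h3 := kzGen_erase_injective F B ⟨x, hxB⟩ (h2.trans (map_zero _).symm)
  have h4 : pull F (Function.Embedding.subtype (· ∈ ({x}ᶜ : Set S))) y = 0 := by
    refine (kzZero_bijective F _).1 (Eq.trans (funext fun C => ?_) (map_zero _).symm)
    obtain rfl : C = B.erase ⟨x, hxB⟩ := Subtype.ext (C.eq_univ.trans (KzIndex.eq_univ _).symm)
    exact h3
  have h5 := pull_pull F (Set.embeddingOfSubset A {x}ᶜ fun a ha h => hx (h ▸ ha))
    (Function.Embedding.subtype (· ∈ ({x}ᶜ : Set S))) y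
  rw [h4, map_zero] at h5
  exact h5.symm

lemma Cosimplicial.alt_zero {C : Type u} [Category.{v} C] [Abelian C] (A : Cosimplicial C) :
    A.alt 0 = A.d 0 - A.d 1 := by
  change ∑ i : Fin 2, (-1 : ℤ) ^ (i : ℕ) • A.d i = _
  rw [Fin.sum_univ_two, Fin.val_zero, Fin.val_one, pow_zero, pow_one,
    one_smul, neg_one_zsmul, ← sub_eq_add_neg]

/-- The differential in degree `0` is `ψ - η`. Here `ψ y` lists all restrictions of `y`, while `η y`
has only the component `y` at `S`, so they agree once the restrictions to proper subsets vanish. -/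
lemma altAt_zero_eq_zero (F : FIopMod k) (S : Sigᵒᵖ) (y)
    (hy : kzD F S.unop 0 (projAt F 0 S y) = 0) : altAt F 0 S y = 0 := by
  let η : (down k).obj F ⟶ (perp k).obj ((down k).obj F) := (coaug k).η.app ((down k).obj F)
  let ψ : (down k).obj F ⟶ (perp k).obj ((down k).obj F) := (comod F).a
  have h : altAt F 0 S y = (ψ.app S).hom y - (η.app S).hom y :=
    congrArg (fun g => (g.app S).hom y) (oppCobar F).alt_zero
  refine h.trans (sub_eq_zero.mpr ?_)
  refine funext fun A : Set S.unop => ?_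
  by_cases hA : A = Set.univ
  · subst hA
    exact (incl_univ ((down k).obj F) y).symm
  · exact (pull_eq_zero_of_kzD F y hy hA).trans (incl_of_ne ((down k).obj F) y hA).symm

/-- A normalized primitive `w` of `z` projects to a Koszul cocycle. In positive degree that cocycle
is a coboundary, and subtracting the differential of a normalized lift of its primitive puts `w` in
the kernel. In degree `0` the cocycle condition already forces the differential of `w` to vanish. -/
lemma exists_kerAt_of_cofree (G : SigopMod k) (n : ℕ) (S : Sigᵒᵖ) (z)
    (hz : KerAt (up.obj G) (n + 1) S z) (hd : altAt (up.obj G) (n + 1) S z = 0) :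
    ∃ w, KerAt (up.obj G) n S w ∧ altAt (up.obj G) n S w = z := by
  obtain ⟨w, hw, rfl⟩ := exists_altAt_eq_of_cofree G n S z hz.1 hd
  have h1 : kzD (up.obj G) S.unop n (projAt (up.obj G) n S w) = 0 := by
    rw [← projAt_altAt, hz.2]
  cases n with
  | zero =>
    rw [altAt_zero_eq_zero _ S w h1]
    exact ⟨0, ⟨trivial, map_zero _⟩, map_zero _⟩
  | succ n =>
    obtain ⟨v, hv⟩ := exists_kzD_eq G _ h1
    obtain ⟨u, hu, rfl⟩ := IsNorm.exists_proj_eq (up.obj G) n S v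
    refine ⟨w - altAt (up.obj G) n S u, ⟨hw.sub hu.altAt, ?_⟩, ?_⟩
    · rw [map_sub, projAt_altAt, ← hv]
      exact sub_self _
    · rw [map_sub, altAt_altAt, sub_zero]

/-- Every `𝐅𝐈ᵒᵖ`-module embeds in a cofree one, and the embedding splits as a morphism of
`𝚺ᵒᵖ`-modules. -/
lemma exists_cofree_embedding (F : FIopMod k) :
    ∃ (G : SigopMod k) (Q : FIopMod k) (i : F ⟶ up.obj G) (q : up.obj G ⟶ Q)
      (r : (down k).obj (up.obj G) ⟶ (down k).obj F)
      (s : (down k).obj Q ⟶ (down k).obj (up.obj G)), i ≫ q = 0 ∧ (down k).map i ≫ r = 𝟙 _ ∧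
      s ≫ (down k).map q = 𝟙 _ ∧ r ≫ (down k).map i + (down k).map q ≫ s = 𝟙 _ := by
  let i := (adj k).unit.app F
  -- The retraction of the unit is the counit at `↓F`, by a triangle identity. It is a morphism over
  -- `𝚺` only.
  have hir : (down k).map i ≫ (adj k).counit.app ((down k).obj F) = 𝟙 _ :=
    (adj k).left_triangle_components F
  let T : ShortComplex (FIopMod k) := ShortComplex.mk i (cokernel.π i) (cokernel.condition i)
  have hT : T.Exact := T.exact_of_g_is_cokernel (cokernelIsCokernel i)
  have hT' : (T.map (down k)).Exact := hT.map (down k)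
  have : Epi (T.map (down k)).g := inferInstanceAs (Epi ((down k).map (cokernel.π i)))
  let σ := ShortComplex.Splitting.ofExactOfRetraction (T.map (down k)) hT' _ hir this
  exact ⟨_, _, i, cokernel.π i, σ.r, σ.s, cokernel.condition i, σ.f_r, σ.s_g, σ.id⟩

lemma iterAt_map_zero (F H : FIopMod k) (n : ℕ) (S : Sigᵒᵖ) (z) :
    iterAt ((down k).map (0 : F ⟶ H)) n S z = 0 := by
  have h := iterAt_add ((down k).map (0 : F ⟶ H)) ((down k).map (0 : F ⟶ H)) n S z
  rw [← Functor.map_add, add_zero] at h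
  exact left_eq_add.mp h

/-- The splitting gives `i (r w) = w`, because `q w = 0`. The map `r` need not commute with the
differential, but `i` does and is split injective on terms, so `d (r w) = z` can be checked after
applying `i`. -/
lemma exists_kerAt_of_retract {F H Q : FIopMod k} {i : F ⟶ H} {q : H ⟶ Q}
    {r : (down k).obj H ⟶ (down k).obj F} {s : (down k).obj Q ⟶ (down k).obj H}
    (hir : (down k).map i ≫ r = 𝟙 _) (hid : r ≫ (down k).map i + (down k).map q ≫ s = 𝟙 _)
    {n : ℕ} {S : Sigᵒᵖ} {z w} (hw : KerAt H n S w)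
    (hwz : altAt H n S w = iterAt ((down k).map i) (n + 1) S z)
    (hq : iterAt ((down k).map q) n S w = 0) : ∃ w', KerAt F n S w' ∧ altAt F n S w' = z := by
  have hri (x) : iterAt r (n + 1) S (iterAt ((down k).map i) (n + 1) S x) = x := by
    rw [← iterAt_comp, hir, iterAt_id]
  have h : iterAt ((down k).map i) n S (iterAt r n S w) = w := by
    conv_rhs => rw [← iterAt_id H n S w, ← hid, iterAt_add, iterAt_comp, iterAt_comp, hq,
      map_zero, add_zero]
  refine ⟨iterAt r n S w, hw.iterAt r, ?_⟩
  rw [← hri (altAt F n S _), ← altAt_iterAt, h, hwz, hri]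

/-- Dimension shifting: the cofree case gives a primitive `w` of `i z`, and `q w` is a cocycle of
the kernel for `Q` one degree lower. If that degree is `0`, then `q w = 0`. Otherwise `q w = d v` by
induction. -/
lemma exists_kerAt (F : FIopMod k) (n : ℕ) (S : Sigᵒᵖ) (z)
    (hz : KerAt F (n + 1) S z) (hd : altAt F (n + 1) S z = 0) :
    ∃ w, KerAt F n S w ∧ altAt F n S w = z := by
  induction n generalizing F with
  | zero =>
    obtain ⟨G, Q, i, q, r, s, -, hir, -, hid⟩ := exists_cofree_embedding F
    obtain ⟨w, hw, hwz⟩ := exists_kerAt_of_cofree G 0 S _ (hz.iterAt ((down k).map i))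
      (by rw [altAt_iterAt, hd, map_zero])
    exact exists_kerAt_of_retract hir hid hw hwz (hw.iterAt ((down k).map q)).eq_zero
  | succ n ih =>
    obtain ⟨G, Q, i, q, r, s, hiq, hir, hsq, hid⟩ := exists_cofree_embedding F
    obtain ⟨w, hw, hwz⟩ := exists_kerAt_of_cofree G (n + 1) S _ (hz.iterAt ((down k).map i))
      (by rw [altAt_iterAt, hd, map_zero])
    obtain ⟨v, hv, hvw⟩ := ih Q _ (hw.iterAt ((down k).map q)) (by
      rw [altAt_iterAt, hwz, ← iterAt_comp, ← Functor.map_comp, hiq, iterAt_map_zero])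
    -- Although `s` does not respect the differential, `q` does, so `q (d (s v)) = d (q (s v)) = d
    -- v`. Hence `w - d (s v)` is killed by `q` and has the same differential as `w`.
    refine exists_kerAt_of_retract hir hid (hw.sub (hv.iterAt s).altAt) ?_ ?_
    · rw [map_sub, altAt_altAt, sub_zero, hwz]
    · rw [map_sub, ← altAt_iterAt, ← iterAt_comp, hsq, iterAt_id, hvw, sub_self]

lemma eq_zero_of_koszulProj (F : FIopMod k) {S : Sigᵒᵖ} (y : ((oppCobar F).normX 0).obj S)
    (hy : projAt F 0 S ((((oppCobar F).normι 0).app S).hom y) = 0) : y = 0 :=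
  (oppCobar F).normι_injective 0 S
    ((KerAt.eq_zero (F := F) ⟨IsNorm.normι F y, hy⟩).trans (map_zero _).symm)

lemma exists_normD_eq (F : FIopMod k) (n : ℕ) {S : Sigᵒᵖ}
    (y : ((oppCobar F).normX (n + 1)).obj S)
    (hy : projAt F (n + 1) S ((((oppCobar F).normι (n + 1)).app S).hom y) = 0)
    (hdy : (((oppCobar F).normD (n + 1)).app S).hom y = 0) :
    ∃ w, projAt F n S ((((oppCobar F).normι n).app S).hom w) = 0 ∧
      (((oppCobar F).normD n).app S).hom w = y := by
  have hι (m : ℕ) (x : ((oppCobar F).normX m).obj S) :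
      (((oppCobar F).normι (m + 1)).app S).hom ((((oppCobar F).normD m).app S).hom x) =
        altAt F m S ((((oppCobar F).normι m).app S).hom x) :=
    congrArg (fun g => (g.app S).hom x) ((oppCobar F).normD_ι m)
  obtain ⟨w, hw, hwy⟩ := exists_kerAt F n S _ ⟨IsNorm.normι F y, hy⟩
    ((hι (n + 1) y).symm.trans ((congrArg _ hdy).trans (map_zero _)))
  obtain ⟨x, rfl⟩ := hw.1.exists_normι_eq
  exact ⟨x, hw.2, (oppCobar F).normι_injective (n + 1) S ((hι n x).trans hwy)⟩

lemma normCobar_d (F : FIopMod k) (n : ℕ) :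
    ((normCobar k).obj F).d n (n + 1) = (oppCobar F).normD n :=
  CochainComplex.of_d _ _ _

lemma exists_d_eq_of_koszulProj (F : FIopMod k) (n : ℕ) {S : Sigᵒᵖ}
    (y : (((normCobar k).obj F).X (n + 1)).obj S)
    (hy : ((((koszulProj k).app F).f (n + 1)).app S).hom y = 0)
    (hdy : ((((normCobar k).obj F).d (n + 1) (n + 2)).app S).hom y = 0) :
    ∃ w, ((((koszulProj k).app F).f n).app S).hom w = 0 ∧
      ((((normCobar k).obj F).d n (n + 1)).app S).hom w = y := by
  rw [normCobar_d] at hdy ⊢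
  exact exists_normD_eq F n y hy hdy

end Kernel

end FIop

/-- There is a morphism of complexes of `𝚺ᵒᵖ`-modules from `N((ℭF)ᵒᵖ)` to `Kz F`, natural in the
`𝐅𝐈ᵒᵖ`-module `F`, which is surjective and a quasi-isomorphism for every `F`. -/
theorem mainTheorem6 (k : Type u) [CommRing k] :
    ∃ π : FIop.normCobar k ⟶ FIop.kzFunctor k, ∀ F : FIop.FIopMod k,
      (∀ (t : ℕ) (S : FIop.Sigᵒᵖ), Function.Surjective (((π.app F).f t).app S).hom) ∧
        QuasiIso (π.app F) := by
  refine ⟨FIop.koszulProj k, fun F => ⟨fun t S => FIop.koszulProj_surjective F t S, ?_⟩⟩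
  -- Homology of complexes of functors is computed objectwise, which reduces the claim to complexes
  -- of modules.
  rw [HomologicalComplex.quasiIso_iff_evaluation]
  exact fun S => FIop.quasiIso_of_surjective _ (fun n => FIop.koszulProj_surjective F n S)
    (fun y hy _ => FIop.eq_zero_of_koszulProj F y hy)
    fun n y hy hdy => FIop.exists_d_eq_of_koszulProj F n y hy hdy
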